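/- **Lemma 4.10.** Let $M$ be a positive definite even integral lattice of dimension $s\ge 1$, identified with $\mathbb Z^s$ through a basis, with Gram matrix $S$; write $(x,y)={}^t\!xSy$ and $S[x]={}^t\!xSx$ (so $S[x]\in 2\mathbb Z$ for $x\in M$), and let $\widehat M=\{\ell\in M\otimes\mathbb Q : (\ell,\alpha)\in\mathbb Z\ \forall \alpha\in M\}$. For an integer $m\ge 0$ put $G_m(M):=\widehat M/mM$, with the quadratic form $q_{m,M}:G_m(M)\to\mathbb Q/2\mathbb Z$ given by $q_{m,M}(h+mM)=\frac{(h,h)}{m}+2\mathbb Z$ if $m\ge1$, and by $q_{0,M}(h)=(h,h)+2\mathbb Z$ if $m=0$. For $k\in\mathbb Z$ let $J_{k,m}(\Gamma^J_M)$ be the complex vector space of holomorphic functions $\phi:H_1\times\mathbb C^s\to\mathbb C$ ($H_1$ the upper half plane) such that: (a) $\phi|_{k,m}\gamma=\phi$ for all $\gamma\in\Gamma^J_M$. Here $\Gamma^J_M$ is the group of those elements of the real Jacobi group $G^J_{\mathbb R}\subset O(s+2,2)$ of the lattice $\Pi_{1,1}\oplus M\oplus\Pi_{1,1}$ that map this lattice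 onto itself; $G^J_{\mathbb R}$ is generated by the elements $\{A\}$, $A=\begin{pmatrix}a&b\\c&d\end{pmatrix}\in SL(2,\mathbb R)$, and the Heisenberg elements $\{x,y;r\}$, $x,y\in\mathbb R^s$, $r\in\mathbb R$. The action $(\phi|_{k,m}g)(\tau,z)=J_{k,m}(g,(\tau,z))^{-1}\phi(g\langle(\tau,z)\rangle)$ is determined by $$\{A\}\langle(\tau,z)\rangle=\Big(\tfrac{a\tau+b}{c\tau+d},\tfrac{z}{c\tau+d}\Big),\qquad J_{k,m}(\{A\},(\tau,z))=(c\tau+d)^k e^{\pi i m\frac{cS[z]}{c\tau+d}},$$ $$\{x,y;r\}\langle(\tau,z)\rangle=(\tau,z+x\tau+y),\qquad J_{k,m}(\{x,y;r\},(\tau,z))=e^{-2\pi i m(r+{}^t\!xSz+\frac12S[x]\tau)}$$ and by the requirement that $J_{k,m}$ be an automorphic factor. (b) $\phi$ has a Fourier expansion $\phi(\tau,z)=\sum_{n\in\mathbb Z}\sum_{\ell\in\widehat M}c(n,\ell)e^{2\pi i(n\tau+{}^t\!\ell Sz)}$ with $c(n,\ell)\ne0$ only if $2nm-S[\ell]\ge0$.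 For $m\ge1$ and $h\in G_m(M)$ let $$\vartheta_{M,m,h}(\tau,z)=\sum_{\ell\in M}e^{\pi i m\left(S[\ell+\frac hm]\tau+2\,{}^t(\ell+\frac hm)Sz\right)}.$$ Now let $M_1$ and $M_2$ be positive definite even integral lattices of dimensions $s_1,s_2\ge1$, let $m_1,m_2\ge0$ and $k$ be integers, and let $\sigma:G_{m_1}(M_1)\to G_{m_2}(M_2)$ be a group isomorphism with $q_{m_2,M_2}\circ\sigma=q_{m_1,M_1}$. Then $k+\frac{s_2-s_1}{2}$ is an integer, and there is an isomorphism of complex vector spaces $$J_{k,m_1}(\Gamma^J_{M_1})\;\cong\;J_{k+\frac{s_2-s_1}{2},\,m_2}(\Gamma^J_{M_2}).$$ If moreover $m_1\ge1$, it may be taken to be the map that swaps the theta functions: every $\phi\in J_{k,m_1}(\Gamma^J_{M_1})$ can be written as $\phi(\tau,z)=\sum_{h\in G_{m_1}(M_1)}\Phi_h(\tau)\,\vartheta_{M_1,m_1,h}(\tau,z)$ with exactly one family of functions $\Phi_h:H_1\to\mathbb C$, and the isomorphism sends $\phi$ to $\sum_{h\in G_{m_1}(M_1)}\Phi_h(\tau)\,\vartheta_{M_2,m_2,\sigma(h)}(\tau,z)$.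 -/

import Mathlib

open scoped Matrix

noncomputable section

/-- A positive definite even integral lattice of dimension `s`, in coordinates: the lattice is
`ℤ^s` and its bilinear form is `(x, y) = ᵗx S y` with Gram matrix `S`, so that
`(x, x) = S[x] ∈ 2ℤ` for all `x ∈ ℤ^s`. -/
structure EvenLattice (s : ℕ) where
  gram : Matrix (Fin s) (Fin s) ℤ
  isSymm : gram.IsSymm
  even_diag : ∀ i, Even (gram i i)
  posDef : (gram.map (Int.cast : ℤ → ℝ)).PosDef

namespace EvenLattice

variable {s : ℕ}

/-- The bilinear form `(x, y) = ᵗx S y` over a ring of scalars `R`; `S[x]` is `L.bil R x x`. -/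
def bil (L : EvenLattice s) (R : Type) [CommRing R] (x y : Fin s → R) : R :=
  x ⬝ᵥ (L.gram.map (Int.cast : ℤ → R) *ᵥ y)

lemma bil_add_left (L : EvenLattice s) (R : Type) [CommRing R] (x x' y : Fin s → R) :
    L.bil R (x + x') y = L.bil R x y + L.bil R x' y := by
  simp [bil, add_dotProduct]

lemma bil_add_right (L : EvenLattice s) (R : Type) [CommRing R] (x y y' : Fin s → R) :
    L.bil R x (y + y') = L.bil R x y + L.bil R x y' := by
  simp [bil, Matrix.mulVec_add, dotProduct_add]

lemma bil_smul_left (L : EvenLattice s) (R : Type) [CommRing R] (a : R) (x y : Fin s → R) :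
    L.bil R (a • x) y = a * L.bil R x y := by
  simp [bil, smul_dotProduct]

lemma bil_smul_right (L : EvenLattice s) (R : Type) [CommRing R] (a : R) (x y : Fin s → R) :
    L.bil R x (a • y) = a * L.bil R x y := by
  simp [bil, Matrix.mulVec_smul, dotProduct_smul]

lemma bil_neg_left (L : EvenLattice s) (R : Type) [CommRing R] (x y : Fin s → R) :
    L.bil R (-x) y = -L.bil R x y := by
  simp [bil]

lemma bil_comm (L : EvenLattice s) (R : Type) [CommRing R] (x y : Fin s → R) :
    L.bil R x y = L.bil R y x := by
  have h : (L.gram.map (Int.cast : ℤ → R))ᵀ = L.gram.map (Int.cast : ℤ → R) := by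
    rw [← Matrix.transpose_map, L.isSymm.eq]
  unfold bil
  rw [Matrix.dotProduct_mulVec, ← Matrix.mulVec_transpose, h, dotProduct_comm]

lemma bil_intCast (L : EvenLattice s) (R : Type) [CommRing R] (x y : Fin s → ℤ) :
    L.bil R (fun i => (x i : R)) (fun i => (y i : R)) = ((L.bil ℤ x y : ℤ) : R) := by
  simp [bil, dotProduct, Matrix.mulVec]

lemma even_bil_self (L : EvenLattice s) (x : Fin s → ℤ) : Even (L.bil ℤ x x) := by
  have key : ∀ t : Finset (Fin s), ∀ y : Fin s → ℤ, (∀ i, i ∉ t → y i = 0) →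
      Even (L.bil ℤ y y) := by
    intro t
    induction t using Finset.induction_on with
    | empty =>
      intro y hy
      have : y = 0 := by funext i; exact hy i (by simp)
      subst this
      simp [bil]
    | insert a t ha ih =>
      intro y hy
      have hdec : y = Function.update y a 0 + Pi.single a (y a) := by
        funext i
        by_cases h : i = a
        · subst h; simp
        · simp [h]
      have h1 : Even (L.bil ℤ (Function.update y a 0) (Function.update y a 0)) := by
        apply ih
        intro i hi
        by_cases h : i = a
        · subst h; simp
        · simp [h]
          exact hy i (by simp [h, hi])
      have h2 : Even (L.bil ℤ (Pi.single a (y a)) (Pi.single a (y a))) := by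
        have : L.bil ℤ (Pi.single a (y a)) (Pi.single a (y a)) = y a * y a * L.gram a a := by
          simp [bil]; ring
        rw [this]
        exact (L.even_diag a).mul_left _
      rw [hdec, bil_add_left, bil_add_right, bil_add_right,
        L.bil_comm ℤ (Pi.single a (y a)) (Function.update y a 0)]
      obtain ⟨u, hu⟩ := h1
      obtain ⟨v, hv⟩ := h2
      exact ⟨u + v + L.bil ℤ (Function.update y a 0) (Pi.single a (y a)), by rw [hu, hv]; ring⟩
  exact key Finset.univ x (by simp)

/-! ### The discriminant group and its quadratic form -/

/-- The dual lattice `{ℓ ∈ L ⊗ ℚ | (ℓ, α) ∈ ℤ for all α ∈ L}`. -/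
def dual (L : EvenLattice s) : AddSubgroup (Fin s → ℚ) where
  carrier := {ℓ | ∀ α : Fin s → ℤ, ∃ n : ℤ, L.bil ℚ ℓ (fun i => (α i : ℚ)) = n}
  zero_mem' := fun α => ⟨0, by simp [bil]⟩
  add_mem' := by
    intro x y hx hy α
    obtain ⟨a, ha⟩ := hx α
    obtain ⟨b, hb⟩ := hy α
    exact ⟨a + b, by rw [bil_add_left, ha, hb]; push_cast; rfl⟩
  neg_mem' := by
    intro x hx α
    obtain ⟨a, ha⟩ := hx α
    exact ⟨-a, by rw [bil_neg_left, ha]; push_cast; rfl⟩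

/-- The sublattice `m L`, viewed inside `L ⊗ ℚ`. -/
def multiple (_L : EvenLattice s) (m : ℕ) : AddSubgroup (Fin s → ℚ) where
  carrier := {v | ∃ α : Fin s → ℤ, v = fun i => (m : ℚ) * (α i : ℚ)}
  zero_mem' := ⟨0, by funext i; simp⟩
  add_mem' := by
    rintro _ _ ⟨a, rfl⟩ ⟨b, rfl⟩
    exact ⟨a + b, by funext i; simp; ring⟩
  neg_mem' := by
    rintro _ ⟨a, rfl⟩
    exact ⟨-a, by funext i; simp⟩

/-- The discriminant group `G_m(L)`: the quotient of the dual lattice by `m L`. -/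
abbrev discGroup (L : EvenLattice s) (m : ℕ) : Type :=
  L.dual ⧸ (L.multiple m).addSubgroupOf L.dual

lemma exists_of_rel (L : EvenLattice s) (m : ℕ) (h h' : L.dual)
    (hr : (QuotientAddGroup.leftRel ((L.multiple m).addSubgroupOf L.dual)).r h h') :
    ∃ α : Fin s → ℤ,
      (h' : Fin s → ℚ) = (h : Fin s → ℚ) + (m : ℚ) • (fun i => (α i : ℚ)) := by
  have h1 : -h + h' ∈ (L.multiple m).addSubgroupOf L.dual := QuotientAddGroup.leftRel_apply.mp hr
  obtain ⟨α, hα⟩ := AddSubgroup.mem_addSubgroupOf.mp h1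
  refine ⟨α, ?_⟩
  funext i
  have := congrFun hα i
  simp only [AddSubgroup.coe_add, AddSubgroup.coe_neg, Pi.add_apply, Pi.neg_apply] at this
  simp only [Pi.add_apply, Pi.smul_apply, smul_eq_mul]
  linarith

/-- The norm of a representative of a class of `G_m(L)`: `(h, h) / m` for `m ≥ 1`, and `(h, h)`
in the degenerate case `m = 0`. -/
def discNorm (L : EvenLattice s) (m : ℕ) (h : Fin s → ℚ) : ℚ :=
  if m = 0 then L.bil ℚ h h else L.bil ℚ h h / m

/-- The quadratic form of `G_m(L)`, with values in `ℚ / 2ℤ`: for `m ≥ 1` it sends `h + m L` to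
`(h, h) / m + 2ℤ`, the norm of `h / m` in the lattice `L` with form multiplied by `m`. -/
def discForm (L : EvenLattice s) (m : ℕ) :
    L.discGroup m → ℚ ⧸ AddSubgroup.zmultiples (2 : ℚ) :=
  Quotient.lift
    (fun h : L.dual => (QuotientAddGroup.mk (L.discNorm m h) :
      ℚ ⧸ AddSubgroup.zmultiples (2 : ℚ)))
    (by
      intro h h' hr
      obtain ⟨α, hα⟩ := L.exists_of_rel m h h' hr
      obtain ⟨n, hn⟩ := h.2 α
      obtain ⟨e, he⟩ := L.even_bil_self α
      have he' : L.bil ℚ (fun i => (α i : ℚ)) (fun i => (α i : ℚ)) = e + e := by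
        rw [bil_intCast, he]; push_cast; rfl
      apply QuotientAddGroup.eq.mpr
      rw [AddSubgroup.mem_zmultiples_iff]
      have hb : L.bil ℚ (h' : Fin s → ℚ) h' = L.bil ℚ (h : Fin s → ℚ) h
          + 2 * (m * n) + m * (m * (e + e)) := by
        rw [hα, bil_add_left, bil_add_right, bil_add_right, bil_smul_left, bil_smul_left,
          bil_smul_right, bil_smul_right, L.bil_comm ℚ (fun i => (α i : ℚ)) h, hn, he']
        ring
      unfold discNorm
      by_cases hm : m = 0
      · refine ⟨0, ?_⟩
        subst hm
        simp [hb]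
      · refine ⟨n + m * e, ?_⟩
        have hm' : (m : ℚ) ≠ 0 := by exact_mod_cast hm
        simp only [hm, if_false, hb]
        simp only [zsmul_eq_mul]
        push_cast
        field_simp
        ring)

/-! ### Theta functions -/

/-- The theta series attached to a representative `h`:
`∑_{ℓ ∈ L} exp(π i m (S[ℓ + h/m] τ + 2 ᵗ(ℓ + h/m) S z))`. -/
def thetaRep (L : EvenLattice s) (m : ℕ) (h : Fin s → ℚ) (τ : UpperHalfPlane)
    (z : Fin s → ℂ) : ℂ :=
  ∑' ℓ : Fin s → ℤ,
    Complex.exp (Real.pi * Complex.I * m *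
      (L.bil ℂ (fun i => (ℓ i : ℂ) + (h i : ℂ) / m) (fun i => (ℓ i : ℂ) + (h i : ℂ) / m) * τ
        + 2 * L.bil ℂ (fun i => (ℓ i : ℂ) + (h i : ℂ) / m) z))

/-- The theta function `ϑ_{L,m,h}` of a class `h ∈ G_m(L)`. -/
def theta (L : EvenLattice s) (m : ℕ) (h : L.discGroup m) (τ : UpperHalfPlane)
    (z : Fin s → ℂ) : ℂ :=
  Quotient.lift (fun h : L.dual => L.thetaRep m h τ z)
    (by
      intro h₀ h' hr
      obtain ⟨α, hα⟩ := L.exists_of_rel m h₀ h' hr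
      by_cases hm : m = 0
      · subst hm
        have h0 : h' = h₀ := Subtype.ext (by rw [hα]; funext i; simp)
        rw [h0]
      · have hm' : (m : ℂ) ≠ 0 := by exact_mod_cast hm
        simp only [thetaRep]
        rw [← (Equiv.addRight α).tsum_eq]
        refine tsum_congr fun ℓ => ?_
        have : (fun i => (((Equiv.addRight α) ℓ i : ℤ) : ℂ) + ((h₀ : Fin s → ℚ) i : ℂ) / m)
            = fun i => (ℓ i : ℂ) + ((h' : Fin s → ℚ) i : ℂ) / m := by
          funext i
          rw [hα]
          simp only [Equiv.coe_addRight, Pi.add_apply, Pi.smul_apply, smul_eq_mul]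
          push_cast
          field_simp
          ring
        rw [this]) h

/-- `φ = ᵗΦ · Θ_{L,m}`, that is, `φ(τ, z) = ∑_{h ∈ G_m(L)} Φ_h(τ) ϑ_{L,m,h}(τ, z)`
(the group `G_m(L)` is finite for `m ≥ 1`). -/
def IsThetaDecomposition (L : EvenLattice s) (m : ℕ)
    (φ : UpperHalfPlane × (Fin s → ℂ) → ℂ) (Φ : L.discGroup m → UpperHalfPlane → ℂ) : Prop :=
  ∀ (τ : UpperHalfPlane) (z : Fin s → ℂ), φ (τ, z) = ∑ᶠ h, Φ h τ * L.theta m h τ z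

/-! ### The Jacobi group of the lattice `M = Π_{1,1} ⊕ L ⊕ Π_{1,1}` -/

/-- The coordinates of `M ⊗ ℝ`, with `M = Π_{1,1} ⊕ L ⊕ Π_{1,1}`, in the order
`e₁, e₂ | L | e₋₂, e₋₁`; the form has Gram matrix `(0, 0, I; 0, S, 0; I, 0, 0)` where
`I = (0, -1; -1, 0)`. -/
abbrev Idx (s : ℕ) : Type := Fin 2 ⊕ (Fin s ⊕ Fin 2)

/-- The matrix `{A} = diag(A⁰, E_s, A)`, `A⁰ = I ᵗA⁻¹ I`, for `A ∈ SL(2, ℝ)`. -/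
def slMat (s : ℕ) (A : Matrix.SpecialLinearGroup (Fin 2) ℝ) : Matrix (Idx s) (Idx s) ℝ :=
  Matrix.fromBlocks
    (!![0, -1; -1, 0] * ((A⁻¹ : Matrix.SpecialLinearGroup (Fin 2) ℝ).1)ᵀ * !![0, -1; -1, 0])
    0 0 (Matrix.fromBlocks 1 0 0 A.1)

/-- The Heisenberg matrix `{x, y; r}`, whose rows in block form are
`(1, 0, ᵗyS, ᵗxSy - r, S[y]/2)`, `(0, 1, ᵗxS, S[x]/2, r)`, `(0, 0, E_s, x, y)`,
`(0, 0, 0, 1, 0)`, `(0, 0, 0, 0, 1)`. -/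
def heisMat (L : EvenLattice s) (x y : Fin s → ℝ) (r : ℝ) : Matrix (Idx s) (Idx s) ℝ :=
  Matrix.fromBlocks 1
    (Matrix.fromCols
      (Matrix.of ![y ᵥ* L.gram.map (Int.cast : ℤ → ℝ), x ᵥ* L.gram.map (Int.cast : ℤ → ℝ)])
      !![L.bil ℝ x y - r, L.bil ℝ y y / 2; L.bil ℝ x x / 2, r])
    0
    (Matrix.fromBlocks 1 (Matrix.of fun i => ![x i, y i]) 0 1)

/-- The real Jacobi group `G^J_ℝ`, generated by the `{A}` with `A ∈ SL(2, ℝ)` and by the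
`{x, y; r}` with `x, y ∈ ℝ^s`, `r ∈ ℝ`. -/
def realJacobiGroup (L : EvenLattice s) : Subgroup (Matrix (Idx s) (Idx s) ℝ)ˣ :=
  Subgroup.closure
    {g | (∃ A, (g : Matrix (Idx s) (Idx s) ℝ) = slMat s A) ∨
      ∃ x y r, (g : Matrix (Idx s) (Idx s) ℝ) = L.heisMat x y r}

/-- The Jacobi group `Γ^J_M`: the elements of `G^J_ℝ` that map the lattice `M = ℤ^(s+4)` onto
itself (all of `G^J_ℝ` consists of isometries of `M ⊗ ℝ` that preserve the domain). -/
def jacobiGroup (L : EvenLattice s) : Set (Matrix (Idx s) (Idx s) ℝ)ˣ :=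
  {g | g ∈ L.realJacobiGroup ∧ ∀ i j, (∃ n : ℤ, (g : Matrix (Idx s) (Idx s) ℝ) i j = n) ∧
    ∃ n : ℤ, ((g⁻¹ : (Matrix (Idx s) (Idx s) ℝ)ˣ) : Matrix (Idx s) (Idx s) ℝ) i j = n}

/-! ### The action on the tube domain, and the automorphic factors -/

/-- `S₁[Z] = S[z] - 2 ω τ` for `Z = (ω, z, τ)`. -/
def normOne (L : EvenLattice s) (R : Type) [CommRing R] (ω : R) (z : Fin s → R) (τ : R) : R :=
  L.bil R z z - 2 * ω * τ

/-- The tube domain: `ω, τ` in the upper half plane and `S₁[Im Z] < 0`. -/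
def tubeDomain (L : EvenLattice s) : Set (ℂ × (Fin s → ℂ) × ℂ) :=
  {Z | 0 < Z.1.im ∧ 0 < Z.2.2.im ∧ L.normOne ℝ Z.1.im (fun i => (Z.2.1 i).im) Z.2.2.im < 0}

/-- The Borel embedding `p(Z) = (S₁[Z]/2 : ω : z : τ : 1)`. -/
def borelEmb (L : EvenLattice s) (Z : ℂ × (Fin s → ℂ) × ℂ) : Idx s → ℂ :=
  Sum.elim ![L.normOne ℂ Z.1 Z.2.1 Z.2.2 / 2, Z.1] (Sum.elim Z.2.1 ![Z.2.2, 1])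

/-- The vector `g · p(Z)`. -/
def actVec (L : EvenLattice s) (g : Matrix (Idx s) (Idx s) ℝ) (Z : ℂ × (Fin s → ℂ) × ℂ) :
    Idx s → ℂ :=
  g.map (Complex.ofReal) *ᵥ L.borelEmb Z

/-- The automorphic factor `J(g, Z)`, the last coordinate of `g · p(Z)`. -/
def autJ (L : EvenLattice s) (g : Matrix (Idx s) (Idx s) ℝ) (Z : ℂ × (Fin s → ℂ) × ℂ) : ℂ :=
  L.actVec g Z (Sum.inr (Sum.inr 1))

/-- The action `g⟨Z⟩`, determined by `p(g⟨Z⟩) J(g, Z) = g · p(Z)`. -/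
def act (L : EvenLattice s) (g : Matrix (Idx s) (Idx s) ℝ) (Z : ℂ × (Fin s → ℂ) × ℂ) :
    ℂ × (Fin s → ℂ) × ℂ :=
  (L.actVec g Z (Sum.inl 1) / L.autJ g Z,
    fun i => L.actVec g Z (Sum.inr (Sum.inl i)) / L.autJ g Z,
    L.actVec g Z (Sum.inr (Sum.inr 0)) / L.autJ g Z)

/-- The automorphic factor `J_{k,m}(g, (τ, z)) = J(g, Z)^k e^{-2πi m ω(g; Z)} e^{2πi m ω}`,
where `Z = (ω, z, τ)`; for `g` in the Jacobi group it does not depend on `ω`. -/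
def autJkm (L : EvenLattice s) (k : ℤ) (m : ℕ) (g : Matrix (Idx s) (Idx s) ℝ)
    (Z : ℂ × (Fin s → ℂ) × ℂ) : ℂ :=
  L.autJ g Z ^ k * Complex.exp (-(2 * Real.pi * Complex.I * m * (L.act g Z).1))
    * Complex.exp (2 * Real.pi * Complex.I * m * Z.1)

/-- `(φ|_{k,m} g)(τ, z) = J_{k,m}(g, (τ, z))⁻¹ φ(g⟨(τ, z)⟩)`, computed at `Z = (ω, z, τ)`. -/
def slash (L : EvenLattice s) (k : ℤ) (m : ℕ) (φ : UpperHalfPlane × (Fin s → ℂ) → ℂ)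
    (g : Matrix (Idx s) (Idx s) ℝ) (Z : ℂ × (Fin s → ℂ) × ℂ) : ℂ :=
  (L.autJkm k m g Z)⁻¹ * φ (UpperHalfPlane.ofComplex (L.act g Z).2.2, (L.act g Z).2.1)

/-! ### Jacobi forms -/

/-- `φ` is a Jacobi form of weight `k` and index `m` on `Γ^J_M`: it is holomorphic on
`H₁ × ℂ^s`, it satisfies `φ|_{k,m} γ = φ` for all `γ ∈ Γ^J_M`, and it has a Fourier expansion
`∑_{n ∈ ℤ} ∑_ℓ c(n, ℓ) e^{2πi(nτ + ᵗℓSz)}`, `ℓ` in the dual lattice, with `c(n, ℓ) ≠ 0` only if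
`2nm - S[ℓ] ≥ 0`. -/
structure IsJacobiForm (L : EvenLattice s) (k : ℤ) (m : ℕ)
    (φ : UpperHalfPlane × (Fin s → ℂ) → ℂ) : Prop where
  holo : DifferentiableOn ℂ
    (fun p : ℂ × (Fin s → ℂ) => φ (UpperHalfPlane.ofComplex p.1, p.2)) {p | 0 < p.1.im}
  slash_eq : ∀ g ∈ L.jacobiGroup, ∀ (ω : ℂ) (z : Fin s → ℂ) (τ : UpperHalfPlane),
    (ω, z, (τ : ℂ)) ∈ L.tubeDomain → L.slash k m φ g (ω, z, τ) = φ (τ, z)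
  fourier : ∃ c : ℤ × L.dual → ℂ,
    (∀ (n : ℤ) (ℓ : L.dual), c (n, ℓ) ≠ 0 → 0 ≤ 2 * (n : ℚ) * m - L.bil ℚ ℓ ℓ) ∧
    ∀ (τ : UpperHalfPlane) (z : Fin s → ℂ),
      HasSum (fun p : ℤ × L.dual => c p * Complex.exp (2 * Real.pi * Complex.I *
        (p.1 * τ + L.bil ℂ (fun i => (((p.2 : Fin s → ℚ) i : ℚ) : ℂ)) z))) (φ (τ, z))

/-- The complex vector space `J_{k,m}(Γ^J_M)`. -/
def JacobiForms (L : EvenLattice s) (k : ℤ) (m : ℕ) :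
    Submodule ℂ (UpperHalfPlane × (Fin s → ℂ) → ℂ) where
  carrier := {φ | L.IsJacobiForm k m φ}
  zero_mem' :=
    { holo := differentiableOn_const 0
      slash_eq := fun g _ ω z τ _ => by simp [slash]
      fourier := ⟨0, by simp, fun τ z => by simp [hasSum_zero]⟩ }
  add_mem' := by
    intro φ ψ hφ hψ
    obtain ⟨c, hc, hcs⟩ := hφ.fourier
    obtain ⟨d, hd, hds⟩ := hψ.fourier
    refine ⟨hφ.holo.add hψ.holo, fun g hg ω z τ hZ => ?_, c + d, fun n ℓ h => ?_,
      fun τ z => ?_⟩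
    · have h1 := hφ.slash_eq g hg ω z τ hZ
      have h2 := hψ.slash_eq g hg ω z τ hZ
      simp only [slash, Pi.add_apply] at h1 h2 ⊢
      rw [mul_add, h1, h2]
    · by_cases h0 : c (n, ℓ) = 0
      · exact hd n ℓ (by simpa [h0] using h)
      · exact hc n ℓ h0
    · simpa [add_mul] using (hcs τ z).add (hds τ z)
  smul_mem' := by
    intro a φ hφ
    obtain ⟨c, hc, hcs⟩ := hφ.fourier
    refine ⟨hφ.holo.const_smul a, fun g hg ω z τ hZ => ?_, a • c, fun n ℓ h => ?_,
      fun τ z => ?_⟩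
    · have h1 := hφ.slash_eq g hg ω z τ hZ
      simp only [slash, Pi.smul_apply, smul_eq_mul] at h1 ⊢
      rw [← h1]
      ring
    · refine hc n ℓ fun h0 => h ?_
      simp [h0]
    · simpa [mul_assoc] using (hcs τ z).mul_left a

end EvenLattice

end

noncomputable section

open MeasureTheory Filter Topology

/-! ### Series and integrals over `ℤ^s` and `ℝ^s` -/

section LatticeSeries

variable {s : ℕ}

/-! For positive index, invariance under the integral Heisenberg group makes the coefficients of
`φ(τ, ·)` with respect to the theta terms periodic modulo `m L`. Hence `φ = ∑ Φ_h ϑ_h`, and the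
`Φ_h` are unique because the theta functions at a fixed `τ` are linearly independent in `z`
(`exists_theta_decomposition`, `theta_linearIndependent`). What remains of the Jacobi condition is a
condition on the system `(Φ_h)`, packaged in `IsVectorForm`.

That condition sees the lattice only through the finite quadratic module and the dimension. Under `τ
↦ τ + 1` the function `ϑ_h` is multiplied by `e^{πi q(h)}`. Under `τ ↦ -1/τ` Poisson summation gives
a finite Fourier transform whose kernel is the bicharacter of `q`, with factor `|G|^{-1/2}
(-iτ)^{s/2}` (`theta_inversion`). The Fourier exponents of `Φ_h` lie in `-q(h)/2 + ℤ`, and the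
condition `2nm - S[ℓ] ≥ 0` says that they are nonnegative. An isometry `σ` preserves everything
except the power `(-iτ)^{s/2}`.

The relation between the generators `S` and `T` of `SL(2, ℤ)`, tested on theta functions at `τ = i`,
yields Milgram's formula `gauss_sum`. It determines `s` modulo `8` from the quadratic module, so `s₂
- s₁ = 8t`. Then `(-iτ)^{s₂/2}` and `(-iτ)^{s₁/2}` differ exactly by `τ^{4t}`, which is the change
of weight by `(s₂ - s₁)/2` (`IsVectorForm.map`). Relabelling the `Φ_h` along `σ` is the isomorphism.

For index zero the group is the dual lattice itself, which is infinite, so index zero on one side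
forces index zero on the other. A free abelian group determines its rank, so the dimensions agree
and the weight does not change. Positive definiteness leaves only `ℓ = 0` in the Fourier expansion,
so the forms are functions of `τ` alone and do not depend on the lattice (`jacobiFormsZeroEquiv`).
-/

lemma exp_neg_sq_le (a b : ℝ) (ha : 0 < a) (N : ℕ) :
    ∃ C : ℝ, 0 < C ∧ ∀ t : ℝ, 0 ≤ t → Real.exp (-a * t ^ 2 + b * t) * t ^ N ≤ C := by
  -- Since `t^N ≤ N! e^t`, it is enough to bound `exp(-a t² + (b+1) t)`, and the maximum of this
  -- quadratic exponent is `(b+1)²/(4a)`.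
  refine ⟨N.factorial * Real.exp ((b + 1) ^ 2 / (4 * a)), by positivity, fun t ht => ?_⟩
  have h1 : t ^ N ≤ N.factorial * Real.exp t := by
    have := Real.pow_div_factorial_le_exp t ht N
    rwa [div_le_iff₀ (by positivity), mul_comm] at this
  calc Real.exp (-a * t ^ 2 + b * t) * t ^ N
      ≤ Real.exp (-a * t ^ 2 + b * t) * (N.factorial * Real.exp t) := by gcongr
    _ = N.factorial * Real.exp (-a * t ^ 2 + b * t + t) := by rw [Real.exp_add _ t]; ring
    _ ≤ N.factorial * Real.exp ((b + 1) ^ 2 / (4 * a)) := by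
        gcongr
        rw [le_div_iff₀ (by positivity)]
        nlinarith [sq_nonneg (2 * a * t - (b + 1))]

lemma summable_norm_int_pow_inv (s : ℕ) :
    Summable fun k : Fin s → ℤ => ‖k‖⁻¹ ^ (s + 1) := by
  let b := Pi.basisFun ℝ (Fin s)
  let Λ : Submodule ℤ (Fin s → ℝ) := Submodule.span ℤ (Set.range b)
  have hmem : ∀ k : Fin s → ℤ, (fun i => (k i : ℝ)) ∈ Λ := by
    intro k
    rw [b.mem_span_iff_repr_mem ℤ]
    intro i
    exact ⟨k i, by simp [b]⟩
  have hrank : Module.finrank ℤ Λ = s := by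
    have := ZLattice.rank ℝ Λ
    simpa using this
  have h := ZLattice.summable_norm_pow_inv Λ (s + 1) (by rw [hrank]; omega)
  have hinj : Function.Injective (fun k : Fin s → ℤ => (⟨fun i => (k i : ℝ), hmem k⟩ : Λ)) := by
    intro k k' hk
    funext i
    have : ((k i : ℤ) : ℝ) = k' i := congrFun (congrArg Subtype.val hk) i
    exact_mod_cast this
  refine (h.comp_injective hinj).congr fun k => ?_
  simp only [Function.comp]
  congr 2

lemma summable_exp_neg_sq_int (s : ℕ) {a : ℝ} (ha : 0 < a) (b : ℝ) :
    Summable fun k : Fin s → ℤ => Real.exp (-a * ‖k‖ ^ 2 + b * ‖k‖) := by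
  obtain ⟨C, hC, hb⟩ := exp_neg_sq_le a b ha (s + 1)
  refine Summable.of_norm_bounded_eventually ((summable_norm_int_pow_inv s).mul_left C) ?_
  -- The comparison fails at `k = 0`, where `‖k‖⁻¹` is `0` by convention; one exceptional index is
  -- harmless.
  refine (Set.finite_singleton (0 : Fin s → ℤ)).subset ?_
  intro k hk
  by_contra h0
  apply hk
  have hk0 : 0 < ‖k‖ := norm_pos_iff.mpr h0
  change ‖Real.exp (-a * ‖k‖ ^ 2 + b * ‖k‖)‖ ≤ C * ‖k‖⁻¹ ^ (s + 1)
  rw [Real.norm_of_nonneg (Real.exp_nonneg _), inv_pow, ← div_eq_mul_inv,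
    le_div_iff₀ (by positivity)]
  exact hb _ hk0.le

/-- The projection `ℝ^s → (ℝ/ℤ)^s`. -/
def torusMk (x : Fin s → ℝ) : UnitAddTorus (Fin s) := fun i => (x i : UnitAddCircle)

lemma isOpenQuotientMap_torusMk : IsOpenQuotientMap (torusMk (s := s)) :=
  IsOpenQuotientMap.piMap (f := fun _ : Fin s => ((↑) : ℝ → UnitAddCircle))
    fun _ => QuotientAddGroup.isOpenQuotientMap_mk

lemma exists_int_of_torusMk_eq {x y : Fin s → ℝ} (h : torusMk x = torusMk y) :
    ∃ n : Fin s → ℤ, x = y + fun i => (n i : ℝ) := by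
  have : ∀ i, ∃ n : ℤ, x i = y i + n := by
    intro i
    have hi : ((x i : ℝ) : UnitAddCircle) = (y i : ℝ) := congrFun h i
    obtain ⟨n, hn⟩ := AddSubgroup.mem_zmultiples_iff.mp (QuotientAddGroup.eq.mp hi.symm)
    refine ⟨n, ?_⟩
    simp at hn
    linarith
  choose n hn using this
  exact ⟨n, funext hn⟩

lemma mFourier_torusMk (k : Fin s → ℤ) (x : Fin s → ℝ) :
    UnitAddTorus.mFourier k (torusMk x) =
      Complex.exp (2 * Real.pi * Complex.I * ∑ i, (k i : ℂ) * x i) := by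
  simp only [UnitAddTorus.mFourier, torusMk, ContinuousMap.coe_mk, fourier_coe_apply]
  rw [← Complex.exp_sum, Finset.mul_sum]
  congr 1
  refine Finset.sum_congr rfl fun i _ => ?_
  simp; ring

attribute [local instance] instMeasureSpaceUnitAddCircle in
-- Absolute summability gives convergence in `C(𝕋^s)`, hence in `L²`. Pairing the vanishing sum with
-- the `j`-th member of the orthonormal family of characters isolates `a j`.
lemma fourier_series_eq_zero {a : (Fin s → ℤ) → ℂ} (ha : Summable a)
    (h : ∀ x : Fin s → ℝ,
      ∑' k, a k * Complex.exp (2 * Real.pi * Complex.I * ∑ i, (k i : ℂ) * x i) = 0) :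
    a = 0 := by
  have hs : Summable fun k => a k • UnitAddTorus.mFourier k := by
    refine .of_norm ?_
    simpa [norm_smul, UnitAddTorus.mFourier_norm] using ha.norm
  have hz : HasSum (fun k => a k • UnitAddTorus.mFourier k) 0 := by
    have h0 : ∑' k, a k • UnitAddTorus.mFourier k = 0 := by
      ext t
      obtain ⟨x, rfl⟩ := isOpenQuotientMap_torusMk.surjective t
      have := (ContinuousMap.evalCLM ℂ (torusMk x)).map_tsum hs
      simp only [ContinuousMap.evalCLM_apply] at this
      rw [this]
      simpa [mFourier_torusMk] using h x
    rw [← h0]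
    exact hs.hasSum
  have : IsProbabilityMeasure (volume : Measure UnitAddCircle) :=
    inferInstanceAs (IsProbabilityMeasure AddCircle.haarAddCircle)
  funext j
  have h3 := ((innerSL ℂ (UnitAddTorus.mFourierLp 2 j)).comp
    (ContinuousMap.toLp (E := ℂ) 2 _ ℂ)).hasSum hz
  simp only [map_smul, map_zero, ContinuousLinearMap.comp_apply] at h3
  have h4 := hasSum_single (f := fun k => a k •
    (innerSL ℂ (UnitAddTorus.mFourierLp 2 j)) (UnitAddTorus.mFourierLp 2 k)) j (by
      intro k hk
      simp only [innerSL_apply_apply]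
      rw [orthonormal_iff_ite.mp UnitAddTorus.orthonormal_mFourier, if_neg hk.symm, smul_zero])
  have h5 := h4.unique h3
  simp only [innerSL_apply_apply] at h5
  rw [orthonormal_iff_ite.mp UnitAddTorus.orthonormal_mFourier, if_pos rfl] at h5
  simpa using h5

/-- Poisson summation over `ℤ^s`. -/
theorem tsum_int_eq_tsum_fourier {f : (Fin s → ℝ) → ℂ} (hc : Continuous f) (hi : Integrable f)
    (hf : ∀ R : ℝ, ∃ u : (Fin s → ℤ) → ℝ, Summable u ∧
      ∀ n x, ‖x‖ ≤ R → ‖f (x + fun i => (n i : ℝ))‖ ≤ u n)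
    (hs : Summable fun k : Fin s → ℤ =>
      ∫ x, Complex.exp (-(2 * Real.pi * Complex.I * ∑ i, (k i : ℂ) * x i)) * f x) :
    ∑' n : Fin s → ℤ, f (fun i => (n i : ℝ)) = ∑' k : Fin s → ℤ,
      ∫ x, Complex.exp (-(2 * Real.pi * Complex.I * ∑ i, (k i : ℂ) * x i)) * f x := by
  set F : (Fin s → ℝ) → ℂ := fun x => ∑' n : Fin s → ℤ, f (x + fun i => (n i : ℝ)) with hF
  have hFc : Continuous F := by
    rw [continuous_iff_continuousAt]
    intro x
    obtain ⟨u, hu, hb⟩ := hf (‖x‖ + 1)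
    have : ContinuousOn F (Metric.ball 0 (‖x‖ + 1)) :=
      continuousOn_tsum (fun n => by fun_prop) hu
        fun n y hy => hb n y (by simpa using (Metric.mem_ball.mp hy).le)
    exact this.continuousAt (Metric.isOpen_ball.mem_nhds (by simp))
  have hFp : ∀ x (m : Fin s → ℤ), F (x + fun i => (m i : ℝ)) = F x := by
    intro x m
    simp only [hF]
    rw [← (Equiv.addLeft m).tsum_eq (fun n : Fin s → ℤ => f (x + fun i => (n i : ℝ)))]
    refine tsum_congr fun n => ?_
    congr 1
    funext i
    simp; ring
  -- The periodization descends to a continuous function on the torus. Poisson summation is its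
  -- Fourier series evaluated at `0`.
  obtain ⟨G, hG⟩ : ∃ G : C(UnitAddTorus (Fin s), ℂ), ∀ x, G (torusMk x) = F x := by
    have hsurj := (isOpenQuotientMap_torusMk (s := s)).surjective
    have key : ∀ x, F (Function.surjInv hsurj (torusMk x)) = F x := by
      intro x
      obtain ⟨n, hn⟩ := exists_int_of_torusMk_eq (Function.surjInv_eq hsurj (torusMk x))
      rw [hn, hFp]
    refine ⟨⟨fun t => F (Function.surjInv hsurj t), ?_⟩, key⟩
    rw [(isOpenQuotientMap_torusMk (s := s)).isQuotientMap.continuous_iff]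
    exact hFc.congr fun x => (key x).symm
  have hcoef : ∀ k, UnitAddTorus.mFourierCoeff G k =
      ∫ x, Complex.exp (-(2 * Real.pi * Complex.I * ∑ i, (k i : ℂ) * x i)) * f x := by
    intro k
    set g : (Fin s → ℝ) → ℂ :=
      fun x => Complex.exp (-(2 * Real.pi * Complex.I * ∑ i, (k i : ℂ) * x i)) * f x with hg
    have hgi : Integrable g := by
      refine hi.bdd_mul (c := 1) (Continuous.aestronglyMeasurable (by fun_prop)) ?_
      refine Filter.Eventually.of_forall fun x => ?_
      rw [Complex.norm_exp]
      have : (-(2 * Real.pi * Complex.I * ∑ i, (k i : ℂ) * x i)).re = 0 := by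
        have : (∑ i, (k i : ℂ) * x i) = ((∑ i, (k i : ℝ) * x i : ℝ) : ℂ) := by push_cast; rfl
        rw [this]; simp
      rw [this, Real.exp_zero]
    -- Half-open unit cubes: each point lies in exactly one, found by ceilings. Cutting the integral
    -- over `ℝ^s` along them and translating back to `Q 0` turns it into a Fourier coefficient of
    -- the periodization.
    let Q : (Fin s → ℤ) → Set (Fin s → ℝ) := fun n =>
      {x | ∀ i, x i ∈ Set.Ioc (n i : ℝ) (n i + 1)}
    have hQm : ∀ n, MeasurableSet (Q n) := fun n =>
      MeasurableSet.univ_pi' (fun i => measurableSet_Ioc)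
    have hceil : ∀ (r : ℝ) (n : ℤ), r ∈ Set.Ioc (n : ℝ) (n + 1) ↔ n = ⌈r⌉ - 1 := by
      intro r n
      rw [eq_sub_iff_add_eq, eq_comm, Int.ceil_eq_iff]
      simp
    have hQd : Pairwise (Function.onFun Disjoint Q) := by
      intro n n' hnn
      refine Set.disjoint_left.mpr fun x hx hx' => hnn ?_
      funext i
      rw [(hceil _ _).mp (hx i), (hceil _ _).mp (hx' i)]
    have hQu : ⋃ n, Q n = Set.univ := by
      refine Set.eq_univ_of_forall fun x => Set.mem_iUnion.mpr
        ⟨fun i => ⌈x i⌉ - 1, fun i => (hceil _ _).mpr rfl⟩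
    have htrans : ∀ (h : (Fin s → ℝ) → ℂ) (n : Fin s → ℤ),
        ∫ x in Q n, h x = ∫ x in Q 0, h (x + fun i => (n i : ℝ)) := by
      intro h n
      rw [← integral_indicator (hQm n), ← integral_indicator (hQm 0),
        ← integral_add_right_eq_self _ (fun i => (n i : ℝ))]
      congr 1
      funext x
      simp only [Set.indicator]
      have : (x + fun i => (n i : ℝ)) ∈ Q n ↔ x ∈ Q 0 := by
        simp only [Q, Set.mem_ofPred_eq, Pi.add_apply, Set.mem_Ioc, Pi.zero_apply, Int.cast_zero]
        refine forall_congr' fun i => ?_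
        constructor <;> rintro ⟨h1, h2⟩ <;> constructor <;> linarith
      by_cases hx : x ∈ Q 0 <;> simp [hx, this]
    have hsumg := hasSum_integral_iUnion hQm hQd (f := g) (by rw [hQu]; exact hgi.integrableOn)
    have hsumn := hasSum_integral_iUnion hQm hQd (f := fun x => ((‖g x‖ : ℝ) : ℂ))
      (by rw [hQu]; exact hgi.norm.ofReal.integrableOn)
    rw [hQu, setIntegral_univ] at hsumg
    rw [UnitAddTorus.mFourierCoeff_eq_integral _ _ 0]
    rw [← hsumg.tsum_eq]
    have h0 : {x : Fin s → ℝ | ∀ i, x i ∈ Set.Ioc ((0 : Fin s → ℝ) i) ((0 : Fin s → ℝ) i + 1)}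
        = Q 0 := by simp [Q]
    rw [h0]
    simp_rw [htrans g]
    rw [integral_tsum_of_summable_integral_norm]
    · congr 1
      funext x
      change UnitAddTorus.mFourier (-k) (torusMk x) • G (torusMk x) = _
      rw [hG, mFourier_torusMk, hF, smul_eq_mul, ← tsum_mul_left]
      refine tsum_congr fun n => ?_
      simp only [hg]
      congr 1
      rw [Complex.exp_eq_exp_iff_exists_int]
      -- Translating by `n` multiplies the character by `e^{-2πi k·n} = 1`.
      refine ⟨∑ i, k i * n i, ?_⟩
      push_cast
      simp only [Pi.neg_apply, Pi.add_apply, Int.cast_neg, neg_mul, Finset.sum_neg_distrib,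
        Complex.ofReal_add, mul_add, Finset.sum_add_distrib, Complex.ofReal_intCast]
      ring
    · intro n
      exact (hgi.comp_add_right _).integrableOn
    · have : Summable fun n => ∫ x in Q n, ((‖g x‖ : ℝ) : ℂ) := hsumn.summable
      simp_rw [htrans (fun x => ((‖g x‖ : ℝ) : ℂ)), integral_complex_ofReal] at this
      exact_mod_cast this
  have hser := UnitAddTorus.hasSum_mFourier_series_apply_of_summable (f := G)
    (by simpa only [funext hcoef] using hs) (torusMk 0)
  simp only [hcoef, mFourier_torusMk, hG] at hser
  have := hser.tsum_eq
  simp only [Pi.zero_apply, Complex.ofReal_zero, mul_zero, Finset.sum_const_zero, Complex.exp_zero,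
    smul_eq_mul, mul_one] at this
  rw [this, hF]
  simp only [zero_add]

end LatticeSeries

end

noncomputable section

open MeasureTheory Filter Topology

namespace EvenLattice

variable {s : ℕ} (L : EvenLattice s)

/-! ### The bilinear form and the dual lattice -/

/-- The Gram matrix with coefficients in a ring. -/
abbrev gramMap (R : Type) [CommRing R] : Matrix (Fin s) (Fin s) R :=
  L.gram.map (Int.cast : ℤ → R)

lemma bil_map {R R' : Type} [CommRing R] [CommRing R'] (f : R →+* R') (x y : Fin s → R) :
    L.bil R' (fun i => f (x i)) (fun i => f (y i)) = f (L.bil R x y) := by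
  simp [bil, dotProduct, Matrix.mulVec]

lemma bil_ofReal (x y : Fin s → ℝ) :
    L.bil ℂ (fun i => (x i : ℂ)) (fun i => (y i : ℂ)) = (L.bil ℝ x y : ℝ) :=
  L.bil_map Complex.ofRealHom x y

lemma bil_ratCast_real (x y : Fin s → ℚ) :
    L.bil ℝ (fun i => (x i : ℝ)) (fun i => (y i : ℝ)) = (L.bil ℚ x y : ℚ) :=
  L.bil_map (Rat.castHom ℝ) x y

lemma bil_ratCast (x y : Fin s → ℚ) :
    L.bil ℂ (fun i => (x i : ℂ)) (fun i => (y i : ℂ)) = (L.bil ℚ x y : ℚ) :=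
  L.bil_map (Rat.castHom ℂ) x y

lemma bil_neg_right (R : Type) [CommRing R] (x y : Fin s → R) :
    L.bil R x (-y) = -L.bil R x y := by
  simp [bil, Matrix.mulVec_neg]

lemma bil_zero_right (R : Type) [CommRing R] (x : Fin s → R) : L.bil R x 0 = 0 := by
  simp [bil]

lemma bil_zero_left (R : Type) [CommRing R] (x : Fin s → R) : L.bil R 0 x = 0 := by
  simp [bil]

lemma bil_sub_right (R : Type) [CommRing R] (x y y' : Fin s → R) :
    L.bil R x (y - y') = L.bil R x y - L.bil R x y' := by
  rw [sub_eq_add_neg, bil_add_right, bil_neg_right, sub_eq_add_neg]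

lemma bil_sub_left (R : Type) [CommRing R] (x x' y : Fin s → R) :
    L.bil R (x - x') y = L.bil R x y - L.bil R x' y := by
  rw [sub_eq_add_neg, bil_add_left, bil_neg_left, sub_eq_add_neg]

lemma bil_eq_sum (R : Type) [CommRing R] (x y : Fin s → R) :
    L.bil R x y = ∑ i, (L.gramMap R *ᵥ x) i * y i := by
  rw [bil_comm]
  simp only [bil, dotProduct]
  exact Finset.sum_congr rfl fun i _ => mul_comm _ _

/-- The matrix `B` makes the form a sum of squares, `S[x] = |Bx|²`. Both the coercivity estimate and
the Gaussian integral rest on this. -/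
lemma exists_sqrt_gram : ∃ B : Matrix (Fin s) (Fin s) ℝ, B.det ≠ 0 ∧ L.gramMap ℝ = Bᵀ * B := by
  open scoped MatrixOrder in
  obtain ⟨B, hB⟩ := CStarAlgebra.nonneg_iff_eq_star_mul_self.mp L.posDef.posSemidef.nonneg
  have hB' : L.gramMap ℝ = Bᵀ * B := by
    rw [gramMap, hB, Matrix.star_eq_conjTranspose, Matrix.conjTranspose_eq_transpose_of_trivial]
  refine ⟨B, fun h => L.posDef.det_pos.ne' ?_, hB'⟩
  rw [hB, Matrix.det_mul, h, mul_zero]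

lemma det_gramMap_rat_ne_zero : (L.gramMap ℚ).det ≠ 0 := by
  intro h
  have h1 : (L.gramMap ℝ).det = 0 := by
    have : L.gramMap ℝ = (L.gramMap ℚ).map (Rat.castHom ℝ) := by
      ext i j; simp
    rw [this, ← RingHom.mapMatrix_apply, ← RingHom.map_det, h, map_zero]
  exact L.posDef.det_pos.ne' h1

lemma exists_int_gram_mulVec (ℓ : L.dual) (i : Fin s) :
    ∃ n : ℤ, (L.gramMap ℚ *ᵥ (ℓ : Fin s → ℚ)) i = n := by
  obtain ⟨n, hn⟩ := ℓ.2 (Pi.single i 1)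
  refine ⟨n, ?_⟩
  rw [← hn, bil_eq_sum, Finset.sum_eq_single i]
  · simp
  · intro j _ hj; simp [hj]
  · simp

lemma gram_mulVec_inv_mulVec (x : Fin s → ℚ) : L.gramMap ℚ *ᵥ ((L.gramMap ℚ)⁻¹ *ᵥ x) = x := by
  rw [Matrix.mulVec_mulVec, Matrix.mul_nonsing_inv _
      (isUnit_iff_ne_zero.mpr L.det_gramMap_rat_ne_zero), Matrix.one_mulVec]

lemma inv_mulVec_gram_mulVec (x : Fin s → ℚ) : (L.gramMap ℚ)⁻¹ *ᵥ (L.gramMap ℚ *ᵥ x) = x := by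
  rw [Matrix.mulVec_mulVec, Matrix.nonsing_inv_mul _
      (isUnit_iff_ne_zero.mpr L.det_gramMap_rat_ne_zero), Matrix.one_mulVec]

lemma inv_mulVec_mem_dual (k : Fin s → ℤ) :
    ((L.gramMap ℚ)⁻¹ *ᵥ fun i => (k i : ℚ)) ∈ L.dual := fun α => ⟨∑ i, k i * α i, by
  rw [bil_eq_sum, gram_mulVec_inv_mulVec]
  push_cast; rfl⟩

/-- The dual lattice in the dual basis: `ℓ ↦ S ℓ`. -/
def dualEquiv : L.dual ≃+ (Fin s → ℤ) where
  toFun ℓ i := (L.exists_int_gram_mulVec ℓ i).choose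
  invFun k := ⟨(L.gramMap ℚ)⁻¹ *ᵥ fun i => (k i : ℚ), L.inv_mulVec_mem_dual k⟩
  left_inv ℓ := by
    apply Subtype.ext
    have : (fun i => (((L.exists_int_gram_mulVec ℓ i).choose : ℤ) : ℚ)) =
        L.gramMap ℚ *ᵥ (ℓ : Fin s → ℚ) :=
      funext fun i => (L.exists_int_gram_mulVec ℓ i).choose_spec.symm
    simp only [this]
    exact L.inv_mulVec_gram_mulVec _
  right_inv k := by
    funext i
    have h := (L.exists_int_gram_mulVec ⟨_, L.inv_mulVec_mem_dual k⟩ i).choose_spec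
    simp only at h
    have h2 := congrFun (L.gram_mulVec_inv_mulVec fun i => (k i : ℚ)) i
    have h3 := h2.symm.trans h
    exact_mod_cast h3.symm
  map_add' ℓ ℓ' := by
    funext i
    have h := (L.exists_int_gram_mulVec (ℓ + ℓ') i).choose_spec
    have h1 := (L.exists_int_gram_mulVec ℓ i).choose_spec
    have h2 := (L.exists_int_gram_mulVec ℓ' i).choose_spec
    have h3 : (L.gramMap ℚ *ᵥ ((ℓ + ℓ' : L.dual) : Fin s → ℚ)) i =
        (L.gramMap ℚ *ᵥ (ℓ : Fin s → ℚ)) i + (L.gramMap ℚ *ᵥ (ℓ' : Fin s → ℚ)) i := by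
      rw [AddSubgroup.coe_add, Matrix.mulVec_add, Pi.add_apply]
    have h4 := (h3.symm.trans h).symm.trans (congrArg₂ (· + ·) h1 h2)
    simp only [Pi.add_apply]
    exact_mod_cast h4

lemma dualEquiv_apply (ℓ : L.dual) (i : Fin s) :
    (L.dualEquiv ℓ i : ℚ) = (L.gramMap ℚ *ᵥ (ℓ : Fin s → ℚ)) i :=
  (L.exists_int_gram_mulVec ℓ i).choose_spec.symm

lemma coe_dualEquiv_symm (k : Fin s → ℤ) :
    (L.dualEquiv.symm k : Fin s → ℚ) = (L.gramMap ℚ)⁻¹ *ᵥ fun i => (k i : ℚ) := rfl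

lemma bil_dual (ℓ : L.dual) (z : Fin s → ℂ) :
    L.bil ℂ (fun i => ((ℓ : Fin s → ℚ) i : ℂ)) z = ∑ i, (L.dualEquiv ℓ i : ℂ) * z i := by
  rw [bil_eq_sum]
  refine Finset.sum_congr rfl fun i _ => ?_
  congr 1
  have := congrArg (Rat.castHom ℂ) (L.dualEquiv_apply ℓ i)
  simp only [map_intCast] at this
  rw [this]
  simp [Matrix.mulVec, dotProduct]

/-! ### Estimates -/

lemma exists_coercive : ∃ c : ℝ, 0 < c ∧ ∀ x : Fin s → ℝ, c * ‖x‖ ^ 2 ≤ L.bil ℝ x x := by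
  obtain ⟨B, hB, hS⟩ := L.exists_sqrt_gram
  have hbil : ∀ x : Fin s → ℝ, L.bil ℝ x x = ∑ i, ((B *ᵥ x) i) ^ 2 := by
    intro x
    rw [bil, show L.gram.map (Int.cast : ℤ → ℝ) = Bᵀ * B from hS, ← Matrix.mulVec_mulVec,
      Matrix.dotProduct_mulVec, Matrix.vecMul_transpose]
    simp [dotProduct, sq]
  let f : (Fin s → ℝ) →L[ℝ] (Fin s → ℝ) := LinearMap.toContinuousLinearMap (Matrix.toLin' B⁻¹)
  -- From `x = B⁻¹(Bx)` one gets `‖x‖ ≤ ‖B⁻¹‖ ‖Bx‖`, and the sup norm of `Bx` is at most its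
  -- Euclidean norm. The `+ 1` keeps the constant positive when `‖B⁻¹‖ = 0`, that is, in dimension
  -- zero.
  refine ⟨((‖f‖ + 1) ^ 2)⁻¹, by positivity, fun x => ?_⟩
  have h1 : ‖x‖ ≤ (‖f‖ + 1) * ‖B *ᵥ x‖ := by
    have h2 := f.le_opNorm (B *ᵥ x)
    have h3 : f (B *ᵥ x) = x := by
      simp only [f, LinearMap.coe_toContinuousLinearMap', Matrix.toLin'_apply,
        Matrix.mulVec_mulVec]
      rw [Matrix.nonsing_inv_mul _ (isUnit_iff_ne_zero.mpr hB), Matrix.one_mulVec]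
    rw [h3] at h2
    nlinarith [norm_nonneg (B *ᵥ x)]
  have h4 : ‖B *ᵥ x‖ ^ 2 ≤ L.bil ℝ x x := by
    rw [hbil]
    have h5 : ‖B *ᵥ x‖ ≤ Real.sqrt (∑ i, ((B *ᵥ x) i) ^ 2) := by
      refine (pi_norm_le_iff_of_nonneg (Real.sqrt_nonneg _)).mpr fun i => ?_
      rw [Real.norm_eq_abs]
      refine Real.abs_le_sqrt ?_
      exact Finset.single_le_sum (f := fun i => ((B *ᵥ x) i) ^ 2) (fun j _ => sq_nonneg _)
        (Finset.mem_univ i)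
    calc ‖B *ᵥ x‖ ^ 2 ≤ Real.sqrt (∑ i, ((B *ᵥ x) i) ^ 2) ^ 2 := by gcongr
      _ = _ := Real.sq_sqrt (Finset.sum_nonneg fun i _ => sq_nonneg _)
  refine le_trans ?_ h4
  rw [inv_mul_le_iff₀ (by positivity), ← mul_pow]
  gcongr

lemma exists_bil_le : ∃ C : ℝ, 0 ≤ C ∧ ∀ x y : Fin s → ℂ, ‖L.bil ℂ x y‖ ≤ C * ‖x‖ * ‖y‖ := by
  refine ⟨∑ i, ∑ j, ‖L.gramMap ℂ i j‖, by positivity, fun x y => ?_⟩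
  simp only [bil, dotProduct, Matrix.mulVec]
  refine (norm_sum_le _ _).trans ?_
  rw [mul_assoc, Finset.sum_mul]
  refine Finset.sum_le_sum fun i _ => ?_
  rw [norm_mul]
  calc ‖x i‖ * ‖∑ j, L.gramMap ℂ i j * y j‖
      ≤ ‖x‖ * ∑ j, ‖L.gramMap ℂ i j‖ * ‖y‖ := by
        gcongr
        · exact norm_le_pi_norm x i
        · refine (norm_sum_le _ _).trans (Finset.sum_le_sum fun j _ => ?_)
          rw [norm_mul]
          gcongr
          exact norm_le_pi_norm y j
    _ = _ := by rw [← Finset.sum_mul]; ring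

/-- The norms of `ℓ` and of its integral coordinates `k = Sℓ` are equivalent, which reduces the
claim to `ℤ^s`. One inequality serves the quadratic term of the exponent, the other the linear term.
-/
lemma summable_dual {a : ℝ} (ha : 0 < a) (b : ℝ) : Summable fun ℓ : L.dual =>
    Real.exp (-a * ‖fun i => ((ℓ : Fin s → ℚ) i : ℝ)‖ ^ 2
      + b * ‖fun i => ((ℓ : Fin s → ℚ) i : ℝ)‖) := by
  rw [← L.dualEquiv.symm.toEquiv.summable_iff]
  let f : (Fin s → ℝ) →L[ℝ] (Fin s → ℝ) := LinearMap.toContinuousLinearMap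
    (Matrix.toLin' (L.gramMap ℝ))
  let g : (Fin s → ℝ) →L[ℝ] (Fin s → ℝ) := LinearMap.toContinuousLinearMap
    (Matrix.toLin' ((L.gramMap ℚ)⁻¹.map (Rat.cast : ℚ → ℝ)))
  have hnk : ∀ k : Fin s → ℤ, ‖fun i => (k i : ℝ)‖ = ‖k‖ := fun k => rfl
  have hg : ∀ k : Fin s → ℤ, (fun i => ((L.dualEquiv.symm k : Fin s → ℚ) i : ℝ)) =
      g (fun i => (k i : ℝ)) := by
    intro k
    funext i
    simp [coe_dualEquiv_symm, g, Matrix.mulVec, dotProduct]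
  have hf : ∀ k : Fin s → ℤ, (fun i => (k i : ℝ)) =
      f (fun i => ((L.dualEquiv.symm k : Fin s → ℚ) i : ℝ)) := by
    intro k
    funext i
    have := L.dualEquiv_apply (L.dualEquiv.symm k) i
    rw [AddEquiv.apply_symm_apply] at this
    have h2 := congrArg (Rat.cast : ℚ → ℝ) this
    rw [Rat.cast_intCast] at h2
    rw [h2]
    simp [f, Matrix.mulVec, dotProduct]
  refine Summable.of_nonneg_of_le (fun _ => Real.exp_nonneg _) (fun k => ?_)
    (summable_exp_neg_sq_int s (a := a / (‖f‖ + 1) ^ 2) (by positivity) (|b| * ‖g‖))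
  simp only [Function.comp, AddEquiv.toEquiv_eq_coe, EquivLike.coe_coe]
  have h1 : ‖k‖ ≤ (‖f‖ + 1) * ‖fun i => ((L.dualEquiv.symm k : Fin s → ℚ) i : ℝ)‖ := by
    have := f.le_opNorm (fun i => ((L.dualEquiv.symm k : Fin s → ℚ) i : ℝ))
    rw [← hf, hnk] at this
    nlinarith [norm_nonneg (fun i => ((L.dualEquiv.symm k : Fin s → ℚ) i : ℝ))]
  have h2 : ‖fun i => ((L.dualEquiv.symm k : Fin s → ℚ) i : ℝ)‖ ≤ ‖g‖ * ‖k‖ := by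
    rw [hg, ← hnk k]
    exact g.le_opNorm _
  set t := ‖fun i => ((L.dualEquiv.symm k : Fin s → ℚ) i : ℝ)‖
  have ht : 0 ≤ t := norm_nonneg _
  gcongr Real.exp ?_
  refine add_le_add ?_ ?_
  · rw [neg_mul, neg_mul, neg_le_neg_iff, div_mul_eq_mul_div, div_le_iff₀ (by positivity)]
    calc a * ‖k‖ ^ 2 ≤ a * ((‖f‖ + 1) * t) ^ 2 := by gcongr
      _ = _ := by ring
  · calc b * t ≤ |b| * t := by gcongr; exact le_abs_self b
      _ ≤ |b| * (‖g‖ * ‖k‖) := by gcongr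
      _ = _ := by ring

end EvenLattice

end

noncomputable section

open MeasureTheory Filter Topology

namespace EvenLattice

variable {s : ℕ} (L : EvenLattice s)

/-! ### The finite quadratic module `G_m(L)` -/

/-- The class of a dual vector in `G_m(L)`. -/
def mkD (m : ℕ) (ℓ : L.dual) : L.discGroup m := QuotientAddGroup.mk ℓ

lemma mkD_surjective (m : ℕ) : Function.Surjective (L.mkD m) := QuotientAddGroup.mk_surjective

lemma mkD_add (m : ℕ) (ℓ ℓ' : L.dual) : L.mkD m (ℓ + ℓ') = L.mkD m ℓ + L.mkD m ℓ' := rfl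

lemma mkD_neg (m : ℕ) (ℓ : L.dual) : L.mkD m (-ℓ) = -L.mkD m ℓ := rfl

lemma mkD_zero (m : ℕ) : L.mkD m 0 = 0 := rfl

lemma intCast_mem_dual (α : Fin s → ℤ) : (fun i => (α i : ℚ)) ∈ L.dual := fun β =>
  ⟨L.bil ℤ α β, L.bil_intCast ℚ α β⟩

/-- A lattice vector, as an element of the dual lattice. -/
def ofInt (α : Fin s → ℤ) : L.dual := ⟨fun i => (α i : ℚ), L.intCast_mem_dual α⟩

lemma coe_ofInt (α : Fin s → ℤ) : (L.ofInt α : Fin s → ℚ) = fun i => (α i : ℚ) := rfl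

lemma mkD_eq_iff (m : ℕ) (ℓ ℓ' : L.dual) :
    L.mkD m ℓ = L.mkD m ℓ' ↔ ∃ α : Fin s → ℤ, ℓ' = ℓ + m • L.ofInt α := by
  constructor
  · intro h
    obtain ⟨α, hα⟩ := L.exists_of_rel m ℓ ℓ' (Quotient.exact h)
    refine ⟨α, Subtype.ext ?_⟩
    rw [hα]
    funext i
    simp [coe_ofInt]
  · rintro ⟨α, rfl⟩
    refine (QuotientAddGroup.eq.mpr ?_)
    rw [AddSubgroup.mem_addSubgroupOf]
    refine ⟨α, ?_⟩
    funext i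
    simp [coe_ofInt]

/-- A finitely generated torsion abelian group is finite. By Cramer's rule `det S · ℓ` is the
adjugate of `S` applied to `Sℓ`, hence integral, so `m |det S|` annihilates the quotient. -/
lemma finite_discGroup {m : ℕ} (hm : m ≠ 0) : Finite (L.discGroup m) := by
  have : AddGroup.FG (Fin s → ℤ) := AddGroup.fg_iff_addMonoid_fg.mpr inferInstance
  have : AddGroup.FG L.dual :=
    AddGroup.fg_of_surjective (f := (L.dualEquiv.symm : (Fin s → ℤ) →+ L.dual))
      L.dualEquiv.symm.surjective
  have : AddGroup.FG (L.discGroup m) := AddGroup.fg_of_surjective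
    (f := QuotientAddGroup.mk' ((L.multiple m).addSubgroupOf L.dual))
    (QuotientAddGroup.mk'_surjective _)
  have hdet : L.gram.det ≠ 0 := by
    intro h
    apply L.det_gramMap_rat_ne_zero
    have : L.gramMap ℚ = L.gram.map (Int.castRingHom ℚ) := rfl
    rw [this, ← RingHom.mapMatrix_apply, ← RingHom.map_det, h, map_zero]
  refine AddCommGroup.finite_of_fg_isAddTorsion (L.discGroup m) ?_
  intro x
  obtain ⟨ℓ, rfl⟩ := L.mkD_surjective m x
  rw [isOfFinAddOrder_iff_nsmul_eq_zero]
  refine ⟨m * L.gram.det.natAbs, by positivity, ?_⟩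
  have hz : ∃ α : Fin s → ℤ, L.gram.det.natAbs • ℓ = L.ofInt α := by
    have h1 : L.gram.det • ℓ = L.ofInt (L.gram.adjugate *ᵥ L.dualEquiv ℓ) := by
      apply Subtype.ext
      have hk : (fun i => (L.dualEquiv ℓ i : ℚ)) = L.gramMap ℚ *ᵥ (ℓ : Fin s → ℚ) :=
        funext fun i => L.dualEquiv_apply ℓ i
      have hadj : L.gram.adjugate.map (Int.cast : ℤ → ℚ) = (L.gramMap ℚ).adjugate :=
        RingHom.map_adjugate (Int.castRingHom ℚ) L.gram
      have hd : (L.gram.det : ℚ) = (L.gramMap ℚ).det := RingHom.map_det (Int.castRingHom ℚ) L.gram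
      have h2 : (fun i => ((L.gram.adjugate *ᵥ L.dualEquiv ℓ) i : ℚ)) =
          L.gram.adjugate.map (Int.cast : ℤ → ℚ) *ᵥ fun i => (L.dualEquiv ℓ i : ℚ) := by
        funext i
        simp [Matrix.mulVec, dotProduct]
      rw [coe_ofInt, h2, hadj, hk, Matrix.mulVec_mulVec, Matrix.adjugate_mul, ← hd,
        Matrix.smul_mulVec, Matrix.one_mulVec]
      funext i
      simp
    rcases Int.natAbs_eq L.gram.det with h | h
    · refine ⟨L.gram.adjugate *ᵥ L.dualEquiv ℓ, ?_⟩
      rw [← natCast_zsmul, ← h, h1]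
    · refine ⟨-(L.gram.adjugate *ᵥ L.dualEquiv ℓ), ?_⟩
      have h3 : L.ofInt (-(L.gram.adjugate *ᵥ L.dualEquiv ℓ)) =
          -L.ofInt (L.gram.adjugate *ᵥ L.dualEquiv ℓ) := by
        apply Subtype.ext; funext i; simp [coe_ofInt]
      rw [h3, ← h1, ← natCast_zsmul, ← neg_zsmul]
      congr 1
      omega
  obtain ⟨α, hα⟩ := hz
  have : (m * L.gram.det.natAbs) • L.mkD m ℓ = L.mkD m (m • L.ofInt α) := by
    rw [mul_smul, ← hα]; rfl
  rw [this, ← mkD_zero, eq_comm, mkD_eq_iff]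
  exact ⟨α, by simp⟩

/-- The character `x ↦ e^{π i x}` of `ℚ / 2ℤ`. -/
def expHalf : ℚ ⧸ AddSubgroup.zmultiples (2 : ℚ) → ℂ :=
  Quotient.lift (fun x : ℚ => Complex.exp (Real.pi * Complex.I * x)) (by
    intro a b hab
    have h1 : -a + b ∈ AddSubgroup.zmultiples (2 : ℚ) := QuotientAddGroup.leftRel_apply.mp hab
    obtain ⟨n, hn⟩ := AddSubgroup.mem_zmultiples_iff.mp h1
    have hb : b = a + n * 2 := by simp at hn; linarith
    refine Complex.exp_eq_exp_iff_exists_int.mpr ⟨-n, ?_⟩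
    rw [hb]; push_cast; ring)

/-- `e^{π i q(h)}` for `h ∈ G_m(L)`. -/
def discChar (m : ℕ) (h : L.discGroup m) : ℂ := expHalf (L.discForm m h)

lemma discForm_mkD (m : ℕ) (ℓ : L.dual) :
    L.discForm m (L.mkD m ℓ) = QuotientAddGroup.mk (L.discNorm m ℓ) := rfl

lemma discChar_mkD {m : ℕ} (hm : m ≠ 0) (ℓ : L.dual) : L.discChar m (L.mkD m ℓ) =
    Complex.exp (Real.pi * Complex.I * (L.bil ℚ (ℓ : Fin s → ℚ) ℓ / m : ℚ)) := by
  rw [discChar, discForm_mkD, discNorm, if_neg hm]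
  rfl

/-- The bicharacter `e^{-2π i (h, h') / m}` of `G_m(L)`, obtained from the quadratic form. -/
def bichar (m : ℕ) (h h' : L.discGroup m) : ℂ :=
  L.discChar m h * L.discChar m h' / L.discChar m (h + h')

lemma bichar_mkD {m : ℕ} (hm : m ≠ 0) (ℓ ℓ' : L.dual) : L.bichar m (L.mkD m ℓ) (L.mkD m ℓ') =
    Complex.exp (-(2 * Real.pi * Complex.I * (L.bil ℚ (ℓ : Fin s → ℚ) ℓ' / m : ℚ))) := by
  rw [bichar, ← mkD_add, discChar_mkD _ hm, discChar_mkD _ hm, discChar_mkD _ hm,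
    ← Complex.exp_add, ← Complex.exp_sub]
  congr 1
  rw [AddSubgroup.coe_add, bil_add_left, bil_add_right, bil_add_right,
    L.bil_comm ℚ (ℓ' : Fin s → ℚ) ℓ]
  push_cast
  ring

lemma discChar_ne_zero {m : ℕ} (hm : m ≠ 0) (h : L.discGroup m) : L.discChar m h ≠ 0 := by
  obtain ⟨ℓ, rfl⟩ := L.mkD_surjective m h
  rw [discChar_mkD _ hm]
  exact Complex.exp_ne_zero _

lemma discChar_zero {m : ℕ} (hm : m ≠ 0) : L.discChar m 0 = 1 := by
  rw [← mkD_zero, discChar_mkD _ hm]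
  simp [bil]

lemma bichar_comm (m : ℕ) (h h' : L.discGroup m) : L.bichar m h h' = L.bichar m h' h := by
  rw [bichar, bichar, add_comm h h', mul_comm (L.discChar m h)]

lemma bichar_add_right {m : ℕ} (hm : m ≠ 0) (h h' h'' : L.discGroup m) :
    L.bichar m h (h' + h'') = L.bichar m h h' * L.bichar m h h'' := by
  obtain ⟨ℓ, rfl⟩ := L.mkD_surjective m h
  obtain ⟨ℓ', rfl⟩ := L.mkD_surjective m h'
  obtain ⟨ℓ'', rfl⟩ := L.mkD_surjective m h''
  rw [← mkD_add, bichar_mkD _ hm, bichar_mkD _ hm, bichar_mkD _ hm, ← Complex.exp_add]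
  congr 1
  rw [AddSubgroup.coe_add, bil_add_right]
  push_cast
  ring

lemma bichar_zero_left {m : ℕ} (hm : m ≠ 0) (h : L.discGroup m) : L.bichar m 0 h = 1 := by
  rw [bichar, zero_add, discChar_zero _ hm, one_mul, div_self (L.discChar_ne_zero hm h)]

/-- The bicharacter is nondegenerate. -/
lemma eq_zero_of_bichar_eq_one {m : ℕ} (hm : m ≠ 0) (h : L.discGroup m)
    (hh : ∀ h', L.bichar m h h' = 1) : h = 0 := by
  obtain ⟨ℓ, rfl⟩ := L.mkD_surjective m h
  have key : ∀ i, ∃ n : ℤ, (ℓ : Fin s → ℚ) i = m * n := by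
    intro i
    -- The dual vector `ℓ'` with `Sℓ' = e_i` pairs with `ℓ` to the coordinate `ℓ_i`. Triviality of
    -- the character thus makes `ℓ_i / m` an integer.
    have h1 := hh (L.mkD m (L.dualEquiv.symm (Pi.single i 1)))
    rw [bichar_mkD _ hm, Complex.exp_eq_one_iff] at h1
    obtain ⟨n, hn⟩ := h1
    have hb : L.bil ℚ (ℓ : Fin s → ℚ) (L.dualEquiv.symm (Pi.single i 1) : L.dual) =
        (ℓ : Fin s → ℚ) i := by
      rw [bil_comm, bil_eq_sum, coe_dualEquiv_symm, gram_mulVec_inv_mulVec,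
        Finset.sum_eq_single i]
      · simp
      · intro j _ hj; simp [hj]
      · simp
    rw [hb] at hn
    refine ⟨-n, ?_⟩
    have hm' : (m : ℚ) ≠ 0 := by exact_mod_cast hm
    have h2 : ((ℓ : Fin s → ℚ) i / m : ℚ) = -n := by
      have h3 : (((ℓ : Fin s → ℚ) i / m : ℚ) : ℂ) = ((-n : ℤ) : ℂ) := by
        have h4 : (2 * Real.pi * Complex.I : ℂ) ≠ 0 := Complex.two_pi_I_ne_zero
        apply mul_left_cancel₀ h4
        push_cast at hn ⊢
        linear_combination -hn
      have h5 : (((ℓ : Fin s → ℚ) i / m : ℚ)) = ((-n : ℤ) : ℚ) := by exact_mod_cast h3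
      rw [h5]; push_cast; rfl
    rw [div_eq_iff hm'] at h2
    rw [h2]; push_cast; ring
  choose α hα using key
  rw [← mkD_zero, eq_comm, mkD_eq_iff]
  refine ⟨α, Subtype.ext ?_⟩
  funext i
  simp [coe_ofInt, hα i]

open scoped Classical in
lemma sum_bichar {m : ℕ} (hm : m ≠ 0) [Fintype (L.discGroup m)] (h : L.discGroup m) :
    ∑ h', L.bichar m h h' = if h = 0 then (Fintype.card (L.discGroup m) : ℂ) else 0 := by
  split_ifs with h0
  · subst h0
    simp [bichar_zero_left _ hm]
  · have : ∃ g, L.bichar m h g ≠ 1 := by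
      by_contra hcon
      push Not at hcon
      exact h0 (L.eq_zero_of_bichar_eq_one hm h hcon)
    obtain ⟨g, hg⟩ := this
    have h1 : L.bichar m h g * ∑ h', L.bichar m h h' = ∑ h', L.bichar m h h' := by
      rw [Finset.mul_sum, ← Equiv.sum_comp (Equiv.addLeft g) (fun h' => L.bichar m h h')]
      exact Finset.sum_congr rfl fun h' _ => by simp [bichar_add_right _ hm]
    have h2 : (L.bichar m h g - 1) * ∑ h', L.bichar m h h' = 0 := by
      rw [sub_mul, h1]; ring
    exact (mul_eq_zero.mp h2).resolve_left (sub_ne_zero.mpr hg)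

end EvenLattice

end

noncomputable section

open MeasureTheory Filter Topology

namespace EvenLattice

variable {s : ℕ} (L : EvenLattice s)

/-! ### Theta functions as sums over the dual lattice -/

/-- The term `e^{π i (S[ℓ] τ / m + 2 ᵗℓ S z)}` of the theta functions. -/
def thetaTerm (m : ℕ) (ℓ : L.dual) (τ : ℂ) (z : Fin s → ℂ) : ℂ :=
  Complex.exp (Real.pi * Complex.I * ((L.bil ℚ (ℓ : Fin s → ℚ) ℓ : ℚ) / m * τ +
    2 * L.bil ℂ (fun i => ((ℓ : Fin s → ℚ) i : ℂ)) z))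

lemma norm_ratCast_complex (x : Fin s → ℚ) :
    ‖fun i => (x i : ℂ)‖ = ‖fun i => (x i : ℝ)‖ := by
  have : ∀ i, ‖(x i : ℂ)‖₊ = ‖(x i : ℝ)‖₊ := fun i => by
    apply NNReal.eq
    simp only [coe_nnnorm]
    rw [← Complex.norm_real]
    push_cast
    rfl
  simp only [Pi.norm_def, this]

/-- Coercivity of `S` gives Gaussian decay in `ℓ`, while `z` contributes only a linear exponent. The
bound is uniform for `Im τ ≥ T`, `‖z‖ ≤ R`, as termwise differentiation requires. -/
lemma exists_norm_thetaTerm_le {m : ℕ} (hm : m ≠ 0) {T : ℝ} (hT : 0 < T) (R : ℝ) :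
    ∃ a : ℝ, 0 < a ∧ ∃ b : ℝ, ∀ (ℓ : L.dual) (τ : ℂ) (z : Fin s → ℂ), T ≤ τ.im → ‖z‖ ≤ R →
      ‖L.thetaTerm m ℓ τ z‖ ≤ Real.exp (-a * ‖fun i => ((ℓ : Fin s → ℚ) i : ℝ)‖ ^ 2
        + b * ‖fun i => ((ℓ : Fin s → ℚ) i : ℝ)‖) := by
  obtain ⟨c, hc, hcb⟩ := L.exists_coercive
  obtain ⟨C, hC, hCb⟩ := L.exists_bil_le
  have hm' : 0 < (m : ℝ) := by positivity
  refine ⟨Real.pi * c * T / m, by positivity, 2 * Real.pi * C * R, fun ℓ τ z hτ hz => ?_⟩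
  set t := ‖fun i => ((ℓ : Fin s → ℚ) i : ℝ)‖ with ht
  have ht0 : 0 ≤ t := norm_nonneg _
  rw [thetaTerm, Complex.norm_exp]
  gcongr Real.exp ?_
  have h1 := hcb (fun i => ((ℓ : Fin s → ℚ) i : ℝ))
  rw [bil_ratCast_real, ← ht] at h1
  have h2 := hCb (fun i => ((ℓ : Fin s → ℚ) i : ℂ)) z
  rw [norm_ratCast_complex, ← ht] at h2
  set β := L.bil ℂ (fun i => ((ℓ : Fin s → ℚ) i : ℂ)) z
  set q : ℝ := ((L.bil ℚ (ℓ : Fin s → ℚ) ℓ : ℚ) : ℝ) with hq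
  have hre : (Real.pi * Complex.I * ((L.bil ℚ (ℓ : Fin s → ℚ) ℓ : ℚ) / m * τ + 2 * β)).re =
      -(Real.pi * (q / m * τ.im)) - 2 * Real.pi * β.im := by
    have h3 : ((L.bil ℚ (ℓ : Fin s → ℚ) ℓ : ℚ) : ℂ) / m = ((q / m : ℝ) : ℂ) := by
      rw [hq]; push_cast; rfl
    rw [h3, show (Real.pi : ℂ) * Complex.I * (((q / m : ℝ) : ℂ) * τ + 2 * β) =
      Complex.I * ((Real.pi : ℝ) * (((q / m : ℝ) : ℂ) * τ + (2 : ℝ) * β)) by push_cast; ring]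
    rw [Complex.I_mul_re, Complex.im_ofReal_mul, Complex.add_im, Complex.im_ofReal_mul,
      Complex.im_ofReal_mul]
    ring
  rw [hre]
  have h4 : -β.im ≤ C * t * ‖z‖ := (neg_le_abs _).trans ((Complex.abs_im_le_norm β).trans h2)
  have h5 : C * t * ‖z‖ ≤ C * t * R := by gcongr
  have h6 : c * t ^ 2 * T ≤ q * τ.im := mul_le_mul h1 hτ hT.le (le_trans (by positivity) h1)
  have h7 : c * t ^ 2 * T / m ≤ q * τ.im / m := by gcongr
  have h8 := mul_le_mul_of_nonneg_left h7 Real.pi_pos.le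
  have h9 := mul_le_mul_of_nonneg_left (h4.trans h5) Real.two_pi_pos.le
  have e1 : Real.pi * (q / m * τ.im) = Real.pi * (q * τ.im / m) := by ring
  have e2 : -(Real.pi * c * T / m) * t ^ 2 = -(Real.pi * (c * t ^ 2 * T / m)) := by ring
  rw [e1, e2]
  linarith

lemma summable_norm_thetaTerm {m : ℕ} (hm : m ≠ 0) (τ : UpperHalfPlane) (z : Fin s → ℂ) :
    Summable fun ℓ : L.dual => ‖L.thetaTerm m ℓ τ z‖ := by
  obtain ⟨a, ha, b, h⟩ := L.exists_norm_thetaTerm_le hm τ.im_pos ‖z‖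
  exact Summable.of_nonneg_of_le (fun _ => norm_nonneg _)
    (fun ℓ => h ℓ τ z le_rfl le_rfl) (L.summable_dual ha b)

lemma summable_thetaTerm {m : ℕ} (hm : m ≠ 0) (τ : UpperHalfPlane) (z : Fin s → ℂ) :
    Summable fun ℓ : L.dual => L.thetaTerm m ℓ τ z :=
  (L.summable_norm_thetaTerm hm τ z).of_norm

lemma theta_mkD (m : ℕ) (ℓ : L.dual) (τ : UpperHalfPlane) (z : Fin s → ℂ) :
    L.theta m (L.mkD m ℓ) τ z = L.thetaRep m ℓ τ z := rfl

open scoped Classical in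
-- Substituting `ℓ = ℓ₀ + m n` turns the series over the lattice into one over a coset of `m L` in
-- the dual lattice. Extending by zero puts all classes on a single index set, where they can be
-- added and compared.
lemma hasSum_theta {m : ℕ} (hm : m ≠ 0) (h : L.discGroup m) (τ : UpperHalfPlane)
    (z : Fin s → ℂ) : HasSum (fun ℓ : L.dual => if L.mkD m ℓ = h then L.thetaTerm m ℓ τ z else 0)
      (L.theta m h τ z) := by
  obtain ⟨ℓ₀, rfl⟩ := L.mkD_surjective m h
  have hmC : (m : ℂ) ≠ 0 := by exact_mod_cast hm
  let j : (Fin s → ℤ) → L.dual := fun n => ℓ₀ + m • L.ofInt n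
  have hj : Function.Injective j := by
    intro n n' h
    have h1 : m • L.ofInt n = m • L.ofInt n' := add_left_cancel h
    funext i
    have h2 := congrFun (congrArg Subtype.val h1) i
    simpa [coe_ofInt, hm] using h2
  have hterm : ∀ n, (if L.mkD m (j n) = L.mkD m ℓ₀ then L.thetaTerm m (j n) τ z else 0) =
      L.thetaTerm m (j n) τ z := fun n => if_pos ((L.mkD_eq_iff m _ _).mpr ⟨n, rfl⟩).symm
  rw [← hj.hasSum_iff]
  · rw [show ((fun ℓ : L.dual => if L.mkD m ℓ = L.mkD m ℓ₀ then L.thetaTerm m ℓ τ z else 0) ∘ j) =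
      fun n => L.thetaTerm m (j n) τ z from funext hterm, theta_mkD, thetaRep]
    have hsum : Summable fun n => L.thetaTerm m (j n) τ z :=
      (L.summable_thetaTerm hm τ z).comp_injective hj
    convert hsum.hasSum using 1
    refine tsum_congr fun n => ?_
    have hv : (fun i => (n i : ℂ) + ((ℓ₀ : Fin s → ℚ) i : ℂ) / m) =
        (m : ℂ)⁻¹ • fun i => ((j n : Fin s → ℚ) i : ℂ) := by
      funext i
      simp only [j, Pi.smul_apply, AddSubgroup.coe_add, AddSubgroup.coe_nsmul, coe_ofInt,
        Pi.add_apply, nsmul_eq_mul, Pi.mul_apply, Pi.natCast_apply, smul_eq_mul]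
      push_cast
      field_simp
      ring
    rw [hv, bil_smul_left, bil_smul_left, bil_smul_right, bil_ratCast, thetaTerm]
    congr 1
    field_simp
  · intro ℓ hℓ
    refine if_neg fun h => hℓ ?_
    obtain ⟨α, hα⟩ := (L.mkD_eq_iff m _ _).mp h.symm
    exact ⟨α, hα.symm⟩

end EvenLattice

end

/-! ### Linear independence and elementary symmetries of the theta functions -/

noncomputable section

open MeasureTheory Filter Topology

namespace EvenLattice

variable {s : ℕ} (L : EvenLattice s)

lemma hasSum_sum_theta {m : ℕ} (hm : m ≠ 0) [Fintype (L.discGroup m)] (a : L.discGroup m → ℂ)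
    (τ : UpperHalfPlane) (z : Fin s → ℂ) :
    HasSum (fun ℓ : L.dual => a (L.mkD m ℓ) * L.thetaTerm m ℓ τ z)
      (∑ h, a h * L.theta m h τ z) := by
  classical
  have := hasSum_sum (s := Finset.univ) fun h _ => (L.hasSum_theta hm h τ z).mul_left (a h)
  refine this.congr_fun fun ℓ => ?_
  rw [Finset.sum_eq_single (L.mkD m ℓ)]
  · simp
  · intro h _ hne
    simp [hne.symm]
  · simp

/-- Two absolutely convergent Fourier series in `z` that agree have the same coefficients. -/
lemma dual_fourier_eq_zero {a : L.dual → ℂ} (ha : Summable a)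
    (h : ∀ z : Fin s → ℂ, ∑' ℓ : L.dual, a ℓ * Complex.exp (2 * Real.pi * Complex.I *
      L.bil ℂ (fun i => ((ℓ : Fin s → ℚ) i : ℂ)) z) = 0) : a = 0 := by
  -- For real `z`, in the coordinates `k = Sℓ`, this is an ordinary multiple Fourier series over
  -- `ℤ^s`.
  have h1 : a ∘ L.dualEquiv.symm = 0 := by
    refine fourier_series_eq_zero (L.dualEquiv.symm.toEquiv.summable_iff.mpr ha) fun x => ?_
    rw [← h fun i => x i, ← L.dualEquiv.symm.toEquiv.tsum_eq]
    refine tsum_congr fun k => ?_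
    rw [bil_dual]
    simp
  funext ℓ
  have := congrFun h1 (L.dualEquiv ℓ)
  simpa using this

lemma thetaTerm_eq_mul (m : ℕ) (ℓ : L.dual) (τ : ℂ) (z : Fin s → ℂ) :
    L.thetaTerm m ℓ τ z = L.thetaTerm m ℓ τ 0 * Complex.exp (2 * Real.pi * Complex.I *
      L.bil ℂ (fun i => ((ℓ : Fin s → ℚ) i : ℂ)) z) := by
  rw [thetaTerm, thetaTerm, ← Complex.exp_add, bil_zero_right]
  congr 1
  ring

/-- The theta functions are linearly independent as functions of `z`. -/
lemma theta_linearIndependent {m : ℕ} (hm : m ≠ 0) [Fintype (L.discGroup m)]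
    (a : L.discGroup m → ℂ) (τ : UpperHalfPlane)
    (h : ∀ z, ∑ h, a h * L.theta m h τ z = 0) : a = 0 := by
  have hz : (fun ℓ : L.dual => a (L.mkD m ℓ) * L.thetaTerm m ℓ τ 0) = 0 := by
    refine L.dual_fourier_eq_zero (L.hasSum_sum_theta hm a τ 0).summable fun z => ?_
    rw [← h z, ← (L.hasSum_sum_theta hm a τ z).tsum_eq]
    refine tsum_congr fun ℓ => ?_
    rw [L.thetaTerm_eq_mul m ℓ τ z, mul_assoc]
  funext g
  obtain ⟨ℓ, rfl⟩ := L.mkD_surjective m g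
  have := congrFun hz ℓ
  exact (mul_eq_zero.mp this).resolve_right (Complex.exp_ne_zero _)

lemma theta_combination_injective {m : ℕ} (hm : m ≠ 0) [Fintype (L.discGroup m)]
    (a b : L.discGroup m → ℂ) (τ : UpperHalfPlane)
    (h : ∀ z, ∑ h, a h * L.theta m h τ z = ∑ h, b h * L.theta m h τ z) : a = b := by
  rw [← sub_eq_zero]
  refine L.theta_linearIndependent hm (a - b) τ fun z => ?_
  simp only [Pi.sub_apply, sub_mul, Finset.sum_sub_distrib, h z, sub_self]

lemma theta_neg {m : ℕ} (hm : m ≠ 0) (h : L.discGroup m) (τ : UpperHalfPlane) (z : Fin s → ℂ) :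
    L.theta m h τ (-z) = L.theta m (-h) τ z := by
  classical
  refine (L.hasSum_theta hm h τ (-z)).unique ?_
  have := (Equiv.neg L.dual).hasSum_iff.mpr (L.hasSum_theta hm (-h) τ z)
  refine this.congr_fun fun ℓ => ?_
  simp only [Function.comp, Equiv.neg_apply, mkD_neg, neg_inj]
  refine if_congr Iff.rfl ?_ rfl
  have h1 : (fun i => (((-ℓ : L.dual) : Fin s → ℚ) i : ℂ)) =
      -fun i => ((ℓ : Fin s → ℚ) i : ℂ) := by funext i; simp
  rw [thetaTerm, thetaTerm, h1, bil_neg_right, bil_neg_left, AddSubgroup.coe_neg, bil_neg_left,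
    bil_neg_right, neg_neg]

/-- The factor `e^{πi S[ℓ]/m}` gained by each term depends only on the class of `ℓ`, so it comes out
of the sum. -/
lemma theta_add_one {m : ℕ} (hm : m ≠ 0) (h : L.discGroup m) (τ τ' : UpperHalfPlane)
    (hτ : (τ' : ℂ) = τ + 1) (z : Fin s → ℂ) :
    L.theta m h τ' z = L.discChar m h * L.theta m h τ z := by
  classical
  refine (L.hasSum_theta hm h τ' z).unique ?_
  refine ((L.hasSum_theta hm h τ z).mul_left (L.discChar m h)).congr_fun fun ℓ => ?_
  split_ifs with hℓ
  · subst hℓ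
    rw [discChar_mkD _ hm, thetaTerm, thetaTerm, ← Complex.exp_add, hτ]
    congr 1
    push_cast
    ring
  · simp

lemma bil_ofInt_right_int (ℓ : L.dual) (y : Fin s → ℤ) : ∃ n : ℤ,
    L.bil ℂ (fun i => ((ℓ : Fin s → ℚ) i : ℂ)) (fun i => (y i : ℂ)) = n := by
  obtain ⟨n, hn⟩ := ℓ.2 y
  refine ⟨n, ?_⟩
  have := L.bil_ratCast ℓ (fun i => (y i : ℚ))
  simp only [Rat.cast_intCast] at this
  rw [this, hn, Rat.cast_intCast]

/-- Completing the square: translation by `xτ` moves the term of `ℓ` to that of `ℓ + m x`, up to the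
automorphic factor. Translation by `y` only contributes `e^{2πi(ℓ, y)} = 1`, because `ℓ` is in the
dual lattice. -/
lemma thetaTerm_heis {m : ℕ} (hm : m ≠ 0) (ℓ : L.dual) (τ : ℂ) (z : Fin s → ℂ)
    (x y : Fin s → ℤ) :
    L.thetaTerm m ℓ τ (z + τ • (fun i => (x i : ℂ)) + fun i => (y i : ℂ)) *
      Complex.exp (Real.pi * Complex.I * m * (2 * L.bil ℂ (fun i => (x i : ℂ)) z +
        L.bil ℂ (fun i => (x i : ℂ)) (fun i => (x i : ℂ)) * τ)) =
      L.thetaTerm m (ℓ + m • L.ofInt x) τ z := by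
  have hmC : (m : ℂ) ≠ 0 := by exact_mod_cast hm
  obtain ⟨n, hn⟩ := L.bil_ofInt_right_int ℓ y
  have h1 : (fun i => (((ℓ + m • L.ofInt x : L.dual) : Fin s → ℚ) i : ℂ)) =
      (fun i => ((ℓ : Fin s → ℚ) i : ℂ)) + (m : ℂ) • fun i => (x i : ℂ) := by
    funext i; simp [coe_ofInt]
  rw [thetaTerm, thetaTerm, ← L.bil_ratCast, ← L.bil_ratCast, h1, ← Complex.exp_add]
  simp only [bil_add_left, bil_add_right, bil_smul_left, bil_smul_right, hn]
  rw [L.bil_comm ℂ (fun i => (x i : ℂ)) (fun i => ((ℓ : Fin s → ℚ) i : ℂ))]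
  refine Complex.exp_eq_exp_iff_exists_int.mpr ⟨n, ?_⟩
  field_simp
  ring

lemma theta_heis {m : ℕ} (hm : m ≠ 0) (h : L.discGroup m) (τ : UpperHalfPlane) (z : Fin s → ℂ)
    (x y : Fin s → ℤ) :
    L.theta m h τ (z + (τ : ℂ) • (fun i => (x i : ℂ)) + fun i => (y i : ℂ)) *
      Complex.exp (Real.pi * Complex.I * m * (2 * L.bil ℂ (fun i => (x i : ℂ)) z +
        L.bil ℂ (fun i => (x i : ℂ)) (fun i => (x i : ℂ)) * τ)) = L.theta m h τ z := by
  classical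
  refine ((L.hasSum_theta hm h τ _).mul_right _).unique ?_
  have := (Equiv.addRight (m • L.ofInt x)).hasSum_iff.mpr (L.hasSum_theta hm h τ z)
  refine this.congr_fun fun ℓ => ?_
  simp only [Function.comp, Equiv.coe_addRight]
  have h1 : L.mkD m (ℓ + m • L.ofInt x) = L.mkD m ℓ := ((L.mkD_eq_iff m _ _).mpr ⟨x, rfl⟩).symm
  rw [ite_mul, zero_mul, L.thetaTerm_heis hm]
  exact if_congr (by rw [h1]) rfl rfl

/-! ### Holomorphy of the theta functions -/

/-- The exponent of `thetaTerm`, a linear form in `(τ, z)`. -/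
def thetaExp (m : ℕ) (ℓ : L.dual) : (ℂ × (Fin s → ℂ)) →L[ℂ] ℂ :=
  LinearMap.toContinuousLinearMap
    { toFun := fun p => Real.pi * Complex.I * ((L.bil ℚ (ℓ : Fin s → ℚ) ℓ : ℚ) / m * p.1 +
        2 * L.bil ℂ (fun i => ((ℓ : Fin s → ℚ) i : ℂ)) p.2)
      map_add' := fun p q => by simp only [Prod.fst_add, Prod.snd_add, bil_add_right]; ring
      map_smul' := fun c p => by
        simp only [Prod.smul_fst, Prod.smul_snd, bil_smul_right, smul_eq_mul, RingHom.id_apply]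
        ring }

/-- Differentiating a theta term brings down this linear form, of quadratic growth in `ℓ`. Bounding
it by `e^{2‖ℓ‖}` lets it be absorbed into the linear exponent of the Gaussian majorant. -/
lemma exists_norm_thetaExp_le (m : ℕ) : ∃ K : ℝ, 0 ≤ K ∧ ∀ ℓ : L.dual,
    ‖L.thetaExp m ℓ‖ ≤ K * Real.exp (2 * ‖fun i => ((ℓ : Fin s → ℚ) i : ℝ)‖) := by
  obtain ⟨C, hC, hCb⟩ := L.exists_bil_le
  refine ⟨Real.pi * (C * (m : ℝ)⁻¹ + 2 * C), by positivity, fun ℓ => ?_⟩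
  refine ContinuousLinearMap.opNorm_le_bound _ (by positivity) fun p => ?_
  set t := ‖fun i => ((ℓ : Fin s → ℚ) i : ℝ)‖ with ht
  have ht0 : 0 ≤ t := norm_nonneg _
  have h1 := hCb (fun i => ((ℓ : Fin s → ℚ) i : ℂ)) (fun i => ((ℓ : Fin s → ℚ) i : ℂ))
  have h2 := hCb (fun i => ((ℓ : Fin s → ℚ) i : ℂ)) p.2
  rw [norm_ratCast_complex, ← ht] at h1 h2
  rw [bil_ratCast] at h1
  have e0 : t ≤ Real.exp t := by linarith [Real.add_one_le_exp t]
  have e1 : t * t ≤ Real.exp (2 * t) := by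
    rw [two_mul, Real.exp_add]; exact mul_le_mul e0 e0 ht0 (Real.exp_nonneg _)
  have e2 : t ≤ Real.exp (2 * t) := e0.trans (Real.exp_le_exp.mpr (by linarith))
  have hp1 : ‖p.1‖ ≤ ‖p‖ := norm_fst_le p
  have hp2 : ‖p.2‖ ≤ ‖p‖ := norm_snd_le p
  change ‖(Real.pi : ℂ) * Complex.I * ((L.bil ℚ (ℓ : Fin s → ℚ) ℓ : ℚ) / m * p.1 +
        2 * L.bil ℂ (fun i => ((ℓ : Fin s → ℚ) i : ℂ)) p.2)‖ ≤ _
  rw [norm_mul, norm_mul, Complex.norm_I, mul_one, Complex.norm_real,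
    Real.norm_of_nonneg Real.pi_pos.le, mul_assoc, mul_assoc]
  gcongr
  refine (norm_add_le _ _).trans ?_
  rw [norm_mul, norm_div, norm_mul, Complex.norm_natCast, Complex.norm_ofNat, add_mul]
  refine add_le_add ?_ ?_
  · calc ‖((L.bil ℚ (ℓ : Fin s → ℚ) ℓ : ℚ) : ℂ)‖ / m * ‖p.1‖
        ≤ C * t * t / m * ‖p‖ := by gcongr
      _ = C * (m : ℝ)⁻¹ * ((t * t) * ‖p‖) := by ring
      _ ≤ C * (m : ℝ)⁻¹ * (Real.exp (2 * t) * ‖p‖) := by gcongr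
  · calc 2 * ‖L.bil ℂ (fun i => ((ℓ : Fin s → ℚ) i : ℂ)) p.2‖
        ≤ 2 * (C * t * ‖p‖) := by
          gcongr
          exact h2.trans (by gcongr)
      _ = 2 * C * (t * ‖p‖) := by ring
      _ ≤ 2 * C * (Real.exp (2 * t) * ‖p‖) := by gcongr

/-- The theta functions are holomorphic on `H₁ × ℂ^s`. -/
lemma differentiableOn_tsum_thetaTerm {m : ℕ} (hm : m ≠ 0) (a : L.dual → ℂ)
    (ha : ∀ ℓ, ‖a ℓ‖ ≤ 1) :
    DifferentiableOn ℂ (fun p : ℂ × (Fin s → ℂ) => ∑' ℓ, a ℓ * L.thetaTerm m ℓ p.1 p.2)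
      {p | 0 < p.1.im} := by
  intro p hp
  have hp' : 0 < p.1.im := hp
  set T := p.1.im / 2 with hT
  set R := ‖p.2‖ + 1 with hR
  -- A convex open neighbourhood of `p` on which `Im τ` stays away from `0` and `z` stays bounded,
  -- so that one summable majorant controls all the derivatives.
  let U : Set (ℂ × (Fin s → ℂ)) := {q | T < q.1.im} ∩ {q | q.2 ∈ Metric.ball 0 R}
  have hUo : IsOpen U := by
    refine IsOpen.inter ?_ ?_
    · exact isOpen_lt continuous_const (Complex.continuous_im.comp continuous_fst)
    · exact Metric.isOpen_ball.preimage continuous_snd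
  have hUc : Convex ℝ U := by
    refine Convex.inter ?_ ?_
    · exact (convex_halfSpace_im_gt T).linear_preimage (LinearMap.fst ℝ ℂ (Fin s → ℂ))
    · exact (convex_ball (0 : Fin s → ℂ) R).linear_preimage (LinearMap.snd ℝ ℂ (Fin s → ℂ))
  have hpU : p ∈ U := ⟨by change T < p.1.im; linarith, by simp [hR]⟩
  obtain ⟨A, hA, B, hAB⟩ := L.exists_norm_thetaTerm_le hm (T := T) (by positivity) R
  obtain ⟨K, hK, hKb⟩ := L.exists_norm_thetaExp_le m
  have hu := (L.summable_dual hA (B + 2)).mul_left K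
  have hbound : ∀ (ℓ : L.dual) (q : ℂ × (Fin s → ℂ)), q ∈ U →
      ‖a ℓ • (L.thetaTerm m ℓ q.1 q.2 • L.thetaExp m ℓ)‖ ≤
        K * Real.exp (-A * ‖fun i => ((ℓ : Fin s → ℚ) i : ℝ)‖ ^ 2
          + (B + 2) * ‖fun i => ((ℓ : Fin s → ℚ) i : ℝ)‖) := by
    intro ℓ q hq
    have h1 := hAB ℓ q.1 q.2 (le_of_lt hq.1) (by simpa using (Metric.mem_ball.mp hq.2).le)
    have h2 := hKb ℓ
    rw [norm_smul, norm_smul]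
    calc ‖a ℓ‖ * (‖L.thetaTerm m ℓ q.1 q.2‖ * ‖L.thetaExp m ℓ‖)
        ≤ 1 * (Real.exp (-A * ‖fun i => ((ℓ : Fin s → ℚ) i : ℝ)‖ ^ 2
          + B * ‖fun i => ((ℓ : Fin s → ℚ) i : ℝ)‖) *
          (K * Real.exp (2 * ‖fun i => ((ℓ : Fin s → ℚ) i : ℝ)‖))) := by
          gcongr
          exact ha ℓ
      _ = K * (Real.exp (-A * ‖fun i => ((ℓ : Fin s → ℚ) i : ℝ)‖ ^ 2
          + B * ‖fun i => ((ℓ : Fin s → ℚ) i : ℝ)‖) *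
          Real.exp (2 * ‖fun i => ((ℓ : Fin s → ℚ) i : ℝ)‖)) := by ring
      _ = _ := by rw [← Real.exp_add]; congr 2; ring
  have hsum0 : Summable fun ℓ => a ℓ * L.thetaTerm m ℓ p.1 p.2 := by
    refine Summable.of_norm_bounded (L.summable_norm_thetaTerm hm ⟨p.1, hp'⟩ p.2) fun ℓ => ?_
    rw [norm_mul]
    exact mul_le_of_le_one_left (norm_nonneg _) (ha ℓ)
  have := hasFDerivAt_tsum_of_isPreconnected (𝕜 := ℂ)
    (f := fun ℓ (q : ℂ × (Fin s → ℂ)) => a ℓ * L.thetaTerm m ℓ q.1 q.2)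
    (f' := fun ℓ q => a ℓ • (L.thetaTerm m ℓ q.1 q.2 • L.thetaExp m ℓ)) hu hUo
    hUc.isPreconnected (fun ℓ q _ => ?_) hbound hpU hsum0 hpU
  · exact this.differentiableAt.differentiableWithinAt
  · exact ((L.thetaExp m ℓ).hasFDerivAt.cexp).const_mul (a ℓ)

lemma differentiableOn_theta {m : ℕ} (hm : m ≠ 0) (h : L.discGroup m) :
    DifferentiableOn ℂ
      (fun p : ℂ × (Fin s → ℂ) => L.theta m h (UpperHalfPlane.ofComplex p.1) p.2)
      {p | 0 < p.1.im} := by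
  classical
  refine (L.differentiableOn_tsum_thetaTerm hm (fun ℓ => if L.mkD m ℓ = h then 1 else 0)
    fun ℓ => by split_ifs <;> simp).congr fun p hp => ?_
  rw [← (L.hasSum_theta hm h _ _).tsum_eq]
  refine tsum_congr fun ℓ => ?_
  rw [UpperHalfPlane.ofComplex_apply_of_im_pos hp, ite_mul, one_mul, zero_mul]

end EvenLattice

end

noncomputable section

open MeasureTheory Filter Topology

lemma ofReal_mul_cpow {r : ℝ} (hr : 0 < r) {x : ℂ} (hx : x ≠ 0) (y : ℂ) :
    ((r : ℂ) * x) ^ y = (r : ℂ) ^ y * x ^ y := by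
  have hr' : (r : ℂ) ≠ 0 := Complex.ofReal_ne_zero.mpr hr.ne'
  rw [Complex.cpow_def_of_ne_zero (mul_ne_zero hr' hx), Complex.cpow_def_of_ne_zero hr',
    Complex.cpow_def_of_ne_zero hx, Complex.log_ofReal_mul hr hx, add_mul, Complex.exp_add,
    Complex.ofReal_log hr.le]

namespace EvenLattice

variable {s : ℕ} (L : EvenLattice s)

/-! ### The inversion formula -/

/-- The substitution `v = Bx` with `S = ᵗB B` reduces to a product of one-dimensional Gaussians.
Only the positivity of `D = |det B|⁻¹` and its independence of `b` and `w` are recorded: the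
constant of the inversion formula is recovered later from the functional equation itself. -/
lemma exists_integral_gaussian : ∃ D : ℝ, 0 < D ∧ ∀ (b : ℂ), 0 < b.re → ∀ w : Fin s → ℂ,
    Integrable (fun x : Fin s → ℝ =>
      Complex.exp (-b * L.bil ℂ (fun i => (x i : ℂ)) (fun i => (x i : ℂ)) +
        2 * b * L.bil ℂ (fun i => (x i : ℂ)) w)) ∧
    ∫ x : Fin s → ℝ, Complex.exp (-b * L.bil ℂ (fun i => (x i : ℂ)) (fun i => (x i : ℂ)) +
        2 * b * L.bil ℂ (fun i => (x i : ℂ)) w) =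
      D * (Real.pi / b) ^ (s / 2 : ℂ) * Complex.exp (b * L.bil ℂ w w) := by
  obtain ⟨B, hB, hS⟩ := L.exists_sqrt_gram
  set Bc : Matrix (Fin s) (Fin s) ℂ := B.map Complex.ofReal with hBc
  have hSc : L.gramMap ℂ = Bcᵀ * Bc := by
    have h1 : L.gramMap ℂ = (L.gramMap ℝ).map Complex.ofRealHom := by ext i j; simp
    rw [h1, hS, Matrix.map_mul, Matrix.transpose_map]
    rfl
  have hbil : ∀ u v : Fin s → ℂ, L.bil ℂ u v = ∑ i, (Bc *ᵥ u) i * (Bc *ᵥ v) i := by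
    intro u v
    rw [bil, show L.gram.map (Int.cast : ℤ → ℂ) = Bcᵀ * Bc from hSc, ← Matrix.mulVec_mulVec,
      Matrix.dotProduct_mulVec, Matrix.vecMul_transpose]
    rfl
  have hBx : ∀ (x : Fin s → ℝ) i, (Bc *ᵥ fun j => (x j : ℂ)) i =
      ((Matrix.toLin' B x i : ℝ) : ℂ) := by
    intro x i
    simp [hBc, Matrix.mulVec, dotProduct]
  refine ⟨|B.det⁻¹|, by positivity, fun b hb w => ?_⟩
  set c : Fin s → ℂ := fun i => 2 * b * (Bc *ᵥ w) i with hc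
  set f : (Fin s → ℝ) → ℂ := fun v => Complex.exp (-b * ∑ i, (v i : ℂ) ^ 2 + ∑ i, c i * v i)
    with hf
  have hfx : (fun x : Fin s → ℝ =>
      Complex.exp (-b * L.bil ℂ (fun i => (x i : ℂ)) (fun i => (x i : ℂ)) +
        2 * b * L.bil ℂ (fun i => (x i : ℂ)) w)) = fun x => f (Matrix.toLin' B x) := by
    funext x
    simp only [hf, hbil, hBx, hc]
    congr 3
    · exact Finset.sum_congr rfl fun i _ => by ring
    · rw [Finset.mul_sum]
      exact Finset.sum_congr rfl fun i _ => by ring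
  have hfi : Integrable f := GaussianFourier.integrable_cexp_neg_mul_sum_add hb c
  have hint : ∫ v, f v = (Real.pi / b) ^ (s / 2 : ℂ) * Complex.exp (b * L.bil ℂ w w) := by
    rw [hf, GaussianFourier.integral_cexp_neg_mul_sum_add hb c, Fintype.card_fin]
    congr 2
    have hb0 : b ≠ 0 := by rintro rfl; simp at hb
    rw [hbil, div_eq_iff (by simp [hb0]), Finset.mul_sum, Finset.sum_mul]
    exact Finset.sum_congr rfl fun i _ => by simp only [hc]; ring
  have hmap := Real.map_matrix_volume_pi_eq_smul_volume_pi hB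
  have hcont : Continuous (Matrix.toLin' B) := LinearMap.continuous_of_finiteDimensional _
  have hfc : Continuous f := by
    simp only [hf]
    fun_prop
  rw [hfx]
  constructor
  · have : Integrable f (Measure.map (Matrix.toLin' B) volume) := by
      rw [hmap]
      exact hfi.smul_measure ENNReal.ofReal_ne_top
    exact (integrable_map_measure hfc.aestronglyMeasurable hcont.aemeasurable).mp this
  · rw [← integral_map hcont.aemeasurable hfc.aestronglyMeasurable, hmap, integral_smul_measure,
      hint, ENNReal.toReal_ofReal (abs_nonneg _), mul_assoc]
    rfl

/-- This is the locally uniform majorant required by Poisson summation: a bounded translation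
changes `‖n‖` by at most `R'`, which only perturbs the linear part of the exponent. -/
lemma summable_exp_translate {a : ℝ} (ha : 0 < a) (b : ℝ) (v : Fin s → ℝ) (R : ℝ) :
    ∃ u : (Fin s → ℤ) → ℝ, Summable u ∧ ∀ (n : Fin s → ℤ) (x : Fin s → ℝ), ‖x‖ ≤ R →
      Real.exp (-a * ‖x + (fun i => (n i : ℝ)) + v‖ ^ 2 +
        b * ‖x + (fun i => (n i : ℝ)) + v‖) ≤ u n := by
  set R' := |R| + ‖v‖ with hR'
  have hR0 : 0 ≤ R' := by positivity
  refine ⟨_, (summable_exp_neg_sq_int s ha (2 * a * R' + |b|)).mul_left (Real.exp (|b| * R')),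
    fun n x hx => ?_⟩
  rw [← Real.exp_add]
  gcongr Real.exp ?_
  have hn : ‖fun i => (n i : ℝ)‖ = ‖n‖ := rfl
  set y := ‖x + (fun i => (n i : ℝ)) + v‖
  have hy0 : 0 ≤ y := norm_nonneg _
  have h1 : y ≤ ‖n‖ + R' := by
    have := norm_add₃_le (a := x) (b := fun i => (n i : ℝ)) (c := v)
    rw [hn] at this
    linarith [le_abs_self R]
  have h2 : ‖n‖ ≤ y + R' := by
    have h3 : (fun i => (n i : ℝ)) = (x + (fun i => (n i : ℝ)) + v) + -x + -v := by abel
    have := norm_add₃_le (a := x + (fun i => (n i : ℝ)) + v) (b := -x) (c := -v)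
    rw [← h3, norm_neg, norm_neg, hn] at this
    linarith [le_abs_self R]
  have h4 : b * y ≤ |b| * (‖n‖ + R') :=
    (mul_le_mul_of_nonneg_right (le_abs_self b) hy0).trans (by gcongr)
  have h5 : ‖n‖ ^ 2 - 2 * R' * ‖n‖ ≤ y ^ 2 := by
    rcases le_total R' ‖n‖ with h | h
    · nlinarith
    · nlinarith [norm_nonneg n]
  nlinarith [mul_le_mul_of_nonneg_left h5 ha.le]

/-- First form of the inversion formula. -/
lemma exists_theta_inversion_aux {m : ℕ} (hm : m ≠ 0) : ∃ D : ℝ, 0 < D ∧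
    ∀ (ℓ₀ : L.dual) (τ τ' : UpperHalfPlane), (τ' : ℂ) = -1 / τ → ∀ z : Fin s → ℂ,
      L.theta m (L.mkD m ℓ₀) τ' ((τ : ℂ)⁻¹ • z) =
        D * (-Complex.I * τ) ^ (s / 2 : ℂ) *
          Complex.exp (Real.pi * Complex.I * m * (L.bil ℂ z z / τ)) *
          ∑' ℓ : L.dual, Complex.exp (2 * Real.pi * Complex.I *
            (L.bil ℚ (ℓ : Fin s → ℚ) ℓ₀ / m : ℚ)) * L.thetaTerm m ℓ τ (-z) := by
  obtain ⟨D, hD, hG⟩ := L.exists_integral_gaussian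
  have hmR : 0 < (m : ℝ) := by positivity
  have hmC : (m : ℂ) ≠ 0 := by exact_mod_cast hm
  refine ⟨D * ((m : ℝ)⁻¹) ^ (s / 2 : ℝ), by positivity, fun ℓ₀ τ τ' hτ z => ?_⟩
  have hτ0 : (τ : ℂ) ≠ 0 := τ.ne_zero
  -- With this `b`, the theta term at `(-1/τ, z/τ)` is `exp(-b S[x] + 2b (x, z))` at `x = n + ℓ₀/m`.
  set b : ℂ := Real.pi * Complex.I * m / τ with hb
  have hbre : 0 < b.re := by
    have h1 : b = ((Real.pi * m / Complex.normSq τ : ℝ) : ℂ) * (Complex.I * (starRingEnd ℂ) τ) := by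
      rw [hb, div_eq_mul_inv, Complex.inv_def]
      push_cast
      ring
    have h2 : 0 < Complex.normSq τ := Complex.normSq_pos.mpr hτ0
    rw [h1, Complex.re_ofReal_mul]
    have h3 : (Complex.I * (starRingEnd ℂ) (τ : ℂ)).re = (τ : ℂ).im := by simp
    rw [h3]
    have := τ.im_pos
    have h4 : 0 < (τ : ℂ).im := this
    positivity
  have hb0 : b ≠ 0 := by intro h; rw [h] at hbre; simp at hbre
  set v : Fin s → ℝ := fun i => ((ℓ₀ : Fin s → ℚ) i : ℝ) / m with hv
  set g : (Fin s → ℂ) → (Fin s → ℝ) → ℂ := fun w x =>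
    Complex.exp (-b * L.bil ℂ (fun i => (x i : ℂ)) (fun i => (x i : ℂ)) +
        2 * b * L.bil ℂ (fun i => (x i : ℂ)) w) with hg
  have hgint : ∀ w, Integrable (g w) := fun w => (hG b hbre w).1
  have hgI : ∀ w, ∫ x, g w x = D * (Real.pi / b) ^ (s / 2 : ℂ) * Complex.exp (b * L.bil ℂ w w) :=
    fun w => (hG b hbre w).2
  have hgc : ∀ w, Continuous (g w) := by
    intro w
    simp only [hg, bil, dotProduct, Matrix.mulVec]
    fun_prop
  have hnorm : ∃ a : ℝ, 0 < a ∧ ∃ β : ℝ, ∀ x, ‖g z x‖ ≤ Real.exp (-a * ‖x‖ ^ 2 + β * ‖x‖) := by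
    obtain ⟨c, hc, hcb⟩ := L.exists_coercive
    obtain ⟨C, hC, hCb⟩ := L.exists_bil_le
    refine ⟨b.re * c, by positivity, 2 * ‖b‖ * (C * ‖z‖), fun x => ?_⟩
    rw [hg, Complex.norm_exp]
    gcongr Real.exp ?_
    rw [bil_ofReal, Complex.add_re, Complex.re_mul_ofReal, Complex.neg_re]
    have h1 := hcb x
    have h2 := hCb (fun i => (x i : ℂ)) z
    have h3 : ‖fun i => (x i : ℂ)‖ = ‖x‖ := by simp [Pi.norm_def]
    rw [h3] at h2
    have h4 : (2 * b * L.bil ℂ (fun i => (x i : ℂ)) z).re ≤ 2 * ‖b‖ * (C * ‖x‖ * ‖z‖) := by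
      refine (Complex.re_le_norm _).trans ?_
      rw [norm_mul, norm_mul, Complex.norm_ofNat]
      gcongr
    nlinarith [mul_le_mul_of_nonneg_left h1 hbre.le]
  obtain ⟨a, ha, β, hab⟩ := hnorm
  set f : (Fin s → ℝ) → ℂ := fun x => g z (x + v) with hf
  -- Since `2b · (τ/m) = 2πi`, the character `e^{-2πi(ℓ, x)}` is absorbed by moving the complex
  -- centre of the Gaussian from `z` to `z - (τ/m) ℓ`.
  set w : (Fin s → ℤ) → Fin s → ℂ := fun k => z - ((τ : ℂ) / m) •
    fun i => ((L.dualEquiv.symm k : Fin s → ℚ) i : ℂ) with hw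
  set K : ℂ := D * (Real.pi / b) ^ (s / 2 : ℂ) with hK
  have hhat : ∀ k : Fin s → ℤ,
      ∫ x, Complex.exp (-(2 * Real.pi * Complex.I * ∑ i, (k i : ℂ) * x i)) * f x =
      K * Complex.exp (Real.pi * Complex.I * m * (L.bil ℂ z z / τ)) *
       (Complex.exp (2 * Real.pi * Complex.I *
            (L.bil ℚ (L.dualEquiv.symm k : Fin s → ℚ) ℓ₀ / m : ℚ)) *
          L.thetaTerm m (L.dualEquiv.symm k) τ (-z)) := by
    intro k
    have hkx : ∀ x : Fin s → ℝ, ∑ i, (k i : ℂ) * x i =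
        L.bil ℂ (fun i => ((L.dualEquiv.symm k : Fin s → ℚ) i : ℂ)) (fun i => (x i : ℂ)) := by
      intro x
      rw [bil_dual, AddEquiv.apply_symm_apply]
    simp only [hkx]
    set ℓ := L.dualEquiv.symm k
    set ℓc : Fin s → ℂ := fun i => ((ℓ : Fin s → ℚ) i : ℂ) with hℓc
    rw [← integral_sub_right_eq_self _ v]
    have hv2 : L.bil ℂ ℓc (fun i => (v i : ℂ)) = ((L.bil ℚ (ℓ : Fin s → ℚ) ℓ₀ / m : ℚ) : ℂ) := by
      have : (fun i => (v i : ℂ)) = (m : ℂ)⁻¹ • fun i => ((ℓ₀ : Fin s → ℚ) i : ℂ) := by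
        funext i
        simp [hv]
        ring
      rw [this, bil_smul_right, hℓc, bil_ratCast]
      push_cast
      ring
    have hfun : (fun x : Fin s → ℝ => Complex.exp (-(2 * Real.pi * Complex.I *
        L.bil ℂ ℓc (fun i => ((x - v) i : ℂ)))) * f (x - v)) =
        fun x => Complex.exp (2 * Real.pi * Complex.I *
            (L.bil ℚ (ℓ : Fin s → ℚ) ℓ₀ / m : ℚ)) * g (w k) x := by
      funext x
      simp only [hf, hg, hw, sub_add_cancel]
      rw [← Complex.exp_add, ← Complex.exp_add]
      congr 1
      have : (fun i => (((x - v) i : ℝ) : ℂ)) = (fun i => (x i : ℂ)) - fun i => (v i : ℂ) := by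
        funext i; simp
      rw [this, bil_sub_right, hv2, bil_sub_right, bil_smul_right,
        L.bil_comm ℂ (fun i => (x i : ℂ)) ℓc, hb]
      field_simp
      ring
    rw [hfun, integral_const_mul, hgI]
    have hexp : Complex.exp (b * L.bil ℂ (w k) (w k)) =
        Complex.exp (Real.pi * Complex.I * m * (L.bil ℂ z z / τ)) * L.thetaTerm m ℓ τ (-z) := by
      rw [thetaTerm, ← Complex.exp_add, ← bil_ratCast]
      congr 1
      simp only [hw]
      change b * L.bil ℂ (z - ((τ : ℂ) / m) • ℓc) (z - ((τ : ℂ) / m) • ℓc) =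
        Real.pi * Complex.I * m * (L.bil ℂ z z / τ) + Real.pi * Complex.I *
          (L.bil ℂ ℓc ℓc / m * τ + 2 * L.bil ℂ ℓc (-z))
      rw [bil_sub_right, bil_sub_left, bil_sub_left, bil_smul_left, bil_smul_right, bil_smul_right,
        bil_smul_left, bil_neg_right, L.bil_comm ℂ z ℓc, hb]
      field_simp
      ring
    rw [hexp]
    ring
  have hsumm : Summable fun ℓ : L.dual => Complex.exp (2 * Real.pi * Complex.I *
            (L.bil ℚ (ℓ : Fin s → ℚ) ℓ₀ / m : ℚ)) * L.thetaTerm m ℓ τ (-z) := by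
    refine Summable.of_norm_bounded (L.summable_norm_thetaTerm hm τ (-z)) fun ℓ => ?_
    rw [norm_mul]
    refine mul_le_of_le_one_left (norm_nonneg _) (le_of_eq ?_)
    rw [Complex.norm_exp]
    have : (2 * Real.pi * Complex.I * ((L.bil ℚ (ℓ : Fin s → ℚ) ℓ₀ / m : ℚ) : ℂ)).re = 0 := by
      rw [show ((L.bil ℚ (ℓ : Fin s → ℚ) ℓ₀ / m : ℚ) : ℂ) =
        (((L.bil ℚ (ℓ : Fin s → ℚ) ℓ₀ / m : ℚ) : ℝ) : ℂ) by push_cast; rfl]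
      simp
    rw [this, Real.exp_zero]
  have hpoisson := tsum_int_eq_tsum_fourier (f := f) (by simp only [hf]; fun_prop)
    ((hgint z).comp_add_right v) (fun R => by
      obtain ⟨u, hu, hub⟩ := summable_exp_translate ha β v R
      exact ⟨u, hu, fun n x hx => (hab _).trans (hub n x hx)⟩)
    (by
      simp only [hhat]
      exact (L.dualEquiv.symm.toEquiv.summable_iff.mpr hsumm).mul_left _)
  simp only [hhat] at hpoisson
  rw [tsum_mul_left] at hpoisson
  have hre := L.dualEquiv.symm.toEquiv.tsum_eq (fun ℓ : L.dual =>
    Complex.exp (2 * Real.pi * Complex.I * (L.bil ℚ (ℓ : Fin s → ℚ) ℓ₀ / m : ℚ)) *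
      L.thetaTerm m ℓ τ (-z))
  have hre' : ∑' k : Fin s → ℤ, Complex.exp (2 * Real.pi * Complex.I *
      (L.bil ℚ (L.dualEquiv.symm k : Fin s → ℚ) ℓ₀ / m : ℚ)) *
      L.thetaTerm m (L.dualEquiv.symm k) τ (-z) = _ := hre
  rw [hre'] at hpoisson
  -- Here `π/b = m⁻¹ (-iτ)`; the positive real factor may be split off without crossing the branch
  -- cut of the complex power.
  have hKval : K = ((D * ((m : ℝ)⁻¹) ^ (s / 2 : ℝ) : ℝ) : ℂ) * (-Complex.I * τ) ^ (s / 2 : ℂ) := by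
    have h1 : (Real.pi : ℂ) / b = (((m : ℝ)⁻¹ : ℝ) : ℂ) * (-Complex.I * τ) := by
      rw [hb]
      push_cast
      have hpi : (Real.pi : ℂ) ≠ 0 := by exact_mod_cast Real.pi_ne_zero
      field_simp
      rw [Complex.I_sq]
      ring
    rw [hK, h1, ofReal_mul_cpow (by positivity) (by simp [hτ0])]
    push_cast
    rw [Complex.ofReal_cpow (by positivity)]
    push_cast
    ring
  rw [← hKval, ← hpoisson, theta_mkD, thetaRep]
  refine tsum_congr fun n => ?_
  simp only [hf, hg]
  congr 1
  have h1 : (fun i => ((((fun i => (n i : ℝ)) + v) i : ℝ) : ℂ)) =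
      fun i => (n i : ℂ) + ((ℓ₀ : Fin s → ℚ) i : ℂ) / m := by
    funext i; simp [hv]
  rw [h1, bil_smul_right, hτ, hb]
  field_simp

end EvenLattice

end

/-! ### The constant of the inversion formula and Milgram's formula -/

noncomputable section

open MeasureTheory Filter Topology

/-- The factor `N^{-1/2} (-iτ)^{s/2}` of the inversion formula. -/
def inversionFactor (N s : ℕ) (τ : ℂ) : ℂ :=
  (((Real.sqrt N)⁻¹ : ℝ) : ℂ) * (-Complex.I * τ) ^ (s / 2 : ℂ)

/-- Both numbers have modulus `√2`, and their principal arguments are `∓π/4`. This is the source of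
the eighth root of unity in Milgram's formula. -/
lemma exp_cpow_ratio (s : ℕ) : (1 - Complex.I) ^ (s / 2 : ℂ) / (1 + Complex.I) ^ (s / 2 : ℂ) =
    Complex.exp (-(Real.pi * Complex.I * s / 4)) := by
  have h1 : (1 + Complex.I) ≠ 0 := fun h => by simpa using congrArg Complex.re h
  have h2 : (1 - Complex.I) ≠ 0 := fun h => by simpa using congrArg Complex.re h
  have key : ∀ θ : ℝ, θ ∈ Set.Ioc (-Real.pi) Real.pi →
      Complex.log ((Real.sqrt 2 : ℝ) * Complex.exp (θ * Complex.I)) =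
        Real.log (Real.sqrt 2) + θ * Complex.I := by
    intro θ hθ
    rw [Complex.log_ofReal_mul (by positivity) (Complex.exp_ne_zero _), Complex.log_exp] <;>
      simp [hθ.1, hθ.2]
  have hsq : Real.sqrt 2 * (Real.sqrt 2 / 2) = 1 := by
    rw [mul_div_assoc', Real.mul_self_sqrt (by norm_num)]; norm_num
  have hsqc : ((Real.sqrt 2 : ℝ) : ℂ) * ((Real.sqrt 2 / 2 : ℝ) : ℂ) = 1 := by exact_mod_cast hsq
  have e1 : (1 + Complex.I) = (Real.sqrt 2 : ℝ) * Complex.exp ((Real.pi / 4 : ℝ) * Complex.I) := by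
    rw [Complex.exp_mul_I, ← Complex.ofReal_cos, ← Complex.ofReal_sin, Real.cos_pi_div_four,
      Real.sin_pi_div_four]
    linear_combination -(1 + Complex.I) * hsqc
  have e2 : (1 - Complex.I) =
      (Real.sqrt 2 : ℝ) * Complex.exp ((-(Real.pi / 4) : ℝ) * Complex.I) := by
    rw [Complex.exp_mul_I, ← Complex.ofReal_cos, ← Complex.ofReal_sin, Real.cos_neg, Real.sin_neg,
      Real.cos_pi_div_four, Real.sin_pi_div_four]
    push_cast at hsqc ⊢
    linear_combination -(1 - Complex.I) * hsqc
  rw [Complex.cpow_def_of_ne_zero h1, Complex.cpow_def_of_ne_zero h2, ← Complex.exp_sub, e1, e2,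
    key _ ⟨by linarith [Real.pi_pos], by linarith [Real.pi_pos]⟩,
    key _ ⟨by linarith [Real.pi_pos], by linarith [Real.pi_pos]⟩]
  congr 1
  push_cast
  ring

namespace EvenLattice

variable {s : ℕ} (L : EvenLattice s)

/-- The sum over the dual lattice is grouped by classes; the sign of `z` is absorbed by replacing
`h'` with `-h'`, which also produces the minus sign in the bicharacter. -/
lemma exists_theta_inversion {m : ℕ} (hm : m ≠ 0) [Fintype (L.discGroup m)] : ∃ D : ℝ, 0 < D ∧
    ∀ (h : L.discGroup m) (τ τ' : UpperHalfPlane), (τ' : ℂ) = -1 / τ → ∀ z : Fin s → ℂ,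
      L.theta m h τ' ((τ : ℂ)⁻¹ • z) =
        D * (-Complex.I * τ) ^ (s / 2 : ℂ) *
          Complex.exp (Real.pi * Complex.I * m * (L.bil ℂ z z / τ)) *
          ∑ h', L.bichar m h h' * L.theta m h' τ z := by
  obtain ⟨D, hD, hDt⟩ := L.exists_theta_inversion_aux hm
  refine ⟨D, hD, fun h τ τ' hτ z => ?_⟩
  obtain ⟨ℓ₀, rfl⟩ := L.mkD_surjective m h
  rw [hDt ℓ₀ τ τ' hτ z]
  congr 1
  rw [← Equiv.sum_comp (Equiv.neg (L.discGroup m))]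
  simp only [Equiv.neg_apply, ← theta_neg L hm]
  rw [← (L.hasSum_sum_theta hm (fun h' => L.bichar m (L.mkD m ℓ₀) (-h')) τ (-z)).tsum_eq]
  refine tsum_congr fun ℓ => ?_
  rw [← mkD_neg, bichar_mkD _ hm, AddSubgroup.coe_neg, bil_neg_right,
    L.bil_comm ℚ (ℓ₀ : Fin s → ℚ) ℓ]
  congr 2
  push_cast
  ring

/-- The inversion formula of the theta functions. -/
theorem theta_inversion {m : ℕ} (hm : m ≠ 0) [Fintype (L.discGroup m)] (h : L.discGroup m)
    (τ τ' : UpperHalfPlane) (hτ : (τ' : ℂ) = -1 / τ) (z : Fin s → ℂ) :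
    L.theta m h τ' ((τ : ℂ)⁻¹ • z) = inversionFactor (Fintype.card (L.discGroup m)) s τ *
      Complex.exp (Real.pi * Complex.I * m * (L.bil ℂ z z / τ)) *
        ∑ h', L.bichar m h h' * L.theta m h' τ z := by
  classical
  obtain ⟨D, hD, hDt⟩ := L.exists_theta_inversion hm
  suffices hcard : D = (Real.sqrt (Fintype.card (L.discGroup m)))⁻¹ by
    rw [hDt h τ τ' hτ z, inversionFactor, hcard]
  set ι : UpperHalfPlane := UpperHalfPlane.I
  have hι : (ι : ℂ) = Complex.I := rfl
  have hιι : (ι : ℂ) = -1 / (ι : ℂ) := by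
    rw [hι, eq_div_iff Complex.I_ne_zero, Complex.I_mul_I]
  have hone : (-Complex.I * (ι : ℂ)) ^ (s / 2 : ℂ) = 1 := by
    rw [hι, neg_mul, Complex.I_mul_I, neg_neg, Complex.one_cpow]
  -- The inversion is applied twice at its fixed point `i`, where `(-iτ)^{s/2} = 1` and the
  -- exponential factors cancel. Orthogonality of characters leaves `D² |G|` times the original
  -- function, and `D > 0` then fixes `D`.
  have key : ∀ z, L.theta m 0 ι z = ((D ^ 2 * Fintype.card (L.discGroup m) : ℝ) : ℂ) *
      L.theta m 0 ι z := by
    intro z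
    have h1 := hDt 0 ι ι hιι ((ι : ℂ) • z)
    rw [smul_smul, inv_mul_cancel₀ ι.ne_zero, one_smul, hone, mul_one] at h1
    have h2 : ∀ h', L.theta m h' ι ((ι : ℂ) • z) = D *
        Complex.exp (Real.pi * Complex.I * m * (L.bil ℂ z z / ι)) *
          ∑ h'', L.bichar m h' h'' * L.theta m h'' ι (-z) := by
      intro h'
      have h3 := hDt h' ι ι hιι (-z)
      rw [hone, mul_one, bil_neg_left, bil_neg_right, neg_neg] at h3
      rw [← h3]
      congr 1
      rw [smul_neg, ← neg_smul]
      congr 1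
      rw [hι, Complex.inv_I, neg_neg]
    simp only [h2] at h1
    have hE : Complex.exp (Real.pi * Complex.I * m * (L.bil ℂ ((ι : ℂ) • z) ((ι : ℂ) • z) / ι)) *
        Complex.exp (Real.pi * Complex.I * m * (L.bil ℂ z z / ι)) = 1 := by
      rw [← Complex.exp_add, Complex.exp_eq_one_iff]
      refine ⟨0, ?_⟩
      rw [bil_smul_left, bil_smul_right, hι]
      have : (Complex.I : ℂ) ≠ 0 := Complex.I_ne_zero
      field_simp
      rw [Complex.I_sq]
      simp
    have hdbl : ∑ h', L.bichar m 0 h' * (D *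
        Complex.exp (Real.pi * Complex.I * m * (L.bil ℂ z z / ι)) *
          ∑ h'', L.bichar m h' h'' * L.theta m h'' ι (-z)) = D *
        Complex.exp (Real.pi * Complex.I * m * (L.bil ℂ z z / ι)) *
          (Fintype.card (L.discGroup m) * L.theta m 0 ι z) := by
      simp only [bichar_zero_left _ hm, one_mul]
      rw [← Finset.mul_sum]
      congr 1
      rw [Finset.sum_comm]
      have : ∀ h'', ∑ h', L.bichar m h' h'' * L.theta m h'' ι (-z) =
          if h'' = 0 then (Fintype.card (L.discGroup m) : ℂ) * L.theta m h'' ι (-z) else 0 := by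
        intro h''
        rw [← Finset.sum_mul]
        simp only [fun h' => L.bichar_comm m h' h'']
        rw [sum_bichar _ hm, ite_mul, zero_mul]
      simp only [this]
      rw [Finset.sum_ite_eq' Finset.univ (0 : L.discGroup m)]
      simp [theta_neg L hm]
    rw [hdbl] at h1
    refine h1.trans ?_
    push_cast
    linear_combination ((D : ℂ) ^ 2 * Fintype.card (L.discGroup m) * L.theta m 0 ι z) * hE
  have h5 : D ^ 2 * Fintype.card (L.discGroup m) = 1 := by
    have h6 := L.theta_combination_injective hm (Pi.single 0 1)
      (Pi.single 0 ((D ^ 2 * Fintype.card (L.discGroup m) : ℝ) : ℂ)) ι (fun z => by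
        rw [Finset.sum_eq_single 0 (fun b _ hb => by simp [hb]) (by simp),
          Finset.sum_eq_single 0 (fun b _ hb => by simp [hb]) (by simp)]
        simpa using key z)
    have h7 := congrFun h6 0
    simp only [Pi.single_eq_same] at h7
    exact_mod_cast h7.symm
  have hN : (0 : ℝ) < Fintype.card (L.discGroup m) := by exact_mod_cast Fintype.card_pos
  have h8 : D ^ 2 = ((Real.sqrt (Fintype.card (L.discGroup m)))⁻¹) ^ 2 := by
    rw [inv_pow, Real.sq_sqrt hN.le]
    exact eq_inv_of_mul_eq_one_left h5
  exact (pow_left_inj₀ hD.le (by positivity) two_ne_zero).mp h8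

/-- **Milgram's formula** for the conjugate Gauss sum of the finite quadratic module `G_m(L)`. -/
theorem gauss_sum {m : ℕ} (hm : m ≠ 0) [Fintype (L.discGroup m)] :
    ∑ h, (L.discChar m h)⁻¹ = (Real.sqrt (Fintype.card (L.discGroup m)) : ℝ) *
      Complex.exp (-(Real.pi * Complex.I * s / 4)) := by
  set N := Fintype.card (L.discGroup m) with hN
  have hI2 := Complex.I_sq
  have hp : (1 + Complex.I) ≠ 0 := fun h => by simpa using congrArg Complex.re h
  have hp' : (Complex.I + 1) ≠ 0 := by rwa [add_comm]
  have hq : (Complex.I - 1) ≠ 0 := fun h => by simpa using congrArg Complex.re h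
  let ι : UpperHalfPlane := UpperHalfPlane.I
  let ιp : UpperHalfPlane := ⟨Complex.I + 1, by simp⟩
  let ιm : UpperHalfPlane := ⟨Complex.I - 1, by simp⟩
  let τa : UpperHalfPlane := ⟨-1 / (Complex.I + 1), by
    rw [show -1 / (Complex.I + 1) = (Complex.I - 1) / 2 by
      field_simp; linear_combination -hI2]
    simp⟩
  let τb : UpperHalfPlane := ⟨-1 / (Complex.I - 1), by
    rw [show -1 / (Complex.I - 1) = (Complex.I + 1) / 2 by
      field_simp; linear_combination -hI2]
    simp⟩
  have hι : (ι : ℂ) = Complex.I := rfl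
  have hιp : (ιp : ℂ) = Complex.I + 1 := rfl
  have hιm : (ιm : ℂ) = Complex.I - 1 := rfl
  have hιι : (ι : ℂ) = -1 / (ι : ℂ) := by
    rw [hι, eq_div_iff Complex.I_ne_zero, Complex.I_mul_I]
  have hab : (τb : ℂ) = τa + 1 := by
    change -1 / (Complex.I - 1) = -1 / (Complex.I + 1) + 1
    field_simp
    linear_combination -hI2
  -- The relation `T S T = S T⁻¹ S` of transformations of the half plane, evaluated at `i`. The
  -- function `ϑ_0` agrees at `τa` and `τb = τa + 1`; its value at `τa` is expanded through `S` and
  -- `T`, that at `τb` through `S`, `T⁻¹` and again `S`. The argument `i z` in the second expansion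
  -- makes the two `z`-variables match. Comparing the coefficients of `ϑ_0` gives the Gauss sum.
  have hcomb := L.theta_combination_injective hm
    (fun h => inversionFactor N s ιp * L.discChar m h)
    (fun h => inversionFactor N s ιm * inversionFactor N s ι *
      ∑ g, (L.discChar m g)⁻¹ * L.bichar m g (-h)) ι (fun z => by
    have e1 := L.theta_inversion hm 0 ιp τa rfl z
    have e2 := L.theta_inversion hm 0 ιm τb rfl (Complex.I • z)
    have e3 := L.theta_add_one hm 0 τa τb hab ((ιp : ℂ)⁻¹ • z)
    rw [discChar_zero _ hm, one_mul] at e3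
    have hvec : (ιm : ℂ)⁻¹ • Complex.I • z = (ιp : ℂ)⁻¹ • z := by
      rw [smul_smul]
      congr 1
      rw [hιm, hιp]
      field_simp
      linear_combination hI2
    rw [hvec, e3, e1] at e2
    simp only [bichar_zero_left _ hm, one_mul] at e2
    have e4 : ∀ h, L.theta m h ιp z = L.discChar m h * L.theta m h ι z :=
      fun h => L.theta_add_one hm h ι ιp rfl z
    have e5 : ∀ h, L.theta m h ιm (Complex.I • z) = (L.discChar m h)⁻¹ *
        (inversionFactor N s ι * Complex.exp (Real.pi * Complex.I * m * (L.bil ℂ z z / ι)) *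
        ∑ h', L.bichar m h (-h') * L.theta m h' ι z) := by
      intro h
      have e6 := L.theta_add_one hm h ιm ι (by rw [hι, hιm]; ring) (Complex.I • z)
      have e7 := L.theta_inversion hm h ι ι hιι (-z)
      rw [bil_neg_left, bil_neg_right, neg_neg] at e7
      have e8 : (ι : ℂ)⁻¹ • (-z) = Complex.I • z := by
        rw [smul_neg, ← neg_smul, hι, Complex.inv_I, neg_neg]
      rw [e8, e6] at e7
      rw [eq_inv_mul_iff_mul_eq₀ (L.discChar_ne_zero hm h), e7]
      congr 1
      rw [← Equiv.sum_comp (Equiv.neg (L.discGroup m))]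
      refine Finset.sum_congr rfl fun h' _ => ?_
      simp [theta_neg L hm]
    simp only [e4, e5] at e2
    have hE : Complex.exp (Real.pi * Complex.I * m *
          (L.bil ℂ (Complex.I • z) (Complex.I • z) / ιm)) *
        Complex.exp (Real.pi * Complex.I * m * (L.bil ℂ z z / ι)) =
        Complex.exp (Real.pi * Complex.I * m * (L.bil ℂ z z / ιp)) := by
      rw [← Complex.exp_add, bil_smul_left, bil_smul_right, hι, hιm, hιp]
      congr 1
      have hI0 := Complex.I_ne_zero
      have : Complex.I * Complex.I / (Complex.I - 1) + 1 / Complex.I = 1 / (Complex.I + 1) := by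
        field_simp
        linear_combination (Complex.I ^ 2 + Complex.I - 1) * hI2
      linear_combination (Real.pi * Complex.I * m * L.bil ℂ z z) * this
    have hE0 := Complex.exp_ne_zero (Real.pi * Complex.I * m * (L.bil ℂ z z / ιp))
    apply mul_left_cancel₀ hE0
    calc _ = inversionFactor N s ιp * Complex.exp (Real.pi * Complex.I * m * (L.bil ℂ z z / ιp)) *
          ∑ h, L.discChar m h * L.theta m h ι z := by
          rw [Finset.mul_sum, Finset.mul_sum]
          exact Finset.sum_congr rfl fun h _ => by ring
      _ = _ := e2
      _ = _ := by
          rw [← hE]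
          simp only [Finset.mul_sum, Finset.sum_mul]
          rw [Finset.sum_comm]
          exact Finset.sum_congr rfl fun h _ => Finset.sum_congr rfl fun g _ => by ring)
  have h0 := congrFun hcomb 0
  simp only [discChar_zero _ hm, neg_zero, fun g => L.bichar_comm m g 0, bichar_zero_left _ hm,
    mul_one] at h0
  have hN0 : N ≠ 0 := Fintype.card_ne_zero
  have hfι : inversionFactor N s ι = (((Real.sqrt N)⁻¹ : ℝ) : ℂ) := by
    rw [inversionFactor, hι, neg_mul, Complex.I_mul_I, neg_neg, Complex.one_cpow, mul_one]
  have hs0 : ((Real.sqrt N : ℝ) : ℂ) ≠ 0 := by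
    have : Real.sqrt N ≠ 0 := by positivity
    exact_mod_cast this
  have hm1 : (-Complex.I * (ιm : ℂ)) = 1 + Complex.I := by
    rw [hιm]; linear_combination -hI2
  have hp1 : (-Complex.I * (ιp : ℂ)) = 1 - Complex.I := by
    rw [hιp]; linear_combination -hI2
  have hc0 : (1 + Complex.I) ^ (s / 2 : ℂ) ≠ 0 := by
    rw [Complex.cpow_ne_zero_iff]; exact Or.inl hp
  rw [← exp_cpow_ratio]
  rw [hfι, inversionFactor, inversionFactor, hm1, hp1] at h0
  push_cast at h0
  field_simp at h0 ⊢
  linear_combination -h0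

end EvenLattice

end

noncomputable section

namespace EvenLattice

variable {s : ℕ} (L : EvenLattice s)

/-! ### The structure of the real Jacobi group -/

lemma slMat_eq (s : ℕ) (A : Matrix.SpecialLinearGroup (Fin 2) ℝ) :
    slMat s A = Matrix.fromBlocks !![A 0 0, -A 0 1; -A 1 0, A 1 1] 0 0
      (Matrix.fromBlocks 1 0 0 A.1) := by
  rw [slMat]
  congr 1
  rw [Matrix.SpecialLinearGroup.coe_inv, Matrix.adjugate_fin_two]
  ext i j
  fin_cases i <;> fin_cases j <;> simp [Matrix.mul_apply, Matrix.vecMul, dotProduct]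

lemma slMat_one (s : ℕ) : slMat s 1 = 1 := by
  rw [slMat_eq]
  have h : (!![(1 : Matrix.SpecialLinearGroup (Fin 2) ℝ) 0 0, -(1 : Matrix.SpecialLinearGroup (Fin 2) ℝ) 0 1;
      -(1 : Matrix.SpecialLinearGroup (Fin 2) ℝ) 1 0, (1 : Matrix.SpecialLinearGroup (Fin 2) ℝ) 1 1] :
      Matrix (Fin 2) (Fin 2) ℝ) = 1 := by
    ext i j
    fin_cases i <;> fin_cases j <;> simp
  rw [h, Matrix.SpecialLinearGroup.coe_one, Matrix.fromBlocks_one, Matrix.fromBlocks_one]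

lemma slMat_mul (s : ℕ) (A B : Matrix.SpecialLinearGroup (Fin 2) ℝ) :
    slMat s (A * B) = slMat s A * slMat s B := by
  simp only [slMat_eq, Matrix.fromBlocks_multiply, Matrix.mul_zero, Matrix.zero_mul, add_zero,
    zero_add, Matrix.mul_one]
  congr 1
  ext i j
  fin_cases i <;> fin_cases j <;>
    simp [Matrix.mul_apply, Fin.sum_univ_two, Matrix.SpecialLinearGroup.coe_mul] <;> ring

/-- The upper middle block of `heisMat`. -/
def heisRows (x y : Fin s → ℝ) : Matrix (Fin 2) (Fin s) ℝ :=
  Matrix.of ![y ᵥ* L.gram.map (Int.cast : ℤ → ℝ), x ᵥ* L.gram.map (Int.cast : ℤ → ℝ)]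

/-- The middle right block of `heisMat`. -/
def heisCols (x y : Fin s → ℝ) : Matrix (Fin s) (Fin 2) ℝ := Matrix.of fun i => ![x i, y i]

/-- The upper right block of `heisMat`. -/
def heisCorner (x y : Fin s → ℝ) (r : ℝ) : Matrix (Fin 2) (Fin 2) ℝ :=
  !![L.bil ℝ x y - r, L.bil ℝ y y / 2; L.bil ℝ x x / 2, r]

lemma heisMat_eq (x y : Fin s → ℝ) (r : ℝ) :
    L.heisMat x y r = Matrix.fromBlocks 1
      (Matrix.fromCols (L.heisRows x y) (L.heisCorner x y r)) 0
      (Matrix.fromBlocks 1 (heisCols x y) 0 1) := rfl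

lemma heisRows_mul_heisCols (x y x' y' : Fin s → ℝ) : L.heisRows x y * heisCols x' y' =
    !![L.bil ℝ y x', L.bil ℝ y y'; L.bil ℝ x x', L.bil ℝ x y'] := by
  ext i j
  fin_cases i <;> fin_cases j <;>
    simpa [Matrix.mul_apply, heisRows, heisCols, bil, dotProduct] using
      (Matrix.dotProduct_mulVec _ _ _).symm

lemma heisRows_add (x y x' y' : Fin s → ℝ) :
    L.heisRows (x + x') (y + y') = L.heisRows x' y' + L.heisRows x y := by
  ext i j
  fin_cases i <;> simp [heisRows, Matrix.add_vecMul, add_comm]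

lemma heisCols_add (x y x' y' : Fin s → ℝ) :
    heisCols (x + x') (y + y') = heisCols x' y' + heisCols x y := by
  ext i j
  fin_cases j <;> simp [heisCols, add_comm]

lemma heisMat_mul (x y : Fin s → ℝ) (r : ℝ) (x' y' : Fin s → ℝ) (r' : ℝ) :
    L.heisMat x y r * L.heisMat x' y' r' =
      L.heisMat (x + x') (y + y') (r + r' + L.bil ℝ x y') := by
  simp only [heisMat_eq, Matrix.fromBlocks_multiply, Matrix.fromCols_mul_fromBlocks,
    Matrix.mul_zero, Matrix.zero_mul, add_zero, zero_add, Matrix.mul_one, Matrix.one_mul,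
    heisRows_mul_heisCols]
  rw [heisRows_add, heisCols_add]
  congr 1
  ext i (j | j)
  · simp
  · simp only [Matrix.add_apply, Matrix.fromCols_apply_inr, heisCorner]
    fin_cases i <;> fin_cases j <;>
      simp [bil_add_left, bil_add_right] <;>
      linarith [L.bil_comm ℝ x y, L.bil_comm ℝ x y', L.bil_comm ℝ x x', L.bil_comm ℝ x' y,
        L.bil_comm ℝ y y']

lemma heisMat_zero : L.heisMat 0 0 0 = 1 := by
  rw [heisMat_eq]
  have h1 : Matrix.fromCols (L.heisRows 0 0) (L.heisCorner 0 0 0) = 0 := by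
    ext i (j | j)
    · fin_cases i <;> simp [heisRows]
    · fin_cases i <;> fin_cases j <;> simp [heisCorner, bil]
  have h2 : heisCols (0 : Fin s → ℝ) 0 = 0 := by
    ext i j
    fin_cases j <;> simp [heisCols]
  rw [h1, h2, Matrix.fromBlocks_one, Matrix.fromBlocks_one]

lemma heisMat_mul_inv (x y : Fin s → ℝ) (r : ℝ) :
    L.heisMat x y r * L.heisMat (-x) (-y) (L.bil ℝ x y - r) = 1 := by
  rw [heisMat_mul, ← heisMat_zero]
  congr 1
  · simp
  · simp
  · rw [bil_neg_right]; ring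

/-- `SL(2)` normalizes the Heisenberg group and acts on the pair `(x, y)` by right multiplication
with `A`. -/
lemma heisMat_mul_slMat (A : Matrix.SpecialLinearGroup (Fin 2) ℝ) (x y : Fin s → ℝ) (r : ℝ) :
    ∃ r', L.heisMat x y r * slMat s A =
      slMat s A * L.heisMat (A 0 0 • x + A 1 0 • y) (A 0 1 • x + A 1 1 • y) r' := by
  have hdet : A 0 0 * A 1 1 - A 0 1 * A 1 0 = 1 := by
    have := A.2
    rwa [Matrix.det_fin_two] at this
  -- The value comes from the invariance of the symmetrized central coordinate `r - (x, y)/2` under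
  -- this conjugation, together with `det A = 1`.
  refine ⟨r + A 0 0 * A 0 1 * (L.bil ℝ x x / 2) + A 1 0 * A 1 1 * (L.bil ℝ y y / 2) +
    A 0 1 * A 1 0 * L.bil ℝ x y, ?_⟩
  simp only [heisMat_eq, slMat_eq, Matrix.fromBlocks_multiply, Matrix.fromCols_mul_fromBlocks,
    Matrix.mul_zero, Matrix.zero_mul, add_zero, zero_add, Matrix.mul_one, Matrix.one_mul,
    Matrix.mul_fromCols]
  congr 1
  · ext i (j | j)
    · fin_cases i
      · simp [heisRows, Matrix.add_vecMul, Matrix.smul_vecMul]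
        linear_combination (-((y ᵥ* L.gram.map (Int.cast : ℤ → ℝ)) j)) * hdet
      · simp [heisRows, Matrix.add_vecMul, Matrix.smul_vecMul]
        linear_combination (-((x ᵥ* L.gram.map (Int.cast : ℤ → ℝ)) j)) * hdet
    · fin_cases i <;> fin_cases j <;>
        simp [heisCorner, Matrix.vecMul, dotProduct, bil_add_left, bil_add_right,
          bil_smul_left, bil_smul_right, L.bil_comm ℝ y x]
      · linear_combination (-(A 0 0 * L.bil ℝ x y + A 1 0 * (L.bil ℝ y y / 2))) * hdet
      · linear_combination (-(A 0 1 * L.bil ℝ x y + A 1 1 * (L.bil ℝ y y / 2))) * hdet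
      · linear_combination (-(A 0 0 * (L.bil ℝ x x / 2))) * hdet
      · linear_combination (-(A 0 1 * (L.bil ℝ x x / 2))) * hdet
  · congr 1
    ext i j
    fin_cases j <;> simp [heisCols, Matrix.mul_apply, Fin.sum_univ_two] <;> ring

/-- Because the Heisenberg group is normalized by the `{A}`, the products `{A}{x, y; r}` are already
closed under multiplication and inversion. -/
lemma exists_eq_slMat_mul_heisMat {g : (Matrix (Idx s) (Idx s) ℝ)ˣ} (hg : g ∈ L.realJacobiGroup) :
    ∃ A x y r, (g : Matrix (Idx s) (Idx s) ℝ) = slMat s A * L.heisMat x y r := by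
  refine Subgroup.closure_induction (p := fun (g : (Matrix (Idx s) (Idx s) ℝ)ˣ) _ => ∃ A x y r,
    (g : Matrix (Idx s) (Idx s) ℝ) = slMat s A * L.heisMat x y r) ?_ ?_ ?_ ?_ hg
  · rintro g (⟨A, hA⟩ | ⟨x, y, r, hx⟩)
    · exact ⟨A, 0, 0, 0, by rw [hA, heisMat_zero, mul_one]⟩
    · exact ⟨1, x, y, r, by rw [hx, slMat_one, one_mul]⟩
  · exact ⟨1, 0, 0, 0, by rw [heisMat_zero, slMat_one, one_mul, Units.val_one]⟩
  · rintro g g' - - ⟨A, x, y, r, hg⟩ ⟨A', x', y', r', hg'⟩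
    obtain ⟨r'', h⟩ := L.heisMat_mul_slMat A' x y r
    refine ⟨A * A', A' 0 0 • x + A' 1 0 • y + x', A' 0 1 • x + A' 1 1 • y + y',
      r'' + r' + L.bil ℝ (A' 0 0 • x + A' 1 0 • y) y', ?_⟩
    rw [Units.val_mul, hg, hg', mul_assoc, ← mul_assoc (L.heisMat x y r), h, mul_assoc,
      heisMat_mul, ← mul_assoc, ← slMat_mul]
  · rintro g - ⟨A, x, y, r, hg⟩
    obtain ⟨r'', h⟩ := L.heisMat_mul_slMat A⁻¹ (-x) (-y) (L.bil ℝ x y - r)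
    refine ⟨A⁻¹, A⁻¹ 0 0 • (-x) + A⁻¹ 1 0 • (-y), A⁻¹ 0 1 • (-x) + A⁻¹ 1 1 • (-y), r'', ?_⟩
    refine Units.inv_eq_of_mul_eq_one_right ?_
    rw [hg, ← h, mul_assoc, ← mul_assoc (L.heisMat x y r), heisMat_mul_inv, one_mul, ← slMat_mul,
      mul_inv_cancel, slMat_one]

end EvenLattice

end

noncomputable section

namespace EvenLattice

variable {s : ℕ} (L : EvenLattice s)

/-! ### The action of the Jacobi group -/

lemma slMat_mul_heisMat (A : Matrix.SpecialLinearGroup (Fin 2) ℝ) (x y : Fin s → ℝ) (r : ℝ) :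
    slMat s A * L.heisMat x y r = Matrix.fromBlocks !![A 0 0, -A 0 1; -A 1 0, A 1 1]
      (Matrix.fromCols (!![A 0 0, -A 0 1; -A 1 0, A 1 1] * L.heisRows x y)
        (!![A 0 0, -A 0 1; -A 1 0, A 1 1] * L.heisCorner x y r)) 0
      (Matrix.fromBlocks 1 (heisCols x y) 0 A.1) := by
  simp only [heisMat_eq, slMat_eq, Matrix.fromBlocks_multiply,
    Matrix.mul_zero, Matrix.zero_mul, add_zero, zero_add, Matrix.mul_one, Matrix.one_mul,
    Matrix.mul_fromCols]

/-- The matrix of `{A}{x, y; r}` displays `A`, `x` and `y` as blocks, so they are integral; `r` is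
recovered from the upper right corner by means of `A`. -/
lemma exists_int_of_mem_jacobiGroup {g : (Matrix (Idx s) (Idx s) ℝ)ˣ} (hg : g ∈ L.jacobiGroup) :
    ∃ (A : Matrix.SpecialLinearGroup (Fin 2) ℤ) (x y : Fin s → ℤ) (r : ℤ),
      (g : Matrix (Idx s) (Idx s) ℝ) =
        slMat s (Matrix.SpecialLinearGroup.map (Int.castRingHom ℝ) A) *
          L.heisMat (fun i => (x i : ℝ)) (fun i => (y i : ℝ)) r := by
  obtain ⟨hg1, hg2⟩ := hg
  obtain ⟨A, x, y, r, h⟩ := L.exists_eq_slMat_mul_heisMat hg1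
  have hdet : A 0 0 * A 1 1 - A 0 1 * A 1 0 = 1 := by
    have := A.2
    rwa [Matrix.det_fin_two] at this
  have hint : ∀ i j, ∃ n : ℤ, (slMat s A * L.heisMat x y r) i j = n := fun i j => by
    rw [← h]; exact (hg2 i j).1
  rw [slMat_mul_heisMat] at hint
  have hA : ∀ i j, ∃ n : ℤ, A i j = n := fun i j => hint (Sum.inr (Sum.inr i)) (Sum.inr (Sum.inr j))
  have hxy : ∀ i j, ∃ n : ℤ, heisCols x y i j = n :=
    fun i j => hint (Sum.inr (Sum.inl i)) (Sum.inr (Sum.inr j))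
  choose B hB using hA
  choose xy hxy using hxy
  have hr : ∃ n : ℤ, r = n := by
    obtain ⟨n₀, h₀⟩ := hint (Sum.inl 0) (Sum.inr (Sum.inr 1))
    obtain ⟨n₁, h₁⟩ := hint (Sum.inl 1) (Sum.inr (Sum.inr 1))
    simp only [Matrix.fromBlocks_apply₁₂, Matrix.fromCols_apply_inr] at h₀ h₁
    simp [Matrix.mul_apply, heisCorner, Fin.sum_univ_two] at h₀ h₁
    -- The two corner entries are `a S[y]/2 - b r` and `-c S[y]/2 + d r`; this combination
    -- eliminates `S[y]/2` and leaves `(ad - bc) r = r`.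
    refine ⟨B 1 0 * n₀ + B 0 0 * n₁, ?_⟩
    push_cast
    rw [← h₀, ← h₁, ← hB, ← hB]
    linear_combination (-r) * hdet
  obtain ⟨n, rfl⟩ := hr
  refine ⟨⟨Matrix.of B, ?_⟩, fun i => xy i 0, fun i => xy i 1, n, ?_⟩
  · rw [Matrix.det_fin_two]
    simp only [Matrix.of_apply]
    have := hdet
    rw [hB, hB, hB, hB] at this
    exact_mod_cast this
  · rw [h]
    congr 2
    · ext i j
      exact hB i j
    · funext i
      rw [← hxy i 0]
      simp [heisCols]
    · funext i
      rw [← hxy i 1]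
      simp [heisCols]

lemma sum_vecMul_gram (y : Fin s → ℝ) (z : Fin s → ℂ) :
    ∑ j, ((y ᵥ* L.gram.map (Int.cast : ℤ → ℝ)) j : ℂ) * z j = L.bil ℂ (fun i => (y i : ℂ)) z := by
  rw [bil, Matrix.dotProduct_mulVec]
  refine Finset.sum_congr rfl fun j _ => ?_
  simp [Matrix.vecMul, dotProduct]

lemma heisMat_mulVec_borelEmb (x y : Fin s → ℝ) (r : ℝ) (ω : ℂ) (z : Fin s → ℂ) (τ : ℂ) :
    (L.heisMat x y r).map Complex.ofReal *ᵥ L.borelEmb (ω, z, τ) =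
      L.borelEmb (ω + L.bil ℂ (fun i => (x i : ℂ)) z +
        L.bil ℂ (fun i => (x i : ℂ)) (fun i => (x i : ℂ)) * τ / 2 + r,
        z + τ • (fun i => (x i : ℂ)) + fun i => (y i : ℂ), τ) := by
  have hc : L.bil ℂ z (fun i => (x i : ℂ)) = L.bil ℂ (fun i => (x i : ℂ)) z := L.bil_comm ℂ _ _
  have hc' : L.bil ℂ z (fun i => (y i : ℂ)) = L.bil ℂ (fun i => (y i : ℂ)) z := L.bil_comm ℂ _ _
  have hc'' : L.bil ℂ (fun i => (y i : ℂ)) (fun i => (x i : ℂ)) =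
    L.bil ℂ (fun i => (x i : ℂ)) (fun i => (y i : ℂ)) := L.bil_comm ℂ _ _
  have h1 := L.sum_vecMul_gram x z
  have h2 := L.sum_vecMul_gram y z
  funext i
  rcases i with i | i | i
  · fin_cases i
    · simp [Matrix.mulVec, dotProduct, heisMat_eq, borelEmb, Fintype.sum_sum_type, heisRows,
        heisCorner, normOne, bil_add_left, bil_add_right, bil_smul_left, bil_smul_right, h2,
        Matrix.one_apply, hc, hc', hc'', ← bil_ofReal]
      ring
    · simp [Matrix.mulVec, dotProduct, heisMat_eq, borelEmb, Fintype.sum_sum_type, heisRows,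
        heisCorner, normOne, h1, Matrix.one_apply, ← bil_ofReal]
      ring
  · simp [Matrix.mulVec, dotProduct, heisMat_eq, borelEmb, Fintype.sum_sum_type, heisCols,
      Matrix.one_apply, apply_ite Complex.ofReal]
    ring
  · fin_cases i <;>
      simp [Matrix.mulVec, dotProduct, heisMat_eq, borelEmb, Fintype.sum_sum_type,
        Matrix.one_apply]

lemma slMat_mulVec_borelEmb (A : Matrix.SpecialLinearGroup (Fin 2) ℝ) (ω : ℂ) (z : Fin s → ℂ)
    (τ : ℂ) : (slMat s A).map Complex.ofReal *ᵥ L.borelEmb (ω, z, τ) =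
      Sum.elim ![A 0 0 * (L.normOne ℂ ω z τ / 2) - A 0 1 * ω,
        -(A 1 0 * (L.normOne ℂ ω z τ / 2)) + A 1 1 * ω]
        (Sum.elim z ![A 0 0 * τ + A 0 1, A 1 0 * τ + A 1 1]) := by
  funext i
  rcases i with i | i | i
  · fin_cases i <;>
      simp [Matrix.mulVec, dotProduct, slMat_eq, borelEmb, Fintype.sum_sum_type]
    <;> ring
  · simp [Matrix.mulVec, dotProduct, slMat_eq, borelEmb, Fintype.sum_sum_type, Matrix.one_apply,
      apply_ite Complex.ofReal]
  · fin_cases i <;>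
      simp [Matrix.mulVec, dotProduct, slMat_eq, borelEmb, Fintype.sum_sum_type]

lemma actVec_slMat_mul_heisMat (A : Matrix.SpecialLinearGroup (Fin 2) ℝ) (x y : Fin s → ℝ) (r : ℝ)
    (ω : ℂ) (z : Fin s → ℂ) (τ : ℂ) : L.actVec (slMat s A * L.heisMat x y r) (ω, z, τ) =
      (slMat s A).map Complex.ofReal *ᵥ L.borelEmb (ω + L.bil ℂ (fun i => (x i : ℂ)) z +
        L.bil ℂ (fun i => (x i : ℂ)) (fun i => (x i : ℂ)) * τ / 2 + r,
        z + τ • (fun i => (x i : ℂ)) + fun i => (y i : ℂ), τ) := by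
  have h : (slMat s A * L.heisMat x y r).map Complex.ofReal =
      (slMat s A).map Complex.ofReal * (L.heisMat x y r).map Complex.ofReal :=
    Matrix.map_mul (f := Complex.ofRealHom)
  rw [actVec, h, ← Matrix.mulVec_mulVec, heisMat_mulVec_borelEmb]

/-- The slash action in coordinates. -/
lemma slash_slMat_mul_heisMat (k : ℤ) (m : ℕ) (φ : UpperHalfPlane × (Fin s → ℂ) → ℂ)
    (A : Matrix.SpecialLinearGroup (Fin 2) ℝ) (x y : Fin s → ℝ) (r : ℝ) (ω : ℂ) (z z' : Fin s → ℂ)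
    (τ : ℂ) (hz' : z' = z + τ • (fun i => (x i : ℂ)) + fun i => (y i : ℂ))
    (hj : (A 1 0 * τ + A 1 1 : ℂ) ≠ 0) :
    L.slash k m φ (slMat s A * L.heisMat x y r) (ω, z, τ) =
      ((A 1 0 * τ + A 1 1 : ℂ) ^ k *
        Complex.exp (Real.pi * Complex.I * m * (A 1 0 * L.bil ℂ z' z' / (A 1 0 * τ + A 1 1)) -
          Real.pi * Complex.I * m * (2 * L.bil ℂ (fun i => (x i : ℂ)) z +
            L.bil ℂ (fun i => (x i : ℂ)) (fun i => (x i : ℂ)) * τ + 2 * r)))⁻¹ *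
      φ (UpperHalfPlane.ofComplex ((A 0 0 * τ + A 0 1) / (A 1 0 * τ + A 1 1)),
        (A 1 0 * τ + A 1 1 : ℂ)⁻¹ • z') := by
  have hact := L.actVec_slMat_mul_heisMat A x y r ω z τ
  rw [slMat_mulVec_borelEmb, ← hz'] at hact
  rw [slash, autJkm, act, autJ, hact]
  simp only [Sum.elim_inr, Sum.elim_inl, Matrix.cons_val_one, Matrix.cons_val_zero]
  congr 1
  · rw [mul_assoc, ← Complex.exp_add]
    congr 3
    -- After the Heisenberg step has moved `(ω, z)` to `(ω', z')`, one has `ω(g; Z) = ω' - c S[z'] /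
    -- (2(cτ + d))`. The difference with `ω` no longer involves `ω`.
    rw [normOne]
    field_simp
    ring
  · congr 2
    funext i
    simp [div_eq_inv_mul]

end EvenLattice

end

noncomputable section

namespace EvenLattice

variable {s : ℕ} (L : EvenLattice s)

/-! ### Invariance under the Jacobi group as functional equations -/

/-- Invariance under the integral Heisenberg group. -/
def HeisEq (m : ℕ) (φ : UpperHalfPlane × (Fin s → ℂ) → ℂ) : Prop :=
  ∀ (x y : Fin s → ℤ) (τ : UpperHalfPlane) (z : Fin s → ℂ),
    φ (τ, z + (τ : ℂ) • (fun i => (x i : ℂ)) + fun i => (y i : ℂ)) *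
      Complex.exp (Real.pi * Complex.I * m * (2 * L.bil ℂ (fun i => (x i : ℂ)) z +
        L.bil ℂ (fun i => (x i : ℂ)) (fun i => (x i : ℂ)) * τ)) = φ (τ, z)

/-- Invariance under `A ∈ SL(2, ℤ)`. -/
def ModEq (k : ℤ) (m : ℕ) (φ : UpperHalfPlane × (Fin s → ℂ) → ℂ)
    (A : Matrix.SpecialLinearGroup (Fin 2) ℤ) : Prop :=
  ∀ (τ : UpperHalfPlane) (z : Fin s → ℂ),
    φ (A • τ, ((A 1 0 : ℂ) * τ + A 1 1)⁻¹ • z) = ((A 1 0 : ℂ) * τ + A 1 1) ^ k *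
      Complex.exp (Real.pi * Complex.I * m * (A 1 0 * L.bil ℂ z z / (A 1 0 * τ + A 1 1))) *
        φ (τ, z)

lemma coe_smul_int (A : Matrix.SpecialLinearGroup (Fin 2) ℤ) (τ : UpperHalfPlane) :
    ((A • τ : UpperHalfPlane) : ℂ) = (A 0 0 * τ + A 0 1) / (A 1 0 * τ + A 1 1) := by
  rw [UpperHalfPlane.coe_specialLinearGroup_apply]
  simp

lemma denom_int_ne_zero (A : Matrix.SpecialLinearGroup (Fin 2) ℤ) (τ : UpperHalfPlane) :
    ((A 1 0 : ℂ) * τ + A 1 1) ≠ 0 := by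
  have h := UpperHalfPlane.denom_ne_zero (A : GL (Fin 2) ℝ) τ
  rwa [ModularGroup.denom_apply] at h

/-- Evenness of the lattice is what makes the corner entries `S[x]/2` and `S[y]/2` integral. -/
lemma heisMat_int (x y : Fin s → ℤ) (r : ℤ) (i j : Idx s) :
    ∃ n : ℤ, L.heisMat (fun i => (x i : ℝ)) (fun i => (y i : ℝ)) r i j = n := by
  have hv : ∀ (x : Fin s → ℤ) (j : Fin s), ∃ n : ℤ,
      ((fun i => (x i : ℝ)) ᵥ* L.gram.map (Int.cast : ℤ → ℝ)) j = n := fun x j =>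
    ⟨(x ᵥ* L.gram) j, by simp [Matrix.vecMul, dotProduct]⟩
  have hone : ∀ {ι : Type} [DecidableEq ι] (i j : ι), ∃ n : ℤ, (1 : Matrix ι ι ℝ) i j = n := by
    intro ι _ i j
    by_cases h : i = j
    · exact ⟨1, by subst h; simp⟩
    · exact ⟨0, by simp [h]⟩
  have he : ∀ x : Fin s → ℤ, ∃ n : ℤ,
      L.bil ℝ (fun i => (x i : ℝ)) (fun i => (x i : ℝ)) / 2 = n := by
    intro x
    obtain ⟨n, hn⟩ := L.even_bil_self x
    exact ⟨n, by rw [bil_intCast, hn]; push_cast; ring⟩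
  rw [heisMat_eq]
  rcases i with i | i | i <;> rcases j with j | j | j
  · exact hone i j
  · simp only [Matrix.fromBlocks_apply₁₂, Matrix.fromCols_apply_inl, heisRows]
    fin_cases i
    · exact hv y j
    · exact hv x j
  · simp only [Matrix.fromBlocks_apply₁₂, Matrix.fromCols_apply_inr, heisCorner]
    fin_cases i <;> fin_cases j
    · refine ⟨L.bil ℤ x y - r, ?_⟩
      simp [bil_intCast]
    · exact he y
    · exact he x
    · exact ⟨r, by simp⟩
  · exact ⟨0, by simp⟩
  · exact hone i j
  · simp only [Matrix.fromBlocks_apply₂₂, Matrix.fromBlocks_apply₁₂, heisCols]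
    fin_cases j
    · exact ⟨x i, rfl⟩
    · exact ⟨y i, rfl⟩
  · exact ⟨0, by simp⟩
  · exact ⟨0, by simp⟩
  · exact hone i j

lemma slMat_int (A : Matrix.SpecialLinearGroup (Fin 2) ℤ) (i j : Idx s) :
    ∃ n : ℤ, slMat s (Matrix.SpecialLinearGroup.map (Int.castRingHom ℝ) A) i j = n := by
  rw [slMat_eq]
  rcases i with i | i | i <;> rcases j with j | j | j
  · simp only [Matrix.fromBlocks_apply₁₁]
    fin_cases i <;> fin_cases j
    · exact ⟨A 0 0, rfl⟩
    · exact ⟨-A 0 1, by simp⟩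
    · exact ⟨-A 1 0, by simp⟩
    · exact ⟨A 1 1, rfl⟩
  · exact ⟨0, by simp⟩
  · exact ⟨0, by simp⟩
  · exact ⟨0, by simp⟩
  · by_cases h : i = j
    · exact ⟨1, by simp [h]⟩
    · exact ⟨0, by simp [h]⟩
  · exact ⟨0, by simp⟩
  · exact ⟨0, by simp⟩
  · exact ⟨0, by simp⟩
  · exact ⟨A i j, rfl⟩

/-- Slash invariance is stated over points of the tube domain; taking `Im ω` large lifts every `(τ,
z)` to such a point. -/
lemma exists_mem_tubeDomain (τ : UpperHalfPlane) (z : Fin s → ℂ) :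
    ∃ ω : ℂ, (ω, z, (τ : ℂ)) ∈ L.tubeDomain := by
  set q := L.bil ℝ (fun i => (z i).im) (fun i => (z i).im) with hq
  have hτ : 0 < (τ : ℂ).im := τ.im_pos
  refine ⟨((|q| / (τ : ℂ).im + 1 : ℝ) : ℂ) * Complex.I, ?_, hτ, ?_⟩
  · simp only [Complex.im_ofReal_mul, Complex.I_im, mul_one]
    positivity
  · simp only [normOne, Complex.im_ofReal_mul, Complex.I_im, mul_one]
    rw [← hq]
    have : 2 * (|q| / (τ : ℂ).im + 1) * (τ : ℂ).im = 2 * |q| + 2 * (τ : ℂ).im := by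
      field_simp
    rw [this]
    linarith [le_abs_self q, abs_nonneg q]

/-- Every element of the integral Jacobi group is `{A}{x, y; r}` with integral entries, and the
central part acts by `e^{2πi m r} = 1`. -/
lemma slash_eq_of_heisEq_modEq {k : ℤ} {m : ℕ} {φ : UpperHalfPlane × (Fin s → ℂ) → ℂ}
    (hH : L.HeisEq m φ) (hM : ∀ A, L.ModEq k m φ A) :
    ∀ g ∈ L.jacobiGroup, ∀ (ω : ℂ) (z : Fin s → ℂ) (τ : UpperHalfPlane),
      (ω, z, (τ : ℂ)) ∈ L.tubeDomain → L.slash k m φ g (ω, z, τ) = φ (τ, z) := by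
  intro g hg ω z τ _
  obtain ⟨A, x, y, r, h⟩ := L.exists_int_of_mem_jacobiGroup hg
  have hj := denom_int_ne_zero A τ
  have hcast : ∀ i j, ((Matrix.SpecialLinearGroup.map (Int.castRingHom ℝ) A i j : ℝ) : ℂ) =
      (A i j : ℂ) := fun i j => by simp
  set z' : Fin s → ℂ := z + (τ : ℂ) • (fun i => (x i : ℂ)) + fun i => (y i : ℂ) with hz'
  rw [h, L.slash_slMat_mul_heisMat k m φ _ _ _ _ ω z z' τ (by simp [hz'])
    (by simpa [hcast] using hj)]
  simp only [hcast, Complex.ofReal_intCast]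
  rw [← coe_smul_int, UpperHalfPlane.ofComplex_apply, hM A τ z', ← hH x y τ z, ← hz']
  have h1 : Complex.exp (Real.pi * Complex.I * m * (2 * L.bil ℂ (fun i => (x i : ℂ)) z +
      L.bil ℂ (fun i => (x i : ℂ)) (fun i => (x i : ℂ)) * τ + 2 * r)) =
      Complex.exp (Real.pi * Complex.I * m * (2 * L.bil ℂ (fun i => (x i : ℂ)) z +
      L.bil ℂ (fun i => (x i : ℂ)) (fun i => (x i : ℂ)) * τ)) := by
    refine Complex.exp_eq_exp_iff_exists_int.mpr ⟨m * r, ?_⟩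
    push_cast
    ring
  rw [Complex.exp_sub, h1]
  have h2 := zpow_ne_zero k hj
  field_simp

lemma heisEq_of_slash_eq {k : ℤ} {m : ℕ} {φ : UpperHalfPlane × (Fin s → ℂ) → ℂ}
    (h : ∀ g ∈ L.jacobiGroup, ∀ (ω : ℂ) (z : Fin s → ℂ) (τ : UpperHalfPlane),
      (ω, z, (τ : ℂ)) ∈ L.tubeDomain → L.slash k m φ g (ω, z, τ) = φ (τ, z)) :
    L.HeisEq m φ := by
  intro x y τ z
  obtain ⟨ω, hω⟩ := L.exists_mem_tubeDomain τ z
  let g : (Matrix (Idx s) (Idx s) ℝ)ˣ :=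
    { val := L.heisMat (fun i => (x i : ℝ)) (fun i => (y i : ℝ)) (0 : ℤ)
      inv := L.heisMat (fun i => ((-x) i : ℝ)) (fun i => ((-y) i : ℝ)) (L.bil ℤ x y : ℤ)
      val_inv := by
        have := L.heisMat_mul_inv (fun i => (x i : ℝ)) (fun i => (y i : ℝ)) 0
        rw [sub_zero, bil_intCast] at this
        rw [← this]
        congr 2
        · simp
        · funext i; simp
        · funext i; simp
      inv_val := by
        have := L.heisMat_mul_inv (fun i => ((-x) i : ℝ)) (fun i => ((-y) i : ℝ)) (L.bil ℤ x y : ℤ)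
        rw [← this]
        congr 2
        · funext i; simp
        · funext i; simp
        · have h3 := L.bil_intCast ℝ (-x) (-y)
          rw [h3, bil_neg_left, bil_neg_right, neg_neg]
          simp }
  have hg : g ∈ L.jacobiGroup :=
    ⟨Subgroup.subset_closure (Or.inr ⟨_, _, _, rfl⟩), fun i j =>
      ⟨L.heisMat_int x y 0 i j, L.heisMat_int (-x) (-y) _ i j⟩⟩
  have h1 := h g hg ω z τ hω
  have h2 : (g : Matrix (Idx s) (Idx s) ℝ) = slMat s 1 *
      L.heisMat (fun i => (x i : ℝ)) (fun i => (y i : ℝ)) (0 : ℤ) := by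
    rw [slMat_one, one_mul]
  rw [h2, L.slash_slMat_mul_heisMat k m φ _ _ _ _ ω z
    (z + (τ : ℂ) • (fun i => (x i : ℂ)) + fun i => (y i : ℂ)) τ (by simp) (by simp)] at h1
  rw [← h1]
  simp only [Matrix.SpecialLinearGroup.coe_one, Matrix.one_apply_eq, Complex.ofReal_intCast,
    Int.cast_zero, Complex.ofReal_one, Complex.ofReal_zero, mul_zero, add_zero, zero_mul, zero_add,
    div_one, one_zpow, ne_eq, one_ne_zero, zero_ne_one, not_false_eq_true, Matrix.one_apply_ne,
    one_mul, UpperHalfPlane.ofComplex_apply, inv_one, one_smul, zero_sub]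
  rw [Complex.exp_neg, inv_inv, mul_comm]

lemma modEq_of_slash_eq {k : ℤ} {m : ℕ} {φ : UpperHalfPlane × (Fin s → ℂ) → ℂ}
    (h : ∀ g ∈ L.jacobiGroup, ∀ (ω : ℂ) (z : Fin s → ℂ) (τ : UpperHalfPlane),
      (ω, z, (τ : ℂ)) ∈ L.tubeDomain → L.slash k m φ g (ω, z, τ) = φ (τ, z))
    (A : Matrix.SpecialLinearGroup (Fin 2) ℤ) : L.ModEq k m φ A := by
  intro τ z
  obtain ⟨ω, hω⟩ := L.exists_mem_tubeDomain τ z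
  set f := Matrix.SpecialLinearGroup.map (n := Fin 2) (Int.castRingHom ℝ) with hf
  let g : (Matrix (Idx s) (Idx s) ℝ)ˣ :=
    { val := slMat s (f A)
      inv := slMat s (f A⁻¹)
      val_inv := by rw [← slMat_mul, ← map_mul, mul_inv_cancel, map_one, slMat_one]
      inv_val := by rw [← slMat_mul, ← map_mul, inv_mul_cancel, map_one, slMat_one] }
  have hg : g ∈ L.jacobiGroup :=
    ⟨Subgroup.subset_closure (Or.inl ⟨_, rfl⟩), fun i j => ⟨slMat_int A i j, slMat_int A⁻¹ i j⟩⟩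
  have h1 := h g hg ω z τ hω
  have h2 : (g : Matrix (Idx s) (Idx s) ℝ) = slMat s (f A) * L.heisMat 0 0 0 := by
    rw [heisMat_zero, mul_one]
  have hj := denom_int_ne_zero A τ
  have hcast : ∀ i j, ((f A i j : ℝ) : ℂ) = (A i j : ℂ) := fun i j => by simp [hf]
  rw [h2, L.slash_slMat_mul_heisMat k m φ _ _ _ _ ω z z τ (by
    funext i; simp) (by simpa [hcast] using hj)] at h1
  simp only [hcast, Pi.zero_apply, Complex.ofReal_zero] at h1
  rw [← coe_smul_int, UpperHalfPlane.ofComplex_apply] at h1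
  have h3 : L.bil ℂ (fun _ => 0) z = 0 := L.bil_zero_left ℂ z
  have h4 : L.bil ℂ (fun _ => 0) (fun _ => 0) = 0 := L.bil_zero_left ℂ _
  rw [h3, h4] at h1
  simp only [mul_zero, zero_mul, add_zero, sub_zero] at h1
  rw [← h1]
  have h5 := zpow_ne_zero k hj
  field_simp

lemma modEq_mul {k : ℤ} {m : ℕ} {φ : UpperHalfPlane × (Fin s → ℂ) → ℂ}
    {A B : Matrix.SpecialLinearGroup (Fin 2) ℤ} (hA : L.ModEq k m φ A) (hB : L.ModEq k m φ B) :
    L.ModEq k m φ (A * B) := by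
  intro τ z
  have hjA := denom_int_ne_zero A (B • τ)
  have hjB := denom_int_ne_zero B τ
  have hdet : (B 0 0 : ℂ) * B 1 1 - B 0 1 * B 1 0 = 1 := by
    have := B.2
    rw [Matrix.det_fin_two] at this
    exact_mod_cast this
  have h10 : ((A * B) 1 0 : ℤ) = A 1 0 * B 0 0 + A 1 1 * B 1 0 := by
    simp [Matrix.SpecialLinearGroup.coe_mul, Matrix.mul_apply, Fin.sum_univ_two]
  have h11 : ((A * B) 1 1 : ℤ) = A 1 0 * B 0 1 + A 1 1 * B 1 1 := by
    simp [Matrix.SpecialLinearGroup.coe_mul, Matrix.mul_apply, Fin.sum_univ_two]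
  have hj : (((A * B) 1 0 : ℤ) : ℂ) * τ + ((A * B) 1 1 : ℤ) =
      (A 1 0 * (B • τ : UpperHalfPlane) + A 1 1) * (B 1 0 * τ + B 1 1) := by
    rw [coe_smul_int, h10, h11]
    push_cast
    field_simp
    ring
  have hA' := hA (B • τ) (((B 1 0 : ℂ) * τ + B 1 1)⁻¹ • z)
  rw [hj, mul_inv, mul_smul, mul_smul, hA', hB τ z, bil_smul_left, bil_smul_right]
  have hexp : Complex.exp (Real.pi * Complex.I * m * (((A * B) 1 0 : ℤ) * L.bil ℂ z z /
      ((A 1 0 * (B • τ : UpperHalfPlane) + A 1 1) * (B 1 0 * τ + B 1 1)))) =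
      Complex.exp (Real.pi * Complex.I * m * (A 1 0 * (((B 1 0 : ℂ) * τ + B 1 1)⁻¹ *
        (((B 1 0 : ℂ) * τ + B 1 1)⁻¹ * L.bil ℂ z z)) /
          (A 1 0 * (B • τ : UpperHalfPlane) + A 1 1))) *
      Complex.exp (Real.pi * Complex.I * m * (B 1 0 * L.bil ℂ z z / (B 1 0 * τ + B 1 1))) := by
    rw [← Complex.exp_add, ← mul_add]
    congr 2
    -- With `j` denoting `cτ + d`, this is `c_{AB} j_B = c_A + c_B j_{AB}`, which needs `det B = 1`.
    -- Divided by `j_B j_{AB}`, it is the cocycle property of `c S[z]/(cτ + d)`.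
    have key : (((A * B) 1 0 : ℤ) : ℂ) * (B 1 0 * τ + B 1 1) = A 1 0 +
        B 1 0 * ((A 1 0 * (B • τ : UpperHalfPlane) + A 1 1) * (B 1 0 * τ + B 1 1)) := by
      rw [← hj, h10, h11]
      push_cast
      linear_combination (A 1 0 : ℂ) * hdet
    generalize (A 1 0 * ((B • τ : UpperHalfPlane) : ℂ) + A 1 1 : ℂ) = u at *
    generalize ((B 1 0 : ℂ) * τ + B 1 1) = v at *
    field_simp
    linear_combination (L.bil ℂ z z) * key
  rw [hexp, mul_zpow]
  ring

lemma modEq_inv {k : ℤ} {m : ℕ} {φ : UpperHalfPlane × (Fin s → ℂ) → ℂ}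
    {A : Matrix.SpecialLinearGroup (Fin 2) ℤ} (hA : L.ModEq k m φ A) : L.ModEq k m φ A⁻¹ := by
  intro τ z
  have hjA := denom_int_ne_zero A (A⁻¹ • τ)
  have hj := denom_int_ne_zero A⁻¹ τ
  have hdet : (A 0 0 : ℂ) * A 1 1 - A 0 1 * A 1 0 = 1 := by
    have := A.2
    rw [Matrix.det_fin_two] at this
    exact_mod_cast this
  have e00 : (A⁻¹ 0 0 : ℤ) = A 1 1 := by
    simp [Matrix.SpecialLinearGroup.coe_inv, Matrix.adjugate_fin_two]
  have e01 : (A⁻¹ 0 1 : ℤ) = -A 0 1 := by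
    simp [Matrix.SpecialLinearGroup.coe_inv, Matrix.adjugate_fin_two]
  have e10 : (A⁻¹ 1 0 : ℤ) = -A 1 0 := by
    simp [Matrix.SpecialLinearGroup.coe_inv, Matrix.adjugate_fin_two]
  have e11 : (A⁻¹ 1 1 : ℤ) = A 0 0 := by
    simp [Matrix.SpecialLinearGroup.coe_inv, Matrix.adjugate_fin_two]
  set u : ℂ := (A⁻¹ 1 0 : ℤ) * τ + (A⁻¹ 1 1 : ℤ) with hu
  have hinv : (A 1 0 : ℂ) * (A⁻¹ • τ : UpperHalfPlane) + A 1 1 = u⁻¹ := by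
    rw [coe_smul_int, ← hu]
    field_simp
    rw [hu, e00, e01, e10, e11]
    push_cast
    linear_combination hdet
  have h := hA (A⁻¹ • τ) (u⁻¹ • z)
  rw [smul_inv_smul, hinv, inv_inv, smul_smul, mul_inv_cancel₀ hj, one_smul, bil_smul_left,
    bil_smul_right] at h
  rw [h]
  have h1 : Complex.exp (Real.pi * Complex.I * m * ((A⁻¹ 1 0 : ℤ) * L.bil ℂ z z / u)) *
      Complex.exp (Real.pi * Complex.I * m * (A 1 0 * (u⁻¹ * (u⁻¹ * L.bil ℂ z z)) / u⁻¹)) = 1 := by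
    rw [← Complex.exp_add, Complex.exp_eq_one_iff]
    refine ⟨0, ?_⟩
    rw [e10]
    push_cast
    field_simp
    ring
  have h2 : u ^ k * u⁻¹ ^ k = 1 := by rw [← mul_zpow, mul_inv_cancel₀ hj, one_zpow]
  linear_combination (-(φ (A⁻¹ • τ, u⁻¹ • z)) * u ^ k * u⁻¹ ^ k) * h1 - φ (A⁻¹ • τ, u⁻¹ • z) * h2

/-- `SL(2, ℤ)` is generated by `S` and `T`. -/
lemma modEq_of_generators {k : ℤ} {m : ℕ} {φ : UpperHalfPlane × (Fin s → ℂ) → ℂ}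
    (hS : L.ModEq k m φ ModularGroup.S) (hT : L.ModEq k m φ ModularGroup.T)
    (A : Matrix.SpecialLinearGroup (Fin 2) ℤ) : L.ModEq k m φ A := by
  have hA : A ∈ Subgroup.closure {ModularGroup.S, ModularGroup.T} := by
    rw [_root_.SpecialLinearGroup.SL2Z_generators]; trivial
  refine Subgroup.closure_induction (p := fun A _ => L.ModEq k m φ A) ?_ ?_ ?_ ?_ hA
  · rintro B (rfl | rfl)
    · exact hS
    · exact hT
  · intro τ z
    simp
  · intro A B _ _ hA hB
    exact L.modEq_mul hA hB
  · intro A _ hA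
    exact L.modEq_inv hA

lemma modEq_S_iff {k : ℤ} {m : ℕ} {φ : UpperHalfPlane × (Fin s → ℂ) → ℂ} :
    L.ModEq k m φ ModularGroup.S ↔ ∀ (τ τ' : UpperHalfPlane), (τ' : ℂ) = -1 / τ → ∀ z,
      φ (τ', (τ : ℂ)⁻¹ • z) = (τ : ℂ) ^ k *
        Complex.exp (Real.pi * Complex.I * m * (L.bil ℂ z z / τ)) * φ (τ, z) := by
  have h10 : ModularGroup.S 1 0 = 1 := rfl
  have h11 : ModularGroup.S 1 1 = 0 := rfl
  have hc : ∀ τ : UpperHalfPlane, ((ModularGroup.S • τ : UpperHalfPlane) : ℂ) = -1 / τ := by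
    intro τ
    rw [coe_smul_int]
    simp [ModularGroup.S]
  constructor
  · intro h τ τ' hτ z
    have := h τ z
    rw [show τ' = ModularGroup.S • τ from UpperHalfPlane.ext (hτ.trans (hc τ).symm)]
    simpa [h10, h11] using this
  · intro h τ z
    have := h τ _ (hc τ) z
    simpa [h10, h11] using this

lemma modEq_T_iff {k : ℤ} {m : ℕ} {φ : UpperHalfPlane × (Fin s → ℂ) → ℂ} :
    L.ModEq k m φ ModularGroup.T ↔ ∀ (τ τ' : UpperHalfPlane), (τ' : ℂ) = τ + 1 → ∀ z,
      φ (τ', z) = φ (τ, z) := by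
  have h10 : ModularGroup.T 1 0 = 0 := rfl
  have h11 : ModularGroup.T 1 1 = 1 := rfl
  have hc : ∀ τ : UpperHalfPlane, ((ModularGroup.T • τ : UpperHalfPlane) : ℂ) = τ + 1 := by
    intro τ
    rw [coe_smul_int]
    simp [ModularGroup.T]
  constructor
  · intro h τ τ' hτ z
    have := h τ z
    rw [show τ' = ModularGroup.T • τ from UpperHalfPlane.ext (hτ.trans (hc τ).symm)]
    simpa [h10, h11] using this
  · intro h τ z
    have := h τ _ (hc τ) z
    simpa [h10, h11] using this

end EvenLattice

end

/-! ### Vector-valued forms and the theta decomposition -/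

noncomputable section

open Filter Topology

/-- A Fourier series with nonnegative exponents is holomorphic on the upper half plane. -/
lemma differentiableOn_of_hasSum_exp {c : ℚ → ℂ} {f : UpperHalfPlane → ℂ}
    (hc : ∀ q, c q ≠ 0 → 0 ≤ q)
    (hf : ∀ τ : UpperHalfPlane,
      HasSum (fun q : ℚ => c q * Complex.exp (2 * Real.pi * Complex.I * (q * τ))) (f τ)) :
    DifferentiableOn ℂ (fun τ : ℂ => f (UpperHalfPlane.ofComplex τ)) {τ | 0 < τ.im} := by
  intro τ₀ hτ₀
  have hτ₀' : 0 < τ₀.im := hτ₀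
  -- As the exponents are nonnegative, the norms of the terms at half the height of `τ₀` dominate
  -- the terms at every higher point, in particular in a neighbourhood of `τ₀`.
  set τ₁ : UpperHalfPlane := ⟨(τ₀.im / 2 : ℝ) * Complex.I, by simp; linarith⟩ with hτ₁
  have him : (τ₁ : ℂ).im = τ₀.im / 2 := by
    change ((τ₀.im / 2 : ℝ) * Complex.I).im = _
    simp
  have hu := (hf τ₁).summable.norm
  have hU : IsOpen {τ : ℂ | τ₀.im / 2 < τ.im} := isOpen_lt continuous_const Complex.continuous_im
  have hd : DifferentiableOn ℂ
      (fun τ : ℂ => ∑' q : ℚ, c q * Complex.exp (2 * Real.pi * Complex.I * (q * τ)))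
      {τ : ℂ | τ₀.im / 2 < τ.im} := by
    refine Complex.differentiableOn_tsum_of_summable_norm hu (fun q => by fun_prop) hU
      fun q w hw => ?_
    by_cases hq : c q = 0
    · simp [hq]
    · have hq0 : (0 : ℝ) ≤ q := by exact_mod_cast hc q hq
      rw [norm_mul, norm_mul]
      refine mul_le_mul_of_nonneg_left ?_ (norm_nonneg _)
      rw [Complex.norm_exp, Complex.norm_exp]
      have hre : ∀ w : ℂ, (2 * Real.pi * Complex.I * (q * w)).re = -(2 * Real.pi * (q * w.im)) := by
        intro w
        have : (2 * Real.pi * Complex.I * (q * w) : ℂ) =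
            ((2 * Real.pi * q : ℝ) : ℂ) * (Complex.I * w) := by push_cast; ring
        rw [this, Complex.re_ofReal_mul, Complex.I_mul_re]
        ring
      rw [hre, hre, him]
      have hw' : τ₀.im / 2 < w.im := hw
      gcongr
  have hmem : {τ : ℂ | τ₀.im / 2 < τ.im} ∈ 𝓝 τ₀ := hU.mem_nhds (by
    change τ₀.im / 2 < τ₀.im; linarith)
  refine ((hd.differentiableAt hmem).congr_of_eventuallyEq ?_).differentiableWithinAt
  filter_upwards [hmem] with τ hτ
  have h0 : 0 < τ.im := lt_trans (by linarith) (show τ₀.im / 2 < τ.im from hτ)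
  have := (hf (UpperHalfPlane.ofComplex τ)).tsum_eq
  rw [UpperHalfPlane.ofComplex_apply_of_im_pos h0] at this ⊢
  exact this.symm

namespace EvenLattice

variable {s : ℕ} (L : EvenLattice s)

lemma expHalf_mk (x : ℚ) : expHalf (QuotientAddGroup.mk x) =
    Complex.exp (Real.pi * Complex.I * x) := rfl

/-- The systems of functions `Φ_h` on the upper half plane, `h ∈ G_m(L)`, that are the coefficients
of the theta decompositions of Jacobi forms: they have Fourier expansions with nonnegative
exponents in `-q_m(h)/2 + ℤ`, and they transform under `τ ↦ -1/τ` so that `∑ Φ_h ϑ_h` is of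
weight `k`. -/
structure IsVectorForm (k : ℤ) (m : ℕ) [Fintype (L.discGroup m)]
    (Φ : L.discGroup m → UpperHalfPlane → ℂ) : Prop where
  inversion : ∀ τ τ' : UpperHalfPlane, (τ' : ℂ) = -1 / τ → ∀ h',
    inversionFactor (Fintype.card (L.discGroup m)) s τ * ∑ h, Φ h τ' * L.bichar m h h' =
      (τ : ℂ) ^ k * Φ h' τ
  expansion : ∀ h, ∃ c : ℚ → ℂ,
    (∀ q, c q ≠ 0 → 0 ≤ q ∧ QuotientAddGroup.mk (-2 * q) = L.discForm m h) ∧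
    ∀ τ : UpperHalfPlane,
      HasSum (fun q : ℚ => c q * Complex.exp (2 * Real.pi * Complex.I * (q * τ))) (Φ h τ)

/-- Summing over `n` first exhibits `φ(τ, ·)` as a Fourier series in `z` whose coefficients are
functions of `τ`. -/
lemma fiberwise_fourier {c : ℤ × L.dual → ℂ} {φ : UpperHalfPlane × (Fin s → ℂ) → ℂ}
    (hφ : ∀ (τ : UpperHalfPlane) (z : Fin s → ℂ),
      HasSum (fun p : ℤ × L.dual => c p * Complex.exp (2 * Real.pi * Complex.I *
        (p.1 * τ + L.bil ℂ (fun i => (((p.2 : Fin s → ℚ) i : ℚ) : ℂ)) z))) (φ (τ, z)))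
    (τ : UpperHalfPlane) :
    (∀ ℓ, Summable fun n : ℤ => c (n, ℓ) * Complex.exp (2 * Real.pi * Complex.I * (n * τ))) ∧
    ∀ z, HasSum (fun ℓ : L.dual =>
      (∑' n : ℤ, c (n, ℓ) * Complex.exp (2 * Real.pi * Complex.I * (n * τ))) *
        Complex.exp (2 * Real.pi * Complex.I * L.bil ℂ (fun i => ((ℓ : Fin s → ℚ) i : ℂ)) z))
      (φ (τ, z)) := by
  have hsum : ∀ ℓ, Summable fun n : ℤ =>
      c (n, ℓ) * Complex.exp (2 * Real.pi * Complex.I * (n * τ)) := by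
    intro ℓ
    have h0 := ((Equiv.prodComm L.dual ℤ).summable_iff.mpr (hφ τ 0).summable).prod_factor ℓ
    refine h0.congr fun n => ?_
    simp [bil_zero_right]
  refine ⟨hsum, fun z => ?_⟩
  have h1 := (Equiv.prodComm L.dual ℤ).hasSum_iff.mpr (hφ τ z)
  refine h1.prod_fiberwise fun ℓ => ?_
  refine ((hsum ℓ).hasSum.mul_right _).congr_fun fun n => ?_
  simp only [Function.comp, Equiv.prodComm_apply, Prod.swap]
  rw [mul_assoc (c (n, ℓ)), ← Complex.exp_add]
  congr 2
  ring

lemma thetaTerm_ne_zero (m : ℕ) (ℓ : L.dual) (τ : ℂ) (z : Fin s → ℂ) :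
    L.thetaTerm m ℓ τ z ≠ 0 := Complex.exp_ne_zero _

/-- The expansion of a function with the Heisenberg symmetry into theta terms has coefficients
that are periodic modulo `m L`. -/
lemma HeisEq.coeff_add {m : ℕ} (hm : m ≠ 0) {φ : UpperHalfPlane × (Fin s → ℂ) → ℂ}
    (hφ : L.HeisEq m φ) {τ : UpperHalfPlane} {g : L.dual → ℂ}
    (hg : ∀ z, HasSum (fun ℓ => g ℓ * L.thetaTerm m ℓ τ z) (φ (τ, z))) (ℓ : L.dual)
    (x : Fin s → ℤ) : g (ℓ + m • L.ofInt x) = g ℓ := by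
  -- Translation by `xτ` shifts the index by `m x`, so Heisenberg invariance gives a second
  -- expansion of the same function; uniqueness of Fourier coefficients in `z` compares the two.
  have h1 : ∀ z, HasSum (fun ℓ => g (ℓ - m • L.ofInt x) * L.thetaTerm m ℓ τ z) (φ (τ, z)) := by
    intro z
    rw [← (Equiv.addRight (m • L.ofInt x)).hasSum_iff, ← hφ x 0 τ z]
    refine ((hg _).mul_right _).congr_fun fun ℓ => ?_
    simp only [Function.comp, Equiv.coe_addRight, add_sub_cancel_right]
    rw [mul_assoc, L.thetaTerm_heis hm]
  have h2 : ∀ z, HasSum (fun ℓ => (g ℓ - g (ℓ - m • L.ofInt x)) * L.thetaTerm m ℓ τ z) 0 := by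
    intro z
    have := (hg z).sub (h1 z)
    rw [sub_self] at this
    exact this.congr_fun fun ℓ => sub_mul _ _ _
  have h3 := L.dual_fourier_eq_zero (h2 0).summable fun z => by
    rw [← (h2 z).tsum_eq]
    exact tsum_congr fun ℓ => by rw [L.thetaTerm_eq_mul m ℓ τ z, mul_assoc]
  have h4 := congrFun h3 (ℓ + m • L.ofInt x)
  simp only [add_sub_cancel_right, Pi.zero_apply, mul_eq_zero, L.thetaTerm_ne_zero, or_false] at h4
  exact sub_eq_zero.mp h4

/-- Dividing the `ℓ`-th coefficient by `e^{πi S[ℓ]τ/m}` leaves a function of the class of `ℓ` only,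
which is `Φ_h`. The expansion is asserted for every representative `ℓ`, so that its exponents are
tied directly to `2nm - S[ℓ]`. -/
lemma exists_theta_decomposition {m : ℕ} (hm : m ≠ 0) [Fintype (L.discGroup m)]
    {φ : UpperHalfPlane × (Fin s → ℂ) → ℂ} (hH : L.HeisEq m φ) {c : ℤ × L.dual → ℂ}
    (hφ : ∀ (τ : UpperHalfPlane) (z : Fin s → ℂ),
      HasSum (fun p : ℤ × L.dual => c p * Complex.exp (2 * Real.pi * Complex.I *
        (p.1 * τ + L.bil ℂ (fun i => (((p.2 : Fin s → ℚ) i : ℚ) : ℂ)) z))) (φ (τ, z))) :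
    ∃ Φ : L.discGroup m → UpperHalfPlane → ℂ,
      (∀ τ z, φ (τ, z) = ∑ h, Φ h τ * L.theta m h τ z) ∧
      ∀ (ℓ : L.dual) (τ : UpperHalfPlane), HasSum (fun n : ℤ => c (n, ℓ) *
        Complex.exp (2 * Real.pi * Complex.I *
          (((n - L.bil ℚ (ℓ : Fin s → ℚ) ℓ / (2 * m) : ℚ) : ℂ) * τ))) (Φ (L.mkD m ℓ) τ) := by
  have hmC : (m : ℂ) ≠ 0 := by exact_mod_cast hm
  set F : L.dual → UpperHalfPlane → ℂ := fun ℓ τ =>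
    ∑' n : ℤ, c (n, ℓ) * Complex.exp (2 * Real.pi * Complex.I * (n * τ)) with hF
  have hg : ∀ τ z, HasSum (fun ℓ => F ℓ τ / L.thetaTerm m ℓ τ 0 * L.thetaTerm m ℓ τ z)
      (φ (τ, z)) := by
    intro τ z
    refine ((L.fiberwise_fourier hφ τ).2 z).congr_fun fun ℓ => ?_
    rw [L.thetaTerm_eq_mul m ℓ τ z, ← mul_assoc, div_mul_cancel₀ _ (L.thetaTerm_ne_zero m ℓ τ 0)]
  have hcl : ∀ τ ℓ ℓ', L.mkD m ℓ = L.mkD m ℓ' →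
      F ℓ' τ / L.thetaTerm m ℓ' τ 0 = F ℓ τ / L.thetaTerm m ℓ τ 0 := by
    intro τ ℓ ℓ' h
    obtain ⟨x, rfl⟩ := (L.mkD_eq_iff m ℓ ℓ').mp h
    exact HeisEq.coeff_add L hm hH (hg τ) ℓ x
  set r : L.discGroup m → L.dual := Function.surjInv (L.mkD_surjective m)
  have hr : ∀ h, L.mkD m (r h) = h := Function.surjInv_eq (L.mkD_surjective m)
  refine ⟨fun h τ => F (r h) τ / L.thetaTerm m (r h) τ 0, fun τ z => ?_, fun ℓ τ => ?_⟩
  · refine (hg τ z).unique ?_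
    refine (L.hasSum_sum_theta hm (fun h => F (r h) τ / L.thetaTerm m (r h) τ 0) τ z).congr_fun
      fun ℓ => ?_
    rw [hcl τ _ _ (hr (L.mkD m ℓ)).symm]
  · beta_reduce
    rw [hcl τ ℓ (r (L.mkD m ℓ)) (hr _).symm, div_eq_mul_inv]
    refine ((((L.fiberwise_fourier hφ τ).1 ℓ).hasSum).mul_right _).congr_fun fun n => ?_
    rw [mul_assoc (c (n, ℓ)), thetaTerm, ← Complex.exp_neg, ← Complex.exp_add, bil_zero_right]
    congr 2
    push_cast
    field_simp
    ring

/-- The theta decomposition of a Jacobi form. -/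
theorem IsJacobiForm.exists_isVectorForm {k : ℤ} {m : ℕ} (hm : m ≠ 0) [Fintype (L.discGroup m)]
    {φ : UpperHalfPlane × (Fin s → ℂ) → ℂ} (hφ : L.IsJacobiForm k m φ) :
    ∃ Φ : L.discGroup m → UpperHalfPlane → ℂ, L.IsVectorForm k m Φ ∧
      ∀ τ z, φ (τ, z) = ∑ h, Φ h τ * L.theta m h τ z := by
  obtain ⟨c, hc, hcs⟩ := hφ.fourier
  have hmQ : (0 : ℚ) < m := by exact_mod_cast Nat.pos_of_ne_zero hm
  obtain ⟨Φ, hΦ, hΦc⟩ := L.exists_theta_decomposition hm (L.heisEq_of_slash_eq hφ.slash_eq) hcs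
  refine ⟨Φ, ⟨fun τ τ' hτ => ?_, fun h => ?_⟩, hΦ⟩
  · have hS := L.modEq_S_iff.mp (L.modEq_of_slash_eq hφ.slash_eq ModularGroup.S) τ τ' hτ
    -- Both sides of the functional equation are combinations of the `ϑ_{h'}(τ, ·)`; linear
    -- independence equates their coefficients.
    refine congrFun (L.theta_combination_injective hm _ _ τ fun z => ?_)
    have h1 := hS z
    rw [hΦ, hΦ] at h1
    simp only [L.theta_inversion hm _ τ τ' hτ z] at h1
    set E := Complex.exp (Real.pi * Complex.I * m * (L.bil ℂ z z / τ)) with hE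
    have hE0 : E ≠ 0 := Complex.exp_ne_zero _
    apply mul_left_cancel₀ hE0
    calc _ = ∑ h, Φ h τ' * (inversionFactor (Fintype.card (L.discGroup m)) s τ * E *
          ∑ h', L.bichar m h h' * L.theta m h' τ z) := by
          simp only [Finset.mul_sum, Finset.sum_mul]
          rw [Finset.sum_comm]
          refine Finset.sum_congr rfl fun h _ => Finset.sum_congr rfl fun h' _ => by ring
      _ = _ := by
          rw [h1, Finset.mul_sum, Finset.mul_sum]
          exact Finset.sum_congr rfl fun h _ => by ring
  · obtain ⟨ℓ, rfl⟩ := L.mkD_surjective m h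
    set ι : ℤ → ℚ := fun n => n - L.bil ℚ (ℓ : Fin s → ℚ) ℓ / (2 * m) with hι
    have hinj : Function.Injective ι := fun a b hab => by
      simp only [hι, sub_left_inj] at hab
      exact_mod_cast hab
    -- Indexing by all rational exponents, with zero coefficients off the progression `n -
    -- S[ℓ]/(2m)`, removes the representative `ℓ` from the expansion, so that it can be carried to
    -- another lattice.
    refine ⟨Function.extend ι (fun n => c (n, ℓ)) 0, fun q hq => ?_, fun τ => ?_⟩
    · obtain ⟨n, rfl⟩ : ∃ n, ι n = q := by
        by_contra hn
        exact hq (Function.extend_apply' _ _ _ hn)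
      rw [hinj.extend_apply] at hq
      constructor
      · have := hc n ℓ hq
        simp only [hι]
        rw [sub_nonneg, div_le_iff₀ (by positivity)]
        linarith
      · rw [discForm_mkD, discNorm, if_neg hm]
        apply QuotientAddGroup.eq.mpr
        refine AddSubgroup.mem_zmultiples_iff.mpr ⟨n, ?_⟩
        simp only [hι, zsmul_eq_mul]
        field_simp
        ring
    · rw [← hinj.hasSum_iff]
      · refine (hΦc ℓ τ).congr_fun fun n => ?_
        simp only [Function.comp]
        rw [hinj.extend_apply]
      · intro q hq
        rw [Function.extend_apply' _ _ _ hq]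
        simp

end EvenLattice

end

/-! ### From vector-valued forms back to Jacobi forms -/

noncomputable section

open Filter Topology

lemma hasSum_mul_of_hasSum {ι κ : Type*} {f : ι → ℂ} {g : κ → ℂ} {a b : ℂ} (hf : HasSum f a)
    (hg : HasSum g b) : HasSum (fun p : ι × κ => f p.1 * g p.2) (a * b) :=
  hf.mul hg (summable_mul_of_summable_norm hf.summable.norm hg.summable.norm)

namespace EvenLattice

variable {s : ℕ} (L : EvenLattice s)

lemma discChar_eq_of_mk_eq {m : ℕ} {h : L.discGroup m} {q : ℚ}
    (hq : QuotientAddGroup.mk (-2 * q) = L.discForm m h) :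
    L.discChar m h = Complex.exp (-(2 * Real.pi * Complex.I * q)) := by
  rw [discChar, ← hq, expHalf_mk]
  congr 1
  push_cast
  ring

/-- All exponents of `Φ_h` lie in `-q(h)/2 + ℤ`, so every term gains the same factor. The behaviour
under `T` is thus already contained in the expansion and cancels the factor of `ϑ_h`. -/
lemma IsVectorForm.add_one {k : ℤ} {m : ℕ} [Fintype (L.discGroup m)]
    {Φ : L.discGroup m → UpperHalfPlane → ℂ} (hΦ : L.IsVectorForm k m Φ) (h : L.discGroup m)
    (τ τ' : UpperHalfPlane) (hτ : (τ' : ℂ) = τ + 1) : Φ h τ' * L.discChar m h = Φ h τ := by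
  obtain ⟨c, hc, hcs⟩ := hΦ.expansion h
  refine ((hcs τ').mul_right _).unique ((hcs τ).congr_fun fun q => ?_)
  by_cases hq : c q = 0
  · simp [hq]
  · rw [L.discChar_eq_of_mk_eq (hc q hq).2, mul_assoc, ← Complex.exp_add, hτ]
    congr 2
    ring

lemma IsVectorForm.differentiableOn {k : ℤ} {m : ℕ} [Fintype (L.discGroup m)]
    {Φ : L.discGroup m → UpperHalfPlane → ℂ} (hΦ : L.IsVectorForm k m Φ) (h : L.discGroup m) :
    DifferentiableOn ℂ (fun τ : ℂ => Φ h (UpperHalfPlane.ofComplex τ)) {τ | 0 < τ.im} := by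
  obtain ⟨c, hc, hcs⟩ := hΦ.expansion h
  exact differentiableOn_of_hasSum_exp (fun q hq => (hc q hq).1) hcs

lemma hasSum_sum_mul_theta {ι : Type*} {m : ℕ} (hm : m ≠ 0) [Fintype (L.discGroup m)]
    {f : L.discGroup m → ι → ℂ} {a : L.discGroup m → ℂ} (hf : ∀ h, HasSum (f h) (a h))
    (τ : UpperHalfPlane) (z : Fin s → ℂ) :
    HasSum (fun p : ι × L.dual => f (L.mkD m p.2) p.1 * L.thetaTerm m p.2 τ z)
      (∑ h, a h * L.theta m h τ z) := by
  have h2 := fun h => hasSum_mul_of_hasSum (hf h) (L.hasSum_theta hm h τ z)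
  refine (hasSum_sum (s := Finset.univ) fun h _ => h2 h).congr_fun fun p => ?_
  rw [Finset.sum_eq_single (L.mkD m p.2)]
  · rw [if_pos rfl]
  · intro h _ hne
    rw [if_neg hne.symm, mul_zero]
  · intro h
    exact absurd (Finset.mem_univ _) h

/-- The Fourier expansion of `∑ Φ_h ϑ_h`. -/
lemma IsVectorForm.fourier {k : ℤ} {m : ℕ} (hm : m ≠ 0) [Fintype (L.discGroup m)]
    {Φ : L.discGroup m → UpperHalfPlane → ℂ} (hΦ : L.IsVectorForm k m Φ) :
    ∃ c : ℤ × L.dual → ℂ,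
    (∀ (n : ℤ) (ℓ : L.dual), c (n, ℓ) ≠ 0 → 0 ≤ 2 * (n : ℚ) * m - L.bil ℚ ℓ ℓ) ∧
    ∀ (τ : UpperHalfPlane) (z : Fin s → ℂ),
      HasSum (fun p : ℤ × L.dual => c p * Complex.exp (2 * Real.pi * Complex.I *
        (p.1 * τ + L.bil ℂ (fun i => (((p.2 : Fin s → ℚ) i : ℚ) : ℂ)) z)))
        (∑ h, Φ h τ * L.theta m h τ z) := by
  classical
  choose c hc hcs using hΦ.expansion
  have hmQ : (0 : ℚ) < m := by exact_mod_cast Nat.pos_of_ne_zero hm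
  have hmC : (m : ℂ) ≠ 0 := by exact_mod_cast hm
  -- The product of the two series is indexed by `(q, ℓ)`. Its term can be nonzero only if `q +
  -- S[ℓ]/(2m)` is an integer `n`, and reindexing by `(n, ℓ)` gives the Jacobi expansion, with `q ≥
  -- 0` becoming `2nm - S[ℓ] ≥ 0`.
  set ι : ℤ × L.dual → ℚ × L.dual := fun p =>
    (p.1 - L.bil ℚ (p.2 : Fin s → ℚ) p.2 / (2 * m), p.2) with hι
  have hinj : Function.Injective ι := by
    rintro ⟨a, ℓ⟩ ⟨b, ℓ'⟩ hab
    simp only [hι, Prod.mk.injEq] at hab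
    obtain ⟨h1, rfl⟩ := hab
    simp only [sub_left_inj] at h1
    have : a = b := by exact_mod_cast h1
    rw [this]
  refine ⟨fun p => c (L.mkD m p.2) (ι p).1, fun n ℓ hn => ?_, fun τ z => ?_⟩
  · have := (hc _ _ hn).1
    simp only [hι] at this
    rw [sub_nonneg, div_le_iff₀ (by positivity)] at this
    linarith
  · have h1 := L.hasSum_sum_mul_theta hm (fun h => hcs h τ) τ z
    rw [← hinj.hasSum_iff] at h1
    · refine h1.congr_fun fun p => ?_
      simp only [Function.comp]
      rw [mul_assoc (c _ _), thetaTerm, ← Complex.exp_add]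
      congr 2
      simp only [hι]
      push_cast
      field_simp
      ring
    · rintro ⟨q, ℓ⟩ hq
      by_cases hcq : c (L.mkD m ℓ) q = 0
      · simp [hcq]
      · exfalso
        apply hq
        have h3 := (hc _ _ hcq).2
        rw [discForm_mkD, discNorm, if_neg hm] at h3
        obtain ⟨n, hn⟩ := AddSubgroup.mem_zmultiples_iff.mp (QuotientAddGroup.eq.mp h3)
        refine ⟨(n, ℓ), ?_⟩
        simp only [hι, Prod.mk.injEq, and_true]
        simp only [zsmul_eq_mul] at hn
        field_simp at hn ⊢
        linear_combination hn

/-- The converse of the theta decomposition. -/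
theorem IsVectorForm.isJacobiForm {k : ℤ} {m : ℕ} (hm : m ≠ 0) [Fintype (L.discGroup m)]
    {Φ : L.discGroup m → UpperHalfPlane → ℂ} (hΦ : L.IsVectorForm k m Φ) :
    L.IsJacobiForm k m (fun p => ∑ h, Φ h p.1 * L.theta m h p.1 p.2) where
  holo := by
    refine DifferentiableOn.fun_sum fun h _ => ?_
    refine DifferentiableOn.mul ?_ (L.differentiableOn_theta hm h)
    exact (IsVectorForm.differentiableOn L hΦ h).comp differentiableOn_fst fun p hp => hp
  slash_eq := by
    refine L.slash_eq_of_heisEq_modEq ?_ (L.modEq_of_generators ?_ ?_)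
    · intro x y τ z
      rw [Finset.sum_mul]
      refine Finset.sum_congr rfl fun h _ => ?_
      rw [mul_assoc, L.theta_heis hm]
    · refine L.modEq_S_iff.mpr fun τ τ' hτ z => ?_
      simp only [L.theta_inversion hm _ τ τ' hτ z]
      set E := Complex.exp (Real.pi * Complex.I * m * (L.bil ℂ z z / τ)) with hE
      calc _ = E * ∑ h', (inversionFactor (Fintype.card (L.discGroup m)) s τ *
            ∑ h, Φ h τ' * L.bichar m h h') * L.theta m h' τ z := by
            simp only [Finset.mul_sum, Finset.sum_mul]
            rw [Finset.sum_comm]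
            refine Finset.sum_congr rfl fun h _ => Finset.sum_congr rfl fun h' _ => by ring
        _ = _ := by
            rw [Finset.mul_sum, Finset.mul_sum]
            refine Finset.sum_congr rfl fun h _ => ?_
            rw [hΦ.inversion τ τ' hτ]
            ring
    · refine L.modEq_T_iff.mpr fun τ τ' hτ z => ?_
      refine Finset.sum_congr rfl fun h _ => ?_
      rw [L.theta_add_one hm h τ τ' hτ z, ← mul_assoc, IsVectorForm.add_one L hΦ h τ τ' hτ]
  fourier := IsVectorForm.fourier L hm hΦ

/-! ### Transfer along an isometry of discriminant groups -/

variable {s₁ s₂ : ℕ} {M₁ : EvenLattice s₁} {M₂ : EvenLattice s₂} {m₁ m₂ : ℕ}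

lemma discChar_map {σ : M₁.discGroup m₁ ≃+ M₂.discGroup m₂}
    (hσ : ∀ h, M₂.discForm m₂ (σ h) = M₁.discForm m₁ h) (h : M₁.discGroup m₁) :
    M₂.discChar m₂ (σ h) = M₁.discChar m₁ h := by
  rw [discChar, discChar, hσ]

/-- The bicharacter is built from `e^{πi q}` and the group law alone, so an isometry respects it. -/
lemma bichar_map {σ : M₁.discGroup m₁ ≃+ M₂.discGroup m₂}
    (hσ : ∀ h, M₂.discForm m₂ (σ h) = M₁.discForm m₁ h) (h h' : M₁.discGroup m₁) :
    M₂.bichar m₂ (σ h) (σ h') = M₁.bichar m₁ h h' := by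
  rw [bichar, bichar, ← map_add, discChar_map hσ, discChar_map hσ, discChar_map hσ]

/-- Milgram's formula forces the dimensions to agree modulo `8`. -/
lemma exists_dim_sub_eq (hm₁ : m₁ ≠ 0) (hm₂ : m₂ ≠ 0) (σ : M₁.discGroup m₁ ≃+ M₂.discGroup m₂)
    (hσ : ∀ h, M₂.discForm m₂ (σ h) = M₁.discForm m₁ h) :
    ∃ t : ℤ, (s₂ : ℤ) - s₁ = 8 * t := by
  have := M₁.finite_discGroup hm₁
  have := M₂.finite_discGroup hm₂
  have := Fintype.ofFinite (M₁.discGroup m₁)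
  have := Fintype.ofFinite (M₂.discGroup m₂)
  have h1 := M₁.gauss_sum hm₁
  have h2 := M₂.gauss_sum hm₂
  rw [← σ.toEquiv.sum_comp, ← Fintype.card_congr σ.toEquiv] at h2
  have h3 : ∀ h, M₂.discChar m₂ (σ.toEquiv h) = M₁.discChar m₁ h := discChar_map hσ
  simp only [h3] at h2
  have h4 : ((Real.sqrt (Fintype.card (M₁.discGroup m₁)) : ℝ) : ℂ) ≠ 0 := by
    have : Real.sqrt (Fintype.card (M₁.discGroup m₁)) ≠ 0 := by
      have := Fintype.card_pos (α := M₁.discGroup m₁)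
      positivity
    exact_mod_cast this
  have h5 := mul_left_cancel₀ h4 (h1.symm.trans h2)
  obtain ⟨t, ht⟩ := Complex.exp_eq_exp_iff_exists_int.mp h5
  refine ⟨t, ?_⟩
  have h6 : ((s₂ : ℂ) - s₁) * (Real.pi * Complex.I) = 8 * t * (Real.pi * Complex.I) := by
    linear_combination 4 * ht
  have h7 := mul_right_cancel₀
    (mul_ne_zero (by exact_mod_cast Real.pi_ne_zero) Complex.I_ne_zero) h6
  exact_mod_cast h7

/-- Raising the dimension by `8t` changes the exponent by the integer `4t`, and `(-i)^{4t} = 1`.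
Only a power of `τ` appears, with no multiplier left over. -/
lemma inversionFactor_of_dim_sub_eq (N : ℕ) {t : ℤ} (ht : (s₂ : ℤ) - s₁ = 8 * t)
    (τ : UpperHalfPlane) :
    inversionFactor N s₂ τ = inversionFactor N s₁ τ * (τ : ℂ) ^ (4 * t) := by
  have h1 : (s₂ / 2 : ℂ) = s₁ / 2 + ((4 * t : ℤ) : ℂ) := by
    have : (s₂ : ℂ) - s₁ = 8 * t := by exact_mod_cast ht
    push_cast
    linear_combination this / 2
  have h0 : -Complex.I * (τ : ℂ) ≠ 0 :=
    mul_ne_zero (neg_ne_zero.mpr Complex.I_ne_zero) τ.ne_zero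
  have h2 : (-Complex.I : ℂ) ^ (4 * t) = 1 := by
    rw [zpow_mul]
    have : (-Complex.I : ℂ) ^ (4 : ℤ) = 1 := by
      rw [show (4 : ℤ) = ((4 : ℕ) : ℤ) from rfl, zpow_natCast, neg_pow, Complex.I_pow_four]
      norm_num
    rw [this, one_zpow]
  rw [inversionFactor, inversionFactor, h1, Complex.cpow_add _ _ h0, Complex.cpow_intCast,
    mul_zpow, h2, one_mul, mul_assoc]

/-- The kernel of the inversion, the order of the group and the classes of the exponents are
invariants of the quadratic module; the dimension enters only through the factor `τ^{4t}`, which the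
weight absorbs. -/
lemma IsVectorForm.map [Fintype (M₁.discGroup m₁)] [Fintype (M₂.discGroup m₂)]
    {σ : M₁.discGroup m₁ ≃+ M₂.discGroup m₂}
    (hσ : ∀ h, M₂.discForm m₂ (σ h) = M₁.discForm m₁ h) {t : ℤ} (ht : (s₂ : ℤ) - s₁ = 8 * t)
    {k : ℤ} {Φ : M₁.discGroup m₁ → UpperHalfPlane → ℂ} (hΦ : M₁.IsVectorForm k m₁ Φ) :
    M₂.IsVectorForm (k + 4 * t) m₂ (fun h => Φ (σ.symm h)) where
  inversion := by
    intro τ τ' hτ h'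
    have h1 := hΦ.inversion τ τ' hτ (σ.symm h')
    rw [inversionFactor_of_dim_sub_eq _ ht, ← Fintype.card_congr σ.toEquiv,
      ← σ.toEquiv.sum_comp, zpow_add₀ τ.ne_zero]
    have h2 : ∀ h, Φ (σ.symm (σ.toEquiv h)) τ' * M₂.bichar m₂ (σ.toEquiv h) h' =
        Φ h τ' * M₁.bichar m₁ h (σ.symm h') := by
      intro h
      have := bichar_map hσ h (σ.symm h')
      rw [σ.apply_symm_apply] at this
      rw [← this]
      simp
    simp only [h2]
    linear_combination (τ : ℂ) ^ (4 * t) * h1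
  expansion := by
    intro h
    obtain ⟨c, hc, hcs⟩ := hΦ.expansion (σ.symm h)
    refine ⟨c, fun q hq => ⟨(hc q hq).1, ?_⟩, hcs⟩
    rw [(hc q hq).2, ← hσ, σ.apply_symm_apply]

end EvenLattice

end

noncomputable section

namespace EvenLattice

variable {s : ℕ} (L : EvenLattice s)

/-! ### Index zero -/

/-- For `m = 0` the group `G_m(L)` is the dual lattice. -/
def discGroupZeroEquiv : L.dual ≃+ L.discGroup 0 :=
  AddEquiv.ofBijective (QuotientAddGroup.mk' ((L.multiple 0).addSubgroupOf L.dual))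
    ⟨fun ℓ ℓ' h => by
      obtain ⟨α, hα⟩ := (L.mkD_eq_iff 0 ℓ ℓ').mp h
      rw [hα, zero_nsmul, add_zero], L.mkD_surjective 0⟩

lemma infinite_discGroup_zero (hs : 0 < s) : Infinite (L.discGroup 0) := by
  have : Nonempty (Fin s) := ⟨⟨0, hs⟩⟩
  exact Infinite.of_injective _ (L.dualEquiv.symm.trans L.discGroupZeroEquiv).injective

lemma bil_self_pos {x : Fin s → ℚ} (hx : x ≠ 0) : 0 < L.bil ℚ x x := by
  obtain ⟨c, hc, h⟩ := L.exists_coercive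
  have h1 := h fun i => (x i : ℝ)
  rw [bil_ratCast_real] at h1
  have h2 : (fun i => (x i : ℝ)) ≠ 0 := fun h0 => hx (by
    funext i
    have := congrFun h0 i
    simpa using this)
  have h3 : 0 < ‖fun i => (x i : ℝ)‖ := norm_pos_iff.mpr h2
  have h4 : (0 : ℝ) < (L.bil ℚ x x : ℚ) := lt_of_lt_of_le (by positivity) h1
  exact_mod_cast h4

/-- Jacobi forms of index zero do not depend on `z`. -/
lemma IsJacobiForm.hasSum_of_index_zero {k : ℤ} {φ : UpperHalfPlane × (Fin s → ℂ) → ℂ}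
    (hφ : L.IsJacobiForm k 0 φ) : ∃ c : ℤ → ℂ, ∀ (τ : UpperHalfPlane) (z : Fin s → ℂ),
      HasSum (fun n : ℤ => c n * Complex.exp (2 * Real.pi * Complex.I * (n * τ))) (φ (τ, z)) := by
  obtain ⟨c, hc, hcs⟩ := hφ.fourier
  refine ⟨fun n => c (n, 0), fun τ z => ?_⟩
  have hinj : Function.Injective fun n : ℤ => (n, (0 : L.dual)) := fun a b h => by simpa using h
  have h1 := hinj.hasSum_iff (f := fun p : ℤ × L.dual => c p * Complex.exp (2 * Real.pi *
    Complex.I * (p.1 * τ + L.bil ℂ (fun i => (((p.2 : Fin s → ℚ) i : ℚ) : ℂ)) z)))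
    (a := φ (τ, z)) ?_
  · refine (h1.mpr (hcs τ z)).congr_fun fun n => ?_
    have h0 : L.bil ℂ (fun i => ((((0 : L.dual) : Fin s → ℚ) i : ℚ) : ℂ)) z = 0 := by
      simp [bil]
    simp only [Function.comp, h0, add_zero]
  · rintro ⟨n, ℓ⟩ hn
    have h2 : (ℓ : Fin s → ℚ) ≠ 0 := fun h0 => hn ⟨n, by
      rw [show ℓ = 0 from Subtype.ext h0]⟩
    have h3 : c (n, ℓ) = 0 := by
      by_contra h4
      have h5 := hc n ℓ h4
      have h6 := L.bil_self_pos h2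
      simp only [Nat.cast_zero, mul_zero, zero_sub] at h5
      linarith
    simp [h3]

lemma IsJacobiForm.apply_eq_of_index_zero {k : ℤ} {φ : UpperHalfPlane × (Fin s → ℂ) → ℂ}
    (hφ : L.IsJacobiForm k 0 φ) (τ : UpperHalfPlane) (z : Fin s → ℂ) : φ (τ, z) = φ (τ, 0) := by
  obtain ⟨c, hc⟩ := IsJacobiForm.hasSum_of_index_zero L hφ
  exact (hc τ z).unique (hc τ 0)

variable {s₁ s₂ : ℕ} (M₁ : EvenLattice s₁) (M₂ : EvenLattice s₂)

/-- In index zero all exponential factors are trivial, so the functional equations at `z = 0`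
involve only the weight and `SL(2, ℤ)`; the new Fourier expansion is supported on `ℓ = 0`. -/
lemma IsJacobiForm.transfer_of_index_zero {k : ℤ} {φ : UpperHalfPlane × (Fin s₁ → ℂ) → ℂ}
    (hφ : M₁.IsJacobiForm k 0 φ) : M₂.IsJacobiForm k 0 (fun p => φ (p.1, 0)) where
  holo := by
    refine hφ.holo.comp (f := fun p : ℂ × (Fin s₂ → ℂ) => (p.1, (0 : Fin s₁ → ℂ))) ?_
      fun p hp => hp
    exact (differentiable_fst.prodMk (differentiable_const _)).differentiableOn
  slash_eq := by
    refine M₂.slash_eq_of_heisEq_modEq ?_ fun A => ?_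
    · intro x y τ z
      simp
    · intro τ z
      have := M₁.modEq_of_slash_eq hφ.slash_eq A τ 0
      rw [smul_zero] at this
      simpa using this
  fourier := by
    obtain ⟨c, hc⟩ := IsJacobiForm.hasSum_of_index_zero M₁ hφ
    classical
    refine ⟨fun p => if p.2 = 0 then c p.1 else 0, fun n ℓ h => ?_, fun τ z => ?_⟩
    · have : ℓ = 0 := by by_contra h0; simp [h0] at h
      subst this
      simp [bil]
    · have hinj : Function.Injective fun n : ℤ => (n, (0 : M₂.dual)) := fun a b h => by
        simpa using h
      rw [← hinj.hasSum_iff]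
      · refine (hc τ 0).congr_fun fun n => ?_
        have h0 : M₂.bil ℂ (fun i => ((((0 : M₂.dual) : Fin s₂ → ℚ) i : ℚ) : ℂ)) z = 0 := by
          simp [bil]
        simp only [Function.comp, h0, add_zero, if_true]
      · rintro ⟨n, ℓ⟩ hn
        have h2 : ℓ ≠ 0 := fun h0 => hn ⟨n, by rw [h0]⟩
        simp [h2]

/-- Jacobi forms of index zero do not depend on the lattice. -/
def jacobiFormsZeroEquiv (k : ℤ) : M₁.JacobiForms k 0 ≃ₗ[ℂ] M₂.JacobiForms k 0 where
  toFun φ := ⟨fun p => φ.1 (p.1, 0), IsJacobiForm.transfer_of_index_zero M₁ M₂ φ.2⟩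
  map_add' _ _ := rfl
  map_smul' _ _ := rfl
  invFun φ := ⟨fun p => φ.1 (p.1, 0), IsJacobiForm.transfer_of_index_zero M₂ M₁ φ.2⟩
  left_inv φ := Subtype.ext (funext fun p =>
    (IsJacobiForm.apply_eq_of_index_zero M₁ φ.2 p.1 p.2).symm)
  right_inv φ := Subtype.ext (funext fun p =>
    (IsJacobiForm.apply_eq_of_index_zero M₂ φ.2 p.1 p.2).symm)

/-! ### Positive index -/

/-- The map `Φ ↦ ∑ Φ_h ϑ_h`. -/
def thetaMap (m : ℕ) [Fintype (L.discGroup m)] : (L.discGroup m → UpperHalfPlane → ℂ) →ₗ[ℂ]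
    (UpperHalfPlane × (Fin s → ℂ) → ℂ) where
  toFun Φ p := ∑ h, Φ h p.1 * L.theta m h p.1 p.2
  map_add' Φ Ψ := by
    funext p
    simp [add_mul, Finset.sum_add_distrib]
  map_smul' a Φ := by
    funext p
    simp [Finset.mul_sum, mul_assoc]

lemma thetaMap_apply (m : ℕ) [Fintype (L.discGroup m)]
    (Φ : L.discGroup m → UpperHalfPlane → ℂ) (p : UpperHalfPlane × (Fin s → ℂ)) :
    L.thetaMap m Φ p = ∑ h, Φ h p.1 * L.theta m h p.1 p.2 := rfl

lemma isThetaDecomposition_iff (m : ℕ) [Fintype (L.discGroup m)]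
    (φ : UpperHalfPlane × (Fin s → ℂ) → ℂ) (Φ : L.discGroup m → UpperHalfPlane → ℂ) :
    L.IsThetaDecomposition m φ Φ ↔ L.thetaMap m Φ = φ := by
  constructor
  · intro h
    funext p
    rw [thetaMap_apply, ← finsum_eq_sum_of_fintype]
    exact (h p.1 p.2).symm
  · rintro rfl τ z
    rw [thetaMap_apply, finsum_eq_sum_of_fintype]

lemma thetaMap_injective {m : ℕ} (hm : m ≠ 0) [Fintype (L.discGroup m)] :
    Function.Injective (L.thetaMap m) := by
  intro Φ Ψ h
  funext h₀ τ
  refine congrFun (L.theta_combination_injective hm (fun h => Φ h τ) (fun h => Ψ h τ) τ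
    fun z => ?_) h₀
  exact congrFun h (τ, z)

/-- A Jacobi form has some vector form as theta coefficients; injectivity of the theta map shows
that it is the given system. -/
lemma mem_comap_thetaMap {m : ℕ} (hm : m ≠ 0) [Fintype (L.discGroup m)] {k : ℤ}
    {Φ : L.discGroup m → UpperHalfPlane → ℂ} :
    Φ ∈ (L.JacobiForms k m).comap (L.thetaMap m) ↔ L.IsVectorForm k m Φ := by
  constructor
  · intro h
    obtain ⟨Ψ, hΨ, h1⟩ := IsJacobiForm.exists_isVectorForm L hm (show L.IsJacobiForm k m _ from h)
    rwa [L.thetaMap_injective hm (a₁ := Φ) (a₂ := Ψ) (funext fun p => h1 p.1 p.2)]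
  · exact fun h => IsVectorForm.isJacobiForm L hm h

/-- Jacobi forms are identified with their theta coefficients. -/
def thetaEquiv {m : ℕ} (hm : m ≠ 0) [Fintype (L.discGroup m)] (k : ℤ) :
    (L.JacobiForms k m).comap (L.thetaMap m) ≃ₗ[ℂ] L.JacobiForms k m :=
  LinearEquiv.ofBijective ((L.thetaMap m).restrict fun _ h => h) (by
    constructor
    · intro Φ Ψ h
      exact Subtype.ext (L.thetaMap_injective hm (congrArg Subtype.val h))
    · intro φ
      obtain ⟨Φ, hΦ, h1⟩ := IsJacobiForm.exists_isVectorForm L hm φ.2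
      exact ⟨⟨Φ, (L.mem_comap_thetaMap hm).mpr hΦ⟩,
        Subtype.ext (funext fun p => (h1 p.1 p.2).symm)⟩)

lemma coe_thetaEquiv {m : ℕ} (hm : m ≠ 0) [Fintype (L.discGroup m)] (k : ℤ)
    (Φ : (L.JacobiForms k m).comap (L.thetaMap m)) :
    (L.thetaEquiv hm k Φ : UpperHalfPlane × (Fin s → ℂ) → ℂ) = L.thetaMap m Φ := rfl

variable {M₁ M₂} {m₁ m₂ : ℕ}

/-- The isomorphism of spaces of Jacobi forms that swaps the theta functions. -/
theorem exists_jacobiForms_equiv (hm₁ : m₁ ≠ 0) (hm₂ : m₂ ≠ 0) [Fintype (M₁.discGroup m₁)]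
    [Fintype (M₂.discGroup m₂)] (σ : M₁.discGroup m₁ ≃+ M₂.discGroup m₂)
    (hσ : ∀ h, M₂.discForm m₂ (σ h) = M₁.discForm m₁ h) {t : ℤ} (ht : (s₂ : ℤ) - s₁ = 8 * t)
    (k : ℤ) : ∃ e : M₁.JacobiForms k m₁ ≃ₗ[ℂ] M₂.JacobiForms (k + 4 * t) m₂,
      ∀ (φ : M₁.JacobiForms k m₁) (Φ : M₁.discGroup m₁ → UpperHalfPlane → ℂ),
        M₁.thetaMap m₁ Φ = φ → M₂.thetaMap m₂ (fun h => Φ (σ.symm h)) = e φ := by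
  have hσ' : ∀ h, M₁.discForm m₁ (σ.symm h) = M₂.discForm m₂ h := fun h => by
    rw [← hσ, σ.apply_symm_apply]
  have hmap : ((M₁.JacobiForms k m₁).comap (M₁.thetaMap m₁)).map
      (LinearEquiv.funCongrLeft ℂ (UpperHalfPlane → ℂ) σ.symm.toEquiv : _ →ₗ[ℂ] _) =
      (M₂.JacobiForms (k + 4 * t) m₂).comap (M₂.thetaMap m₂) := by
    ext Ψ
    rw [Submodule.mem_map, M₂.mem_comap_thetaMap hm₂]
    constructor
    · rintro ⟨Φ, hΦ, rfl⟩
      exact IsVectorForm.map hσ ht ((M₁.mem_comap_thetaMap hm₁).mp hΦ)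
    · intro hΨ
      refine ⟨fun h => Ψ (σ h), (M₁.mem_comap_thetaMap hm₁).mpr ?_, ?_⟩
      -- Surjectivity is the same transfer applied to `σ⁻¹`, with the dimension difference reversed.
      · have := IsVectorForm.map (t := -t) hσ' (by linarith) hΨ
        rwa [mul_neg, add_neg_cancel_right] at this
      · funext h
        change Ψ (σ (σ.symm h)) = Ψ h
        rw [σ.apply_symm_apply]
  refine ⟨(M₁.thetaEquiv hm₁ k).symm.trans ((LinearEquiv.ofSubmodules _ _ _ hmap).trans
    (M₂.thetaEquiv hm₂ (k + 4 * t))), fun φ Φ hΦ => ?_⟩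
  have h1 : (M₁.thetaEquiv hm₁ k).symm φ = ⟨Φ, show M₁.thetaMap m₁ Φ ∈ _ from hΦ ▸ φ.2⟩ := by
    rw [LinearEquiv.symm_apply_eq]
    exact Subtype.ext hΦ.symm
  rw [LinearEquiv.trans_apply, LinearEquiv.trans_apply, h1, coe_thetaEquiv]
  rfl

end EvenLattice

end

/-! ### The two cases: index zero and positive index -/

theorem lemma4p10 {s₁ s₂ : ℕ} (hs₁ : 0 < s₁) (hs₂ : 0 < s₂)
    (M₁ : EvenLattice s₁) (M₂ : EvenLattice s₂) (k : ℤ) (m₁ m₂ : ℕ)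
    (σ : M₁.discGroup m₁ ≃+ M₂.discGroup m₂)
    (hσ : ∀ h : M₁.discGroup m₁, M₂.discForm m₂ (σ h) = M₁.discForm m₁ h) :
    ∃ k₂ : ℤ, (k₂ : ℚ) = k + ((s₂ : ℚ) - s₁) / 2 ∧
      ∃ e : M₁.JacobiForms k m₁ ≃ₗ[ℂ] M₂.JacobiForms k₂ m₂,
        0 < m₁ → ∀ φ : M₁.JacobiForms k m₁,
          (∃! Φ : M₁.discGroup m₁ → UpperHalfPlane → ℂ, M₁.IsThetaDecomposition m₁ φ Φ) ∧
          ∀ Φ : M₁.discGroup m₁ → UpperHalfPlane → ℂ, M₁.IsThetaDecomposition m₁ φ Φ →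
            M₂.IsThetaDecomposition m₂ (e φ) (fun h => Φ (σ.symm h)) := by
  by_cases hm₁ : m₁ = 0
  · subst hm₁
    -- In positive dimension the group is infinite for index zero, and it is finite for positive
    -- index, so a bijection cannot mix the two cases.
    obtain rfl : m₂ = 0 := by
      by_contra hm₂
      have := M₁.infinite_discGroup_zero hs₁
      have := M₂.finite_discGroup hm₂
      exact not_finite_iff_infinite.mpr (Infinite.of_injective _ σ.injective) this
    -- Both groups are the dual lattices, free of ranks `s₁` and `s₂`; the additive isomorphism
    -- alone forces equal dimensions.
    have e₀ : (Fin s₁ → ℤ) ≃+ (Fin s₂ → ℤ) := M₁.dualEquiv.symm.trans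
      (M₁.discGroupZeroEquiv.trans (σ.trans (M₂.discGroupZeroEquiv.symm.trans M₂.dualEquiv)))
    have hs : s₁ = s₂ := by
      have := e₀.toIntLinearEquiv.finrank_eq
      simpa using this
    subst hs
    exact ⟨k, by simp, EvenLattice.jacobiFormsZeroEquiv M₁ M₂ k, fun h => absurd h (lt_irrefl 0)⟩
  · have hm₂ : m₂ ≠ 0 := by
      rintro rfl
      have := M₂.infinite_discGroup_zero hs₂
      have := M₁.finite_discGroup hm₁
      exact not_finite_iff_infinite.mpr (Infinite.of_injective _ σ.symm.injective) this
    have := M₁.finite_discGroup hm₁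
    have := M₂.finite_discGroup hm₂
    have := Fintype.ofFinite (M₁.discGroup m₁)
    have := Fintype.ofFinite (M₂.discGroup m₂)
    obtain ⟨t, ht⟩ := EvenLattice.exists_dim_sub_eq hm₁ hm₂ σ hσ
    obtain ⟨e, he⟩ := EvenLattice.exists_jacobiForms_equiv hm₁ hm₂ σ hσ ht k
    refine ⟨k + 4 * t, ?_, e, fun _ φ => ⟨?_, fun Φ hΦ => ?_⟩⟩
    · have : (s₂ : ℚ) - s₁ = 8 * t := by exact_mod_cast ht
      rw [this]
      push_cast
      ring
    · obtain ⟨Φ, -, hΦ⟩ := EvenLattice.IsJacobiForm.exists_isVectorForm M₁ hm₁ φ.2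
      refine ⟨Φ, ?_, fun Ψ hΨ => ?_⟩
      · exact (M₁.isThetaDecomposition_iff m₁ _ _).mpr (funext fun p => (hΦ p.1 p.2).symm)
      · have hΨ' := (M₁.isThetaDecomposition_iff m₁ _ _).mp hΨ
        exact M₁.thetaMap_injective hm₁ (hΨ'.trans (funext fun p => hΦ p.1 p.2))
    · rw [M₁.isThetaDecomposition_iff] at hΦ
      exact (M₂.isThetaDecomposition_iff m₂ _ _).mpr (he φ Φ hΦ)
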